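/- Let $n\ge 2$ and consider the strict-feedback system $$\dot x_i=f_i(\bar x_i)+g_i(\bar x_i)x_{i+1}\ (1\le i\le n-1),\qquad \dot x_n=f_n(\bar x_n)+g_n(\bar x_n)u,\qquad y=x_1,$$ with $\bar x_i=(x_1,\dots,x_i)$ and $f_i,g_i:\mathbb R^i\to\mathbb R$ continuous. Assume: (A1) the reference $y_d:[0,\infty)\to\mathbb R$ and its derivatives up to order $n+1$ are bounded and piecewise continuous (so those up to order $n$ are continuous, and $y_d^{(n+1)}$ exists and is continuous off a locally finite set and has one-sided limits); (A2) $|f_i|\le b_i\phi_i$ with unknown constants $b_i\ge 0$ and known smooth functions $\phi_i\ge 0$ on $\mathbb R^i$; (A3) $0<\underline g_i\le g_i\le\bar g_i$ for constants $\underline g_i,\bar g_i$. **Performance functions.** Put $e_1=x_1-y_d$, $s=\operatorname{sign}(e_1(0))$ (with $\operatorname{sign}0=0$), $\rho(t)=(\rho_0-\rho_\infty)e^{-\varsigma t}+\rho_\infty$ with $\rho_0>\rho_\infty>0$, $\varsigma>0$, and for $0<\delta<1$ let $e_u=(\delta+s)\rho-\rho_\infty s$, $e_l=(\delta-s)\rho+\rho_\infty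 s$. Let $T>0$ and let $\eta_u,\eta_l:[0,\infty)\to\mathbb R$ be auxiliary functions: their derivatives of order $0,\dots,n+1$ are continuous and bounded; $\eta_u(0)>e_1(0)-e_u(0)$ and $\eta_l(0)<e_1(0)+e_l(0)$; $\eta_u,\eta_l,\dot\eta_u,\dot\eta_l\to0$ as $t\to T$; $\eta_u\ge\eta_l$ on $[0,\infty)$; and $\eta_u=\eta_l=0$ on $[T,\infty)$. Put $E_u=e_u+\eta_u$, $E_l=e_l-\eta_l$. **Controller.** Let $c_i,r_i,\sigma_i>0$. Put $\ell=\frac1{(e_1+E_l)(E_u-e_1)}$, $\mu_1=\ell(E_u+E_l)$, $\mu_2=\ell\big((\dot e_l-\dot\eta_l)(E_u-e_1)-(\dot e_u+\dot\eta_u)(E_l+e_1)\big)$, $z_1=\ln\frac{E_l+e_1}{E_u-e_1}$, $\Phi_1=\mu_1^2\dot y_d^2+\mu_1^2\phi_1^2+\mu_2^2$, $\alpha_1=-\frac1{\mu_1}(c_1z_1+z_1\hat\theta_1\Phi_1)$, and, for $i=2,\dots,n$, $e_i=x_i-\alpha_{i-1}$, $$\Phi_i=\sum_{k=1}^{i-1}\Big(\tfrac{\partial\alpha_{i-1}}{\partial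 x_k}\phi_k\Big)^2+\sum_{k=1}^{i-1}\Big(\tfrac{\partial\alpha_{i-1}}{\partial x_k}x_{k+1}\Big)^2+(\Delta\alpha_{i-1})^2+\epsilon_{i-1}+\phi_i^2+\kappa_i,$$ where $\epsilon_1=\mu_1^2z_1^2$, $\epsilon_j=e_j^2$ for $j\ge2$, $\kappa_n=1$, $\kappa_i=0$ for $i<n$, and $$\Delta\alpha_j=\sum_{\xi\in\{y_d,\rho,\eta_u,\eta_l\}}\ \sum_{k=0}^{j}\frac{\partial\alpha_j}{\partial\xi^{(k)}}\,\xi^{(k+1)}+\sum_{k=1}^{j}\frac{\partial\alpha_j}{\partial\hat\theta_k}\dot{\hat\theta}_k .$$ The virtual controls are $\alpha_i=-(c_ie_i+\hat\theta_ie_i\Phi_i)$ for $2\le i\le n-1$, the actual control is $v=-(c_ne_n+\hat\theta_ne_n\Phi_n)$, and the adaptive laws are $\dot{\hat\theta}_1=r_1z_1^2\Phi_1-\sigma_1\hat\theta_1$ and $\dot{\hat\theta}_i=r_ie_i^2\Phi_i-\sigma_i\hat\theta_i$ ($i\ge2$), with $\hat\theta_i(0)\ge0$. **Coded event-triggered scheme.**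 Let $p\ge2$ be even, $m\ge1$, $s_c=p^m/2$, $0=\pi_0<\dots<\pi_{s_c-1}<\pi_{s_c}=+\infty$ and $\omega_0,\dots,\omega_{s_c-1}>0$. Put $t_0=0$, $u(t)=v(t_k)$ for $t\in[t_k,t_{k+1})$ and $$t_{k+1}=\inf\{t>t_k:\ |v(t)-v(t_k)|\ge\omega_qp^{q}\},\qquad\text{where } |v(t_k)|\in[\pi_q,\pi_{q+1}),$$ with $\inf\emptyset=\infty$. At $t_{k+1}$ the $m$-digit base-$p$ expansion of $q$ (if $v(t_{k+1})>v(t_k)$) or of $q+s_c$ (otherwise) is sent to the actuator. The actuator reads $\beta$ as the transmitted number and adds $\omega_\beta p^\beta$ to its stored input if the leading digit is less than $p/2$; otherwise it reads $\beta$ as the transmitted number minus $s_c$ and subtracts $\omega_\beta p^\beta$. It starts from $v(0)$. **Theorem.** For all initial states $x(0)\in\mathbb R^n$ and all initial estimates $\hat\theta(0)$ with $\hat\theta_i(0)\ge 0$, a closed-loop solution on $[0,\infty)$ exists, and every closed-loop solution that cannot be continued to a larger time interval is defined on $[0,\infty)$ and satisfies: (i) $-E_l(t)<e_1(t)<E_u(t)$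 for all $t\ge0$, and $-e_l(t)<e_1(t)<e_u(t)$ for all $t\ge T$; (ii) all closed-loop signals are bounded on $[0,\infty)$: $x_i$, $\hat\theta_i$, $\dot{\hat\theta}_i$, $e_i$, $z_1$, $\mu_1$, $\mu_2$, $\Phi_i$, $\alpha_i$, $v$ and $u$; (iii) Zeno behavior is excluded: there is $t^*>0$ such that $t_{k+1}-t_k\ge t^*$ for all $k$ with $t_k<\infty$. Moreover, at every event the input that the actuator reconstructs from the strings is $v(t_k)$. -/

import Mathlib

open Set Filter Topology
open scoped ContDiff

/-! ### The plant -/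

/-- The data of a strict-feedback system
`x_i' = f_i (x_1, …, x_i) + g_i (x_1, …, x_i) x_{i+1}` for `i < n`,
`x_n' = f_n (x_1, …, x_n) + g_n (x_1, …, x_n) u`.
Indices are shifted by one: `i : Fin n` stands for the index `i + 1`. -/
structure Plant (n : ℕ) where
  f : (i : Fin n) → (Fin (i.val + 1) → ℝ) → ℝ
  g : (i : Fin n) → (Fin (i.val + 1) → ℝ) → ℝ

/-- The truncated state `(x_1, …, x_i)`. -/
def headState {n : ℕ} (x : Fin n → ℝ) (i : Fin n) : Fin (i.val + 1) → ℝ :=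
  fun j => x (Fin.castLE i.isLt j)

/-- The right-hand side of the `i`-th state equation at state `x` and input `u`. -/
def Plant.rhs {n : ℕ} (P : Plant n) (x : Fin n → ℝ) (u : ℝ) (i : Fin n) : ℝ :=
  P.f i (headState x i) +
    P.g i (headState x i) * (if h : i.val + 1 < n then x ⟨i.val + 1, h⟩ else u)

/-! ### Reference trajectory -/

/-- The `k`-th time derivative of a signal that lives on `[0, ∞)` (one-sided at `0`). -/
noncomputable def timeDeriv (k : ℕ) (y : ℝ → ℝ) : ℝ → ℝ :=
  iteratedDerivWithin k y (Ici 0)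

/-- `y` and its derivatives up to order `n + 1` are bounded and piecewise continuous on `[0, ∞)`.
The derivatives up to order `n` are then continuous; the derivative of order `n + 1` exists and is
continuous off a set with finitely many points in each bounded interval, and it has one-sided
limits everywhere. -/
structure IsReference (n : ℕ) (y : ℝ → ℝ) : Prop where
  smooth : ContDiffOn ℝ n y (Ici 0)
  bounded : ∀ k ≤ n + 1, ∃ M : ℝ, ∀ t, 0 ≤ t → |timeDeriv k y t| ≤ M
  piecewise : ∃ D : Set ℝ, (∀ R : ℝ, (D ∩ Icc 0 R).Finite) ∧
    ∀ t, 0 ≤ t → t ∉ D →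
      DifferentiableWithinAt ℝ (timeDeriv n y) (Ici 0) t ∧
      ContinuousWithinAt (timeDeriv (n + 1) y) (Ici 0) t
  right_limit : ∀ t, 0 ≤ t → ∃ l : ℝ, Tendsto (timeDeriv (n + 1) y) (𝓝[>] t) (𝓝 l)
  left_limit : ∀ t, 0 < t → ∃ l : ℝ, Tendsto (timeDeriv (n + 1) y) (𝓝[<] t) (𝓝 l)

/-! ### Variables of the control law -/

/-- The variables that the virtual controls are functions of: the states `x_i`, the parameter
estimates `θ̂_i`, and the time derivatives of order `0, …, n` of the reference `y_d`, of the
performance function `ρ` and of the auxiliary functions `η_u`, `η_l`. -/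
inductive Var (n : ℕ) where
  | state (i : Fin n)
  | est (i : Fin n)
  | ref (k : Fin (n + 1))
  | perf (k : Fin (n + 1))
  | auxU (k : Fin (n + 1))
  | auxL (k : Fin (n + 1))
deriving DecidableEq, Fintype

/-- The partial derivative `∂F/∂v` at the point `w`. -/
noncomputable def partialDeriv {n : ℕ} (F : (Var n → ℝ) → ℝ) (v : Var n) (w : Var n → ℝ) : ℝ :=
  deriv (fun s => F (Function.update w v s)) (w v)

/-! ### The design -/

/-- All data of the controller (apart from the transmission scheme), and the initial condition. -/
structure Design (n : ℕ) where
  /-- desired trajectory -/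
  yd : ℝ → ℝ
  /-- auxiliary functions -/
  ηu : ℝ → ℝ
  ηl : ℝ → ℝ
  /-- performance parameters `δ`, `ρ_0`, `ρ_∞`, `ς` -/
  δ : ℝ
  ρzero : ℝ
  ρinf : ℝ
  ς : ℝ
  /-- settling time -/
  T : ℝ
  /-- control gains `c_i`, adaptation gains `r_i`, leakage gains `σ_i` -/
  c : Fin n → ℝ
  r : Fin n → ℝ
  σ : Fin n → ℝ
  /-- known bounding functions `φ_i` -/
  φ : (i : Fin n) → (Fin (i.val + 1) → ℝ) → ℝ
  /-- initial state of the plant -/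
  xinit : Fin n → ℝ
  /-- initial values of the parameter estimates -/
  θinit : Fin n → ℝ

/-- The two functions of a stage `i` of the backstepping design from which everything else is
built: the error (`z_1` in the first stage, `e_i` in the later ones) and `Φ_i`. -/
structure Stage (n : ℕ) where
  err : (Var n → ℝ) → ℝ
  reg : (Var n → ℝ) → ℝ

namespace Design

variable {n : ℕ} [NeZero n] (D : Design n)

/-- `e_1(0)`. -/
def einit : ℝ := D.xinit 0 - D.yd 0

/-- `sign (e_1(0))`, with `sign 0 = 0`. -/
noncomputable def sgn : ℝ := Real.sign D.einit

/-- `ρ(t) = (ρ_0 - ρ_∞) exp (-ς t) + ρ_∞`. -/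
noncomputable def ρ (t : ℝ) : ℝ := (D.ρzero - D.ρinf) * Real.exp (-D.ς * t) + D.ρinf

/-- The prescribed upper boundary `e_u(t)`. -/
noncomputable def upper (t : ℝ) : ℝ := (D.δ + D.sgn) * D.ρ t - D.ρinf * D.sgn

/-- The function `e_l(t)`; the prescribed lower boundary is `-e_l(t)`. -/
noncomputable def lower (t : ℝ) : ℝ := (D.δ - D.sgn) * D.ρ t + D.ρinf * D.sgn

/-- The defining properties of the auxiliary functions `η_u`, `η_l`. -/
structure IsAuxiliary : Prop where
  smooth : ContDiffOn ℝ (n + 1 : ℕ) D.ηu (Ici 0) ∧ ContDiffOn ℝ (n + 1 : ℕ) D.ηl (Ici 0)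
  bounded : ∀ k ≤ n + 1, ∃ M : ℝ, ∀ t, 0 ≤ t →
    |timeDeriv k D.ηu t| ≤ M ∧ |timeDeriv k D.ηl t| ≤ M
  init_upper : D.einit - D.upper 0 < D.ηu 0
  init_lower : D.ηl 0 < D.einit + D.lower 0
  tendsto_zero : ∀ k ≤ 1, Tendsto (timeDeriv k D.ηu) (𝓝 D.T) (𝓝 0) ∧
    Tendsto (timeDeriv k D.ηl) (𝓝 D.T) (𝓝 0)
  le : ∀ t, 0 ≤ t → D.ηl t ≤ D.ηu t
  eq_zero : ∀ t, D.T ≤ t → D.ηu t = 0 ∧ D.ηl t = 0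

/-- The requirements on the design parameters. -/
structure IsAdmissible : Prop where
  δ_pos : 0 < D.δ
  δ_lt : D.δ < 1
  ρinf_pos : 0 < D.ρinf
  ρinf_lt : D.ρinf < D.ρzero
  ς_pos : 0 < D.ς
  T_pos : 0 < D.T
  c_pos : ∀ i, 0 < D.c i
  r_pos : ∀ i, 0 < D.r i
  σ_pos : ∀ i, 0 < D.σ i
  θinit_nonneg : ∀ i, 0 ≤ D.θinit i

/-! The quantities of the first design step, as functions of the variables. Those that contain a
logarithm or a quotient have their meaning where `-E_l < e_1 < E_u`. -/

/-- `e_1 = x_1 - y_d`. -/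
def e₁ (w : Var n → ℝ) : ℝ := w (.state 0) - w (.ref 0)

/-- `E_u = e_u + η_u`. -/
noncomputable def Eu (w : Var n → ℝ) : ℝ :=
  ((D.δ + D.sgn) * w (.perf 0) - D.ρinf * D.sgn) + w (.auxU 0)

/-- `E_l = e_l - η_l`. -/
noncomputable def El (w : Var n → ℝ) : ℝ :=
  ((D.δ - D.sgn) * w (.perf 0) + D.ρinf * D.sgn) - w (.auxL 0)

/-- The time derivative of `E_u`. -/
noncomputable def dEu (w : Var n → ℝ) : ℝ := (D.δ + D.sgn) * w (.perf 1) + w (.auxU 1)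

/-- The time derivative of `E_l`. -/
noncomputable def dEl (w : Var n → ℝ) : ℝ := (D.δ - D.sgn) * w (.perf 1) - w (.auxL 1)

/-- `ℓ = 1 / ((e_1 + E_l) (E_u - e_1))`. -/
noncomputable def ell (w : Var n → ℝ) : ℝ := 1 / ((e₁ w + D.El w) * (D.Eu w - e₁ w))

/-- `μ_1 = ℓ (E_u + E_l)`. -/
noncomputable def μ₁ (w : Var n → ℝ) : ℝ := D.ell w * (D.Eu w + D.El w)

/-- `μ_2 = ℓ (E_l' (E_u - e_1) - E_u' (E_l + e_1))`. -/
noncomputable def μ₂ (w : Var n → ℝ) : ℝ :=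
  D.ell w * (D.dEl w * (D.Eu w - e₁ w) - D.dEu w * (D.El w + e₁ w))

/-- `z_1 = ln ((E_l + e_1) / (E_u - e_1))`. -/
noncomputable def z₁ (w : Var n → ℝ) : ℝ := Real.log ((D.El w + e₁ w) / (D.Eu w - e₁ w))

/-- `φ_i` as a function of the variables. -/
def φAt (i : Fin n) (w : Var n → ℝ) : ℝ := D.φ i (headState (fun j => w (.state j)) i)

/-- `Φ_1 = μ_1² y_d'² + μ_1² φ_1² + μ_2²`. -/
noncomputable def Φ₁ (w : Var n → ℝ) : ℝ :=
  (D.μ₁ w) ^ 2 * (w (.ref 1)) ^ 2 + (D.μ₁ w) ^ 2 * (D.φAt 0 w) ^ 2 + (D.μ₂ w) ^ 2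

/-- The control of a stage: `α_1 = -(1/μ_1) (c_1 z_1 + z_1 θ̂_1 Φ_1)` in the first stage and
`α_i = -(c_i e_i + θ̂_i e_i Φ_i)` in the later ones. -/
noncomputable def stageControl (i : Fin n) (L : Stage n) (w : Var n → ℝ) : ℝ :=
  if i = 0 then -(1 / D.μ₁ w) * (D.c i * L.err w + L.err w * w (.est i) * L.reg w)
  else -(D.c i * L.err w + w (.est i) * L.err w * L.reg w)

/-- The adaptive law of a stage: `θ̂_i' = r_i e_i² Φ_i - σ_i θ̂_i`, with `z_1` for `e_1`. -/
noncomputable def stageRate (i : Fin n) (L : Stage n) (w : Var n → ℝ) : ℝ :=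
  D.r i * (L.err w) ^ 2 * L.reg w - D.σ i * w (.est i)

/-- The backstepping recursion. In the step from `i` to `i + 1` (indices shifted by one),
`α` is the virtual control of stage `i`, and `Δα` is the computable part of its time derivative,
`∑_k ∂α/∂y_d^(k) y_d^(k+1) + (the same for ρ, η_u, η_l) + ∑_k ∂α/∂θ̂_k θ̂_k'`
(derivatives `k` of an order that `α` does not involve contribute `0`). -/
noncomputable def stage (D : Design n) : (i : ℕ) → i < n → Stage n
  | 0, _ => { err := D.z₁, reg := D.Φ₁ }
  | i + 1, hi =>
    let L : Stage n := stage D i (by omega)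
    let α : (Var n → ℝ) → ℝ := D.stageControl ⟨i, by omega⟩ L
    let Δα : (Var n → ℝ) → ℝ := fun w =>
      (∑ k : Fin n,
        (partialDeriv α (.ref k.castSucc) w * w (.ref k.succ) +
         partialDeriv α (.perf k.castSucc) w * w (.perf k.succ) +
         partialDeriv α (.auxU k.castSucc) w * w (.auxU k.succ) +
         partialDeriv α (.auxL k.castSucc) w * w (.auxL k.succ))) +
      ∑ k : Fin (i + 1), partialDeriv α (.est ⟨k.val, by omega⟩) w *
        D.stageRate ⟨k.val, by omega⟩ (stage D k.val (by omega)) w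
    { err := fun w => w (.state ⟨i + 1, hi⟩) - α w
      reg := fun w =>
        (∑ k : Fin (i + 1),
          (partialDeriv α (.state ⟨k.val, by omega⟩) w * D.φAt ⟨k.val, by omega⟩ w) ^ 2) +
        (∑ k : Fin (i + 1),
          (partialDeriv α (.state ⟨k.val, by omega⟩) w *
            w (.state ⟨k.val + 1, by omega⟩)) ^ 2) +
        (Δα w) ^ 2 +
        (if i = 0 then (D.μ₁ w) ^ 2 * (D.z₁ w) ^ 2 else (L.err w) ^ 2) +
        (D.φAt ⟨i + 1, hi⟩ w) ^ 2 +
        (if i + 2 = n then 1 else 0) }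
termination_by i => i
decreasing_by all_goals omega

/-- `z_1` for `i = 0`, and `e_{i+1} = x_{i+1} - α_i` for `i > 0`. -/
noncomputable def err (i : Fin n) : (Var n → ℝ) → ℝ := (D.stage i.val i.isLt).err

/-- `Φ_{i+1}`. -/
noncomputable def Φ (i : Fin n) : (Var n → ℝ) → ℝ := (D.stage i.val i.isLt).reg

/-- `α_{i+1}`; for the last index this is the actual control `v`. -/
noncomputable def control (i : Fin n) : (Var n → ℝ) → ℝ :=
  D.stageControl i (D.stage i.val i.isLt)

/-- The right-hand side of the adaptive law of `θ̂_{i+1}`. -/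
noncomputable def rate (i : Fin n) : (Var n → ℝ) → ℝ :=
  D.stageRate i (D.stage i.val i.isLt)

/-- The last index. -/
def top (n : ℕ) [NeZero n] : Fin n := ⟨n - 1, Nat.sub_lt (NeZero.pos n) Nat.one_pos⟩

/-- The values of the variables at time `t` when the state is `x` and the estimate is `θ`. -/
noncomputable def point (t : ℝ) (x θ : Fin n → ℝ) : Var n → ℝ
  | .state i => x i
  | .est i => θ i
  | .ref k => timeDeriv k.val D.yd t
  | .perf k => iteratedDeriv k.val D.ρ t
  | .auxU k => timeDeriv k.val D.ηu t
  | .auxL k => timeDeriv k.val D.ηl t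

end Design

/-! ### The coded event-triggered scheme -/

/-- The parameters: an even base `p`, the length `m` of the transmitted strings, the switching
levels `0 = π_0 < π_1 < … < π_{s_c - 1}` (with `π_{s_c} = ∞`) and the positive constants
`ω_0, …, ω_{s_c - 1}` (the field `wgt`), where `s_c = p^m / 2`. -/
structure CodedScheme where
  p : ℕ
  m : ℕ
  p_pos : 0 < p
  p_even : Even p
  m_pos : 0 < m
  lvl : ℕ → ℝ
  wgt : ℕ → ℝ
  lvl_zero : lvl 0 = 0
  lvl_lt : ∀ q, q + 1 < p ^ m / 2 → lvl q < lvl (q + 1)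
  wgt_pos : ∀ q, q < p ^ m / 2 → 0 < wgt q

namespace CodedScheme

variable (S : CodedScheme)

/-- `s_c = p^m / 2`. -/
def sc : ℕ := S.p ^ S.m / 2

/-- The index `q < s_c` with `|a| ∈ [π_q, π_{q+1})`. -/
noncomputable def level (a : ℝ) : ℕ := by
  classical exact Nat.findGreatest (fun q => S.lvl q ≤ |a|) (S.sc - 1)

/-- The threshold `ω_β p^β`. -/
def step (β : ℕ) : ℝ := S.wgt β * (S.p : ℝ) ^ β

/-- The threshold that is in force while the input `a` is applied. -/
noncomputable def threshold (a : ℝ) : ℝ := S.step (S.level a)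

/-- The string of `m` digits in base `p` (the digit with index `j` has weight `p^j`) that is sent
when the control signal error is `d` and the level is `b`: it is the expansion of `b` if `0 < d`,
and of `b + s_c` otherwise. -/
noncomputable def encode (d : ℝ) (b : ℕ) : Fin S.m → Fin S.p :=
  open Classical in
  fun j => ⟨(if 0 < d then b else b + S.sc) / S.p ^ j.val % S.p, Nat.mod_lt _ S.p_pos⟩

/-- The number that a string denotes. -/
def value (s : Fin S.m → Fin S.p) : ℕ := ∑ j, (s j).val * S.p ^ j.val

/-- The update of the input `a` on reception of the string `s`; the leading digit carries the
sign. -/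
noncomputable def decode (s : Fin S.m → Fin S.p) (a : ℝ) : ℝ :=
  if (s ⟨S.m - 1, Nat.sub_lt S.m_pos Nat.one_pos⟩).val < S.p / 2 then a + S.step (S.value s)
  else a - S.step (S.value s - S.sc)

end CodedScheme

/-! ### Closed-loop executions -/

/-- A solution of the closed loop on `[0, horizon)`, where `0 ≤ horizon ≤ ∞`; horizon `0` is the
bare initial condition. Event times may be `⊤` (the event does not occur before the horizon), and
they may accumulate at the horizon. -/
structure Execution {n : ℕ} [NeZero n] (P : Plant n) (D : Design n) (S : CodedScheme) where
  horizon : EReal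
  horizon_nonneg : 0 ≤ horizon
  /-- state of the plant -/
  x : ℝ → Fin n → ℝ
  /-- parameter estimates -/
  θ : ℝ → Fin n → ℝ
  /-- actual control signal, before sampling -/
  v : ℝ → ℝ
  /-- input that is applied to the plant -/
  u : ℝ → ℝ
  /-- event times `t_k` -/
  event : ℕ → EReal
  x_init : x 0 = D.xinit
  θ_init : θ 0 = D.θinit
  x_cont : ContinuousOn x {t | 0 ≤ t ∧ (t : EReal) < horizon}
  θ_cont : ContinuousOn θ {t | 0 ≤ t ∧ (t : EReal) < horizon}
  x_deriv : ∀ t : ℝ, 0 ≤ t → (t : EReal) < horizon → ∀ i,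
    HasDerivWithinAt (fun s => x s i) (P.rhs (x t) (u t) i) (Ici t) t
  θ_deriv : ∀ t : ℝ, 0 ≤ t → (t : EReal) < horizon → ∀ i,
    HasDerivWithinAt (fun s => θ s i) (D.rate i (D.point t (x t) (θ t))) (Ici t) t
  v_eq : ∀ t : ℝ, v t = D.control (Design.top n) (D.point t (x t) (θ t))
  event_zero : event 0 = 0
  event_succ : ∀ k, event (k + 1) = sInf {s : EReal | ∃ t : ℝ, s = t ∧
    event k < t ∧ (t : EReal) < horizon ∧
    S.threshold (v (event k).toReal) ≤ |v t - v (event k).toReal|}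
  covered : ∀ t : ℝ, 0 ≤ t → (t : EReal) < horizon →
    ∃ k, event k ≤ t ∧ (t : EReal) < event (k + 1)
  hold : ∀ t : ℝ, 0 ≤ t → (t : EReal) < horizon →
    ∀ k, event k ≤ t → (t : EReal) < event (k + 1) → u t = v (event k).toReal

namespace Execution

variable {n : ℕ} [NeZero n] {P : Plant n} {D : Design n} {S : CodedScheme}

/-- No execution with a larger horizon continues `E`. -/
def IsMaximal (E : Execution P D S) : Prop :=
  ¬ ∃ E' : Execution P D S, E.horizon < E'.horizon ∧
    ∀ t : ℝ, 0 ≤ t → (t : EReal) < E.horizon → E'.x t = E.x t ∧ E'.θ t = E.θ t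

/-- The values of the variables at time `t` along the execution. -/
noncomputable def pt (E : Execution P D S) (t : ℝ) : Var n → ℝ := D.point t (E.x t) (E.θ t)

/-- `e_1(t) = x_1(t) - y_d(t)`. -/
def trackingError (E : Execution P D S) (t : ℝ) : ℝ := E.x t 0 - D.yd t

/-- `v(t_k)`. -/
noncomputable def sample (E : Execution P D S) (k : ℕ) : ℝ := E.v (E.event k).toReal

/-- The string that is sent to the actuator at the event `k + 1`. -/
noncomputable def codeword (E : Execution P D S) (k : ℕ) : Fin S.m → Fin S.p :=
  S.encode (E.sample (k + 1) - E.sample k) (S.level (E.sample k))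

/-- The input `u_d` that the actuator reconstructs at the events: it knows `v(t_0)`, and after that
it only uses the received strings. -/
noncomputable def decoded (E : Execution P D S) : ℕ → ℝ
  | 0 => E.sample 0
  | k + 1 => S.decode (E.codeword k) (E.decoded k)

end Execution

/-!
The closed loop is a strict-feedback system whose input is a sampled version of the backstepping
control. The theorem rests on a Lyapunov estimate whose constants do not depend on the execution,
and on a continuation argument for the hybrid system.

**Lyapunov estimate.** As long as `-E_l < e_1 < E_u`, the controls of the stages are smooth
functions of the variables (`Design.contDiffOn_err_Φ`), and the control of stage `i` involves
derivatives of the reference up to order `i` only (`Design.dependsOn_control`; `i` counts from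
one). So the errors `z_1, e_2, …, e_n` have the right derivatives `Design.errRate`, obtained by
the chain rule. In `e_i e_i'` every uncertain term is the product of an unknown constant and of a
known function whose square is a summand of `Φ_i`, so Young's inequality bounds it by a constant
plus a part of `e_i² Φ_i`; the coupling with the next stage is absorbed by `e_{i+1}² Φ_{i+1}`, and
the sampling error, which is at most the largest threshold, by the summand `1` of `Φ_n`. The
estimates `θ̂_i`, which stay nonnegative, cancel the multiples of `e_i² Φ_i`. This gives
`V' ≤ C - κ V` for the function `Design.lyapunov` (`Design.lyapunovRate_le`). Hence `V` is bounded, a bound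
on `z_1` keeps `e_1` at a positive distance from the boundaries, and the tracking error can never
reach them (`Execution.exists_uniform_bound`). The states are then bounded one after the other,
and all executions stay in one compact set of safe values (`Execution.exists_compact`). All
signals are continuous on it, and the control is uniformly continuous along the trajectories,
which gives a minimal time between events (`Execution.exists_minimal_time`).

**Existence and continuation.** The functions `f_i` and `g_i` are merely continuous, so local
solutions come from Peano's theorem (`exists_local_solution`), proved here with delayed integral
equations and the Arzelà–Ascoli theorem. The events and the applied input are determined by the
trajectory (`Execution.exists_of_trajectory`), which allows executions to be united along chains,
and Zorn's lemma yields a maximal one. An execution with a finite horizon has a limit there and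
only finitely many events, so it can be continued (`Execution.not_isMaximal_of_finite_horizon`).

**Coding.** At an event the control signal has moved by exactly the threshold, by continuity, and
the transmitted string encodes the level and the sign (`CodedScheme.decode_encode`).
-/

/-! ### The Peano existence theorem -/

section Peano

variable {E : Type*} [NormedAddCommGroup E] [NormedSpace ℝ E]

/-- Iterates of the integral operator `y ↦ y₀ + ∫ F (s, y (s - d)) ds` with delay `d`, started at
the constant `y₀`. On each bounded interval they become stationary. -/
noncomputable def delayIterate (F : ℝ × E → E) (y₀ : E) (d : ℝ) : ℕ → ℝ → E
  | 0 => fun _ => y₀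
  | j + 1 => fun t => y₀ + ∫ s in (0 : ℝ)..max 0 t, F (s, delayIterate F y₀ d j (s - d))

variable {F : ℝ × E → E} {y₀ : E} {d M : ℝ}

theorem continuous_delayIterate (hF : Continuous F) (j : ℕ) :
    Continuous (delayIterate F y₀ d j) := by
  induction j with
  | zero => exact continuous_const
  | succ j ih =>
    have h : Continuous fun s => F (s, delayIterate F y₀ d j (s - d)) := by fun_prop
    have h2 : Continuous fun t => ∫ s in (0 : ℝ)..t, F (s, delayIterate F y₀ d j (s - d)) :=
      intervalIntegral.continuous_primitive (fun a b => h.intervalIntegrable a b) 0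
    exact continuous_const.add (h2.comp (continuous_const.max continuous_id))

theorem delayIterate_of_nonpos (j : ℕ) {t : ℝ} (ht : t ≤ 0) : delayIterate F y₀ d j t = y₀ := by
  cases j with
  | zero => rfl
  | succ j => simp [delayIterate, max_eq_left ht]

theorem delayIterate_succ_eq (hd : 0 ≤ d) (j : ℕ) {t : ℝ} (ht : t ≤ j * d) :
    delayIterate F y₀ d (j + 1) t = delayIterate F y₀ d j t := by
  induction j generalizing t with
  | zero =>
    have ht' : t ≤ 0 := by simpa using ht
    rw [delayIterate_of_nonpos _ ht', delayIterate_of_nonpos _ ht']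
  | succ j ih =>
    change y₀ + _ = y₀ + _
    congr 1
    apply intervalIntegral.integral_congr
    intro s hs
    rw [uIcc_of_le (le_max_left _ _)] at hs
    have h0 : (0 : ℝ) ≤ ((j + 1 : ℕ) : ℝ) * d := by positivity
    have hs2 : s ≤ ((j + 1 : ℕ) : ℝ) * d := hs.2.trans (max_le h0 ht)
    push_cast at hs2
    simp only
    rw [ih (by linarith)]

theorem lipschitz_delayIterate (hF : Continuous F) (hM : ∀ p, ‖F p‖ ≤ M) (j : ℕ) (s t : ℝ) :
    ‖delayIterate F y₀ d j t - delayIterate F y₀ d j s‖ ≤ M * |t - s| := by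
  have hM0 : 0 ≤ M := (norm_nonneg _).trans (hM (0, 0))
  cases j with
  | zero => simpa [delayIterate] using by positivity
  | succ j =>
    have h : Continuous fun s => F (s, delayIterate F y₀ d j (s - d)) := by
      have := continuous_delayIterate (y₀ := y₀) (d := d) hF j
      fun_prop
    have e : delayIterate F y₀ d (j + 1) t - delayIterate F y₀ d (j + 1) s =
        ∫ r in max 0 s..max 0 t, F (r, delayIterate F y₀ d j (r - d)) := by
      change y₀ + _ - (y₀ + _) = _
      rw [add_sub_add_left_eq_sub]
      exact intervalIntegral.integral_interval_sub_left (h.intervalIntegrable _ _)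
        (h.intervalIntegrable _ _)
    rw [e]
    refine (intervalIntegral.norm_integral_le_of_norm_le_const fun r _ => hM _).trans ?_
    have h' := abs_max_sub_max_le_abs t s 0
    rw [max_comm t, max_comm s] at h'
    exact mul_le_mul_of_nonneg_left h' hM0

/-- Peano's theorem for a bounded continuous vector field: the delayed iterates have a uniformly
convergent subsequence by the Arzelà–Ascoli theorem, and its limit solves the integral equation. -/
theorem exists_solution_unit_of_bounded [FiniteDimensional ℝ E] (hF : Continuous F)
    (hM : ∀ p, ‖F p‖ ≤ M) (y₀ : E) :
    ∃ y : ℝ → E, y 0 = y₀ ∧ Continuous y ∧ ∀ t ∈ Icc (0 : ℝ) 1, HasDerivAt y (F (t, y t)) t := by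
  have hM0 : 0 ≤ M := (norm_nonneg _).trans (hM (0, 0))
  have : ProperSpace E := FiniteDimensional.proper ℝ E
  have : CompleteSpace E := FiniteDimensional.complete ℝ E
  let d : ℕ → ℝ := fun k => 1 / ((k : ℝ) + 1)
  have hd : ∀ k, 0 < d k := fun k => by positivity
  let z : ℕ → ℝ → E := fun k => delayIterate F y₀ (d k) (k + 1)
  have hzc : ∀ k, Continuous (z k) := fun k => continuous_delayIterate hF _
  have hzl : ∀ k s t, ‖z k t - z k s‖ ≤ M * |t - s| := fun k s t =>
    lipschitz_delayIterate hF hM _ s t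
  have hz0 : ∀ k, z k 0 = y₀ := fun k => delayIterate_of_nonpos _ le_rfl
  have hzfix : ∀ k, ∀ t ∈ Icc (0 : ℝ) 1, z k t = y₀ + ∫ s in (0 : ℝ)..t, F (s, z k (s - d k)) := by
    intro k t ht
    have h1 : delayIterate F y₀ (d k) (k + 1 + 1) t = z k t := by
      apply delayIterate_succ_eq (hd k).le
      have : (((k + 1 : ℕ) : ℝ)) * d k = 1 := by
        simp only [d]; push_cast; field_simp
      rw [this]; exact ht.2
    rw [← h1]
    change y₀ + _ = _
    rw [max_eq_right ht.1]
  -- restriction to the compact interval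
  let Z : ℕ → BoundedContinuousFunction (Icc (0 : ℝ) 1) E := fun k =>
    BoundedContinuousFunction.mkOfCompact ⟨fun t => z k t, (hzc k).comp continuous_subtype_val⟩
  have hcomp : IsCompact (closure (range Z)) := by
    apply BoundedContinuousFunction.arzela_ascoli (Metric.closedBall y₀ M)
      (isCompact_closedBall _ _)
    · rintro f t ⟨k, rfl⟩
      have h := hzl k 0 t
      rw [hz0] at h
      rw [Metric.mem_closedBall, dist_eq_norm]
      refine h.trans ?_
      have : |(t : ℝ) - 0| ≤ 1 := by
        rw [sub_zero, abs_of_nonneg t.2.1]; exact t.2.2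
      nlinarith
    · apply Metric.equicontinuous_of_continuity_modulus (fun r => M * r)
      · have : Tendsto (fun r : ℝ => M * r) (𝓝 0) (𝓝 (M * 0)) := tendsto_id.const_mul M
        simpa using this
      · rintro s t ⟨f, k, rfl⟩
        rw [dist_eq_norm]
        exact hzl k t s
  obtain ⟨W, -, φ, hφ, hW⟩ := hcomp.tendsto_subseq (fun k => subset_closure (mem_range_self k))
  have hWp : ∀ t : Icc (0 : ℝ) 1, Tendsto (fun k => z (φ k) t) atTop (𝓝 (W t)) := fun t =>
    (continuous_eval_const t).continuousAt.tendsto.comp hW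
  let w : ℝ → E := fun t => W (projIcc 0 1 zero_le_one t)
  have hwc : Continuous w := W.continuous.comp continuous_projIcc
  have hwp : ∀ t ∈ Icc (0 : ℝ) 1, Tendsto (fun k => z (φ k) t) atTop (𝓝 (w t)) := by
    intro t ht
    have := hWp ⟨t, ht⟩
    simpa [w, projIcc_of_mem _ ht] using this
  have hdlim : Tendsto (fun k => d (φ k)) atTop (𝓝 0) :=
    tendsto_one_div_add_atTop_nhds_zero_nat.comp hφ.tendsto_atTop
  have hwd : ∀ t ∈ Icc (0 : ℝ) 1, Tendsto (fun k => z (φ k) (t - d (φ k))) atTop (𝓝 (w t)) := by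
    intro t ht
    have h1 : Tendsto (fun k => z (φ k) (t - d (φ k)) - z (φ k) t) atTop (𝓝 0) := by
      apply squeeze_zero_norm (a := fun k => M * d (φ k))
      · intro k
        refine (hzl (φ k) t (t - d (φ k))).trans (le_of_eq ?_)
        rw [sub_sub_cancel_left, abs_neg, abs_of_pos (hd _)]
      · simpa using hdlim.const_mul M
    simpa using h1.add (hwp t ht)
  have hint : ∀ t ∈ Icc (0 : ℝ) 1, w t = y₀ + ∫ s in (0 : ℝ)..t, F (s, w s) := by
    intro t ht
    refine tendsto_nhds_unique (hwp t ht) ?_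
    have e : (fun k => z (φ k) t) = fun k => y₀ + ∫ s in (0 : ℝ)..t,
        F (s, z (φ k) (s - d (φ k))) := funext fun k => hzfix (φ k) t ht
    rw [e]
    refine tendsto_const_nhds.add ?_
    apply intervalIntegral.tendsto_integral_filter_of_dominated_convergence (fun _ => M)
    · refine Eventually.of_forall fun k => Continuous.aestronglyMeasurable ?_
      have := hzc (φ k)
      fun_prop
    · exact Eventually.of_forall fun k => Eventually.of_forall fun s _ => hM _
    · simp
    · refine Eventually.of_forall fun s hs => ?_
      rw [uIoc_of_le ht.1] at hs
      have hs' : s ∈ Icc (0 : ℝ) 1 := ⟨hs.1.le, hs.2.trans ht.2⟩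
      exact (hF.tendsto (s, w s)).comp (tendsto_const_nhds.prodMk_nhds (hwd s hs'))
  have hFw : Continuous fun s => F (s, w s) := by fun_prop
  refine ⟨fun t => y₀ + ∫ s in (0 : ℝ)..t, F (s, w s), by simp, ?_, ?_⟩
  · exact continuous_const.add
      (intervalIntegral.continuous_primitive (fun a b => hFw.intervalIntegrable a b) 0)
  · intro t ht
    beta_reduce
    rw [← hint t ht]
    exact (intervalIntegral.integral_hasDerivAt_right (hFw.intervalIntegrable _ _)
      hFw.aestronglyMeasurable.stronglyMeasurableAtFilter hFw.continuousAt).const_add y₀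

/-- **Peano's existence theorem**, for a vector field that is continuous on a box. -/
theorem exists_local_solution {ι : Type*} [Fintype ι] {F : ℝ × (ι → ℝ) → ι → ℝ} {t₀ r : ℝ}
    {y₀ : ι → ℝ} (hr : 0 < r)
    (hF : ContinuousOn F (Icc t₀ (t₀ + r) ×ˢ Icc (fun i => y₀ i - r) (fun i => y₀ i + r))) :
    ∃ ε > 0, ∃ y : ℝ → ι → ℝ, ε ≤ r ∧ y t₀ = y₀ ∧ Continuous y ∧
      ∀ t ∈ Icc t₀ (t₀ + ε), y t ∈ Icc (fun i => y₀ i - r) (fun i => y₀ i + r) ∧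
        HasDerivAt y (F (t, y t)) t := by
  classical
  set B := Icc t₀ (t₀ + r) ×ˢ Icc (fun i => y₀ i - r) (fun i => y₀ i + r) with hB
  have hlo : (fun i => y₀ i - r) ≤ fun i => y₀ i + r := fun i => by dsimp; linarith
  have hto : t₀ ≤ t₀ + r := by linarith
  -- clamping to the box extends the field to a bounded continuous one
  let π : ℝ × (ι → ℝ) → ℝ × (ι → ℝ) := fun p =>
    (max t₀ (min (t₀ + r) p.1), fun i => max (y₀ i - r) (min (y₀ i + r) (p.2 i)))
  have hπ : ∀ p, π p ∈ B := fun p =>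
    ⟨⟨le_max_left _ _, max_le hto (min_le_left _ _)⟩,
      fun i => le_max_left _ _, fun i => max_le (hlo i) (min_le_left _ _)⟩
  have hπc : Continuous π := by fun_prop
  have hπid : ∀ p ∈ B, π p = p := by
    rintro ⟨t, y⟩ ⟨⟨h1, h2⟩, h3, h4⟩
    ext i
    · simp only [π]; rw [min_eq_right h2, max_eq_right h1]
    · simp only [π]; rw [min_eq_right (h4 i), max_eq_right (h3 i)]
  obtain ⟨M, hM⟩ := (isCompact_Icc.prod isCompact_Icc).exists_bound_of_continuousOn hF
  have hGc : Continuous fun p => F (π p) := hF.comp_continuous hπc hπ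
  let G : ℝ × (ι → ℝ) → ι → ℝ := fun p => F (π (t₀ + p.1, p.2))
  have hG : Continuous G := hGc.comp (by fun_prop)
  have hGM : ∀ p, ‖G p‖ ≤ M := fun p => hM _ (hπ _)
  have hM0 : 0 ≤ M := (norm_nonneg _).trans (hGM 0)
  obtain ⟨y, hy0, hyc, hy⟩ := exists_solution_unit_of_bounded hG hGM y₀
  refine ⟨min (min r 1) (r / (M + 1)), by positivity, fun t => y (t - t₀),
    (min_le_left _ _).trans (min_le_left _ _), by simpa using hy0, by fun_prop, ?_⟩
  intro t ht
  have ht1 : t - t₀ ∈ Icc (0 : ℝ) 1 := ⟨by linarith [ht.1], by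
    have := (min_le_left (min r 1) (r / (M + 1))).trans (min_le_right _ _)
    linarith [ht.2]⟩
  have htr : t - t₀ ≤ r / (M + 1) := by
    linarith [ht.2, min_le_right (min r 1) (r / (M + 1))]
  have htr' : t ≤ t₀ + r := by
    linarith [ht.2, (min_le_left (min r 1) (r / (M + 1))).trans (min_le_left _ _)]
  have hdist : ‖y (t - t₀) - y 0‖ ≤ M * (t - t₀ - 0) :=
    norm_image_sub_le_of_norm_deriv_right_le_segment (a := 0) (b := 1) hyc.continuousOn
      (fun s hs => (hy s (Ico_subset_Icc_self hs)).hasDerivWithinAt) (fun s _ => hGM _) _ ht1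
  have hdist' : ‖y (t - t₀) - y₀‖ ≤ r := by
    rw [hy0] at hdist
    refine hdist.trans ?_
    rw [le_div_iff₀ (by positivity)] at htr
    nlinarith [ht1.1]
  have hmem : y (t - t₀) ∈ Icc (fun i => y₀ i - r) (fun i => y₀ i + r) := by
    have := fun i => (norm_le_pi_norm (y (t - t₀) - y₀) i).trans hdist'
    simp only [Pi.sub_apply, Real.norm_eq_abs, abs_le] at this
    exact ⟨fun i => by dsimp; linarith [(this i).1], fun i => by dsimp; linarith [(this i).2]⟩
  refine ⟨hmem, ?_⟩
  have h := hy _ ht1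
  have e : G (t - t₀, y (t - t₀)) = F (t, y (t - t₀)) := by
    simp only [G, add_sub_cancel]
    rw [hπid _ ⟨⟨ht.1, htr'⟩, hmem⟩]
  rw [e] at h
  exact h.comp_sub_const t t₀

end Peano

/-! ### Mean value inequality and monotonicity -/

/-- The mean value inequality with finitely many exceptional points. -/
theorem abs_sub_le_of_deriv_off_finset {f f' : ℝ → ℝ} {M : ℝ} (s : Finset ℝ) :
    ∀ {a b : ℝ}, a ≤ b → ContinuousOn f (Icc a b) →
      (∀ t ∈ Ioo a b, t ∉ s → HasDerivAt f (f' t) t) → (∀ t ∈ Ioo a b, |f' t| ≤ M) →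
      |f b - f a| ≤ M * (b - a) := by
  classical
  induction s using Finset.induction_on with
  | empty =>
    intro a b hab hf hf' hM
    rcases hab.eq_or_lt with rfl | hab
    · simp
    obtain ⟨c, hc, h⟩ := exists_hasDerivAt_eq_slope f f' hab hf (fun t ht => hf' t ht (by simp))
    have hba : 0 < b - a := sub_pos.2 hab
    have h1 : f b - f a = f' c * (b - a) := by rw [h]; field_simp
    rw [h1, abs_mul, abs_of_pos hba]
    exact mul_le_mul_of_nonneg_right (hM c hc) hba.le
  | insert d s hds ih =>
    intro a b hab hf hf' hM
    by_cases hd : d ∈ Ioo a b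
    · have h1 := ih hd.1.le (hf.mono (Icc_subset_Icc_right hd.2.le))
        (fun t ht hts => hf' t ⟨ht.1, ht.2.trans hd.2⟩ (by simp [hts, ht.2.ne]))
        (fun t ht => hM t ⟨ht.1, ht.2.trans hd.2⟩)
      have h2 := ih hd.2.le (hf.mono (Icc_subset_Icc_left hd.1.le))
        (fun t ht hts => hf' t ⟨hd.1.trans ht.1, ht.2⟩ (by simp [hts, ht.1.ne']))
        (fun t ht => hM t ⟨hd.1.trans ht.1, ht.2⟩)
      calc |f b - f a| ≤ |f b - f d| + |f d - f a| := abs_sub_le _ _ _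
        _ ≤ _ := by linarith
    · exact ih hab hf (fun t ht hts => hf' t ht (by
        simp only [Finset.mem_insert, not_or]
        exact ⟨fun h => hd (h ▸ ht), hts⟩)) hM

/-- A nonnegative initial value and `f' ≥ -σ f` keep `f` nonnegative. -/
theorem nonneg_of_deriv_right_ge {f f' : ℝ → ℝ} {a b σ : ℝ} (hf : ContinuousOn f (Icc a b))
    (hf' : ∀ t ∈ Ico a b, HasDerivWithinAt f (f' t) (Ici t) t) (ha : 0 ≤ f a)
    (h : ∀ t ∈ Ico a b, -(σ * f t) ≤ f' t) : ∀ t ∈ Icc a b, 0 ≤ f t := by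
  intro t ht
  have key : -(f t * Real.exp (σ * t)) ≤ 0 := by
    refine image_le_of_deriv_right_le_deriv_boundary (f := fun t => -(f t * Real.exp (σ * t)))
      (f' := fun t => -(f' t * Real.exp (σ * t) + f t * (Real.exp (σ * t) * σ)))
      (B := fun _ => 0) (B' := fun _ => 0) (a := a) (b := b) ?_ ?_ ?_
      continuousOn_const (fun _ _ => hasDerivWithinAt_const _ _ _) ?_ ht
    · exact (hf.mul (by fun_prop)).neg
    · intro s hs
      have he : HasDerivAt (fun t => Real.exp (σ * t)) (Real.exp (σ * s) * σ) s := by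
        simpa using ((hasDerivAt_id s).const_mul σ).exp
      exact ((hf' s hs).mul he.hasDerivWithinAt).neg
    · have := Real.exp_pos (σ * a)
      simp only [Left.neg_nonpos_iff]; positivity
    · intro s hs
      have := Real.exp_pos (σ * s)
      nlinarith [h s hs]
  have := Real.exp_pos (σ * t)
  by_contra hneg
  push Not at hneg
  nlinarith

/-- A continuous function that is at least `ε` on every initial interval on which it is positive
is at least `ε` throughout. -/
theorem ge_of_forall_pos_initial {G : ℝ → ℝ} {b ε : ℝ} (hε : 0 < ε)
    (hG : ContinuousOn G (Icc 0 b)) (h0 : 0 < G 0)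
    (h : ∀ t ∈ Icc 0 b, (∀ s ∈ Icc 0 t, 0 < G s) → ε ≤ G t) : ∀ t ∈ Icc 0 b, ε ≤ G t := by
  suffices hpos : ∀ t ∈ Icc 0 b, 0 < G t from
    fun t ht => h t ht fun s hs => hpos s ⟨hs.1, hs.2.trans ht.2⟩
  intro t₁ ht₁
  by_contra hneg
  push Not at hneg
  -- the first time at which `G` is at most `ε / 2`
  let A : Set ℝ := {t ∈ Icc 0 b | G t ∈ Iic (ε / 2)}
  have hAc : IsCompact A := by
    have : IsClosed A := hG.preimage_isClosed_of_isClosed isClosed_Icc isClosed_Iic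
    exact isCompact_Icc.of_isClosed_subset this fun t ht => ht.1
  have hAne : A.Nonempty := ⟨t₁, ht₁, by simp only [mem_Iic]; linarith⟩
  obtain ⟨s, hsA, hs⟩ := hAc.exists_isLeast hAne
  have hlt : ∀ r ∈ Ico 0 s, ε / 2 < G r := by
    intro r hr
    by_contra hcon
    push Not at hcon
    exact absurd (hs ⟨⟨hr.1, hr.2.le.trans hsA.1.2⟩, hcon⟩) (not_le.2 hr.2)
  have hb0 : (0 : ℝ) ∈ Icc 0 b := ⟨le_rfl, hsA.1.1.trans hsA.1.2⟩
  have hs0 : 0 < s := by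
    rcases hsA.1.1.eq_or_lt with h' | h'
    · have h1 := h 0 hb0 (by simpa using h0)
      have h2 : G s ≤ ε / 2 := hsA.2
      rw [← h'] at h2
      linarith
    · exact h'
  have hlim : Tendsto G (𝓝[<] s) (𝓝 (G s)) :=
    
    (hG s hsA.1).mono_left (nhdsWithin_le_of_mem (mem_of_superset (Ico_mem_nhdsLT hs0)
      fun r hr => ⟨hr.1, hr.2.le.trans hsA.1.2⟩))
  have hge : ε / 2 ≤ G s := by
    refine ge_of_tendsto hlim ?_
    filter_upwards [Ico_mem_nhdsLT hs0] with r hr using (hlt r hr).le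
  have := h s hsA.1 (by
    intro r hr
    rcases hr.2.eq_or_lt with rfl | h'
    · linarith
    · linarith [hlt r ⟨hr.1, h'⟩])
  have h2 : G s ≤ ε / 2 := hsA.2
  linarith

/-! ### Functions of finitely many of the variables, and the chain rule -/

section Variables

variable {n : ℕ}

theorem sum_var (h : Var n → ℝ) :
    ∑ v, h v = ∑ i, h (.state i) + ∑ i, h (.est i) + ∑ k, h (.ref k) + ∑ k, h (.perf k) +
      ∑ k, h (.auxU k) + ∑ k, h (.auxL k) := by
  let e : (((((Fin n ⊕ Fin n) ⊕ Fin (n + 1)) ⊕ Fin (n + 1)) ⊕ Fin (n + 1)) ⊕ Fin (n + 1)) ≃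
      Var n :=
    { toFun := Sum.elim (Sum.elim (Sum.elim (Sum.elim (Sum.elim .state .est) .ref) .perf) .auxU)
        .auxL
      invFun := fun
        | .state i => .inl (.inl (.inl (.inl (.inl i))))
        | .est i => .inl (.inl (.inl (.inl (.inr i))))
        | .ref i => .inl (.inl (.inl (.inr i)))
        | .perf i => .inl (.inl (.inr i))
        | .auxU i => .inl (.inr i)
        | .auxL i => .inr i
      left_inv := by rintro (((((i | i) | i) | i) | i) | i) <;> rfl
      right_inv := by rintro (i | i | i | i | i | i) <;> rfl }
  rw [← e.sum_comp]
  simp only [Fintype.sum_sum_type]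
  rfl

/-- The first stage of the design in which a variable may occur: `x_i` and `θ̂_i` occur from stage
`i` on, and the time derivatives of order `k` from stage `k - 1` on. -/
def Var.lvl : Var n → ℕ
  | .state i => i.val
  | .est i => i.val
  | .ref k => k.val - 1
  | .perf k => k.val - 1
  | .auxU k => k.val - 1
  | .auxL k => k.val - 1

/-- The variables that occur up to stage `i`. -/
def Var.upTo (i : ℕ) : Set (Var n) := {v | v.lvl ≤ i}

theorem Var.upTo_mono {i j : ℕ} (h : i ≤ j) : (Var.upTo i : Set (Var n)) ⊆ Var.upTo j :=
  fun _ hv => le_trans hv h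

variable {F : (Var n → ℝ) → ℝ} {S : Set (Var n)}

theorem partialDeriv_eq_zero (hF : DependsOn F S) {v : Var n} (hv : v ∉ S) (w : Var n → ℝ) :
    partialDeriv F v w = 0 := by
  have : (fun s => F (Function.update w v s)) = fun _ => F w := by
    funext s
    exact hF fun u hu => Function.update_of_ne (fun h : u = v => hv (h ▸ hu)) _ _
  simp [partialDeriv, this]

theorem dependsOn_partialDeriv (hF : DependsOn F S) (v : Var n) :
    DependsOn (partialDeriv F v) S := by
  intro w w' hw
  by_cases hv : v ∈ S
  · have : (fun s => F (Function.update w v s)) = fun s => F (Function.update w' v s) := by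
      funext s
      refine hF fun u hu => ?_
      by_cases h : u = v
      · subst h; simp
      · rw [Function.update_of_ne h, Function.update_of_ne h, hw u hu]
    simp only [partialDeriv, this, hw v hv]
  · rw [partialDeriv_eq_zero hF hv, partialDeriv_eq_zero hF hv]

theorem partialDeriv_eq_fderiv {w : Var n → ℝ} (hF : DifferentiableAt ℝ F w) (v : Var n) :
    partialDeriv F v w = fderiv ℝ F w (Pi.single v 1) := by
  have h1 : HasDerivAt (fun s => Function.update w v s) (Pi.single v 1) (w v) := by
    rw [hasDerivAt_pi]
    intro u
    by_cases h : u = v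
    · subst h; simpa using hasDerivAt_id' _
    · simpa [Function.update_of_ne h, h] using hasDerivAt_const _ _
  have h2 : HasFDerivAt F (fderiv ℝ F w) (Function.update w v (w v)) := by
    rw [Function.update_eq_self]; exact hF.hasFDerivAt
  exact (h2.comp_hasDerivAt _ h1).deriv

theorem contDiffOn_partialDeriv {U : Set (Var n → ℝ)} (hU : IsOpen U) (hF : ContDiffOn ℝ ∞ F U)
    (v : Var n) : ContDiffOn ℝ ∞ (partialDeriv F v) U := by
  have h1 : ContDiffOn ℝ ∞ (fun w => fderiv ℝ F w (Pi.single v 1)) U :=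
    (hF.fderiv_of_isOpen hU (m := ∞) (by simp)).clm_apply contDiffOn_const
  refine h1.congr fun w hw => partialDeriv_eq_fderiv ?_ v
  exact (hF.contDiffAt (hU.mem_nhds hw)).differentiableAt (by simp)

/-- The chain rule along a curve, where only those coordinates need to be differentiable that the
function depends on. -/
theorem hasDerivWithinAt_comp_of_dependsOn (hF : DependsOn F S) {w : ℝ → Var n → ℝ}
    {W : Var n → ℝ} {t : ℝ} {A : Set ℝ} (hd : DifferentiableAt ℝ F (w t))
    (hw : ∀ v ∈ S, HasDerivWithinAt (fun s => w s v) (W v) A t) :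
    HasDerivWithinAt (fun s => F (w s)) (∑ v, partialDeriv F v (w t) * W v) A t := by
  classical
  -- freeze the coordinates outside `S`
  let w₁ : ℝ → Var n → ℝ := fun s v => if v ∈ S then w s v else w t v
  let W₁ : Var n → ℝ := fun v => if v ∈ S then W v else 0
  have h1 : (fun s => F (w s)) = fun s => F (w₁ s) := by
    funext s
    exact hF fun v hv => by simp [w₁, hv]
  have h2 : w₁ t = w t := by funext v; simp [w₁]
  have h3 : HasDerivWithinAt w₁ W₁ A t := by
    rw [hasDerivWithinAt_pi]
    intro v
    by_cases hv : v ∈ S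
    · simpa [w₁, W₁, hv] using hw v hv
    · simpa [w₁, W₁, hv] using hasDerivWithinAt_const _ _ _
  have h4 : HasFDerivAt F (fderiv ℝ F (w t)) (w₁ t) := by rw [h2]; exact hd.hasFDerivAt
  have h5 := h4.comp_hasDerivWithinAt t h3
  rw [h1]
  refine h5.congr_deriv ?_
  have h6 : W₁ = ∑ v, W₁ v • Pi.single (M := fun _ => ℝ) v 1 := by
    funext u
    simp [Finset.sum_apply, Pi.single_apply]
  rw [h6, map_sum]
  symm
  refine Finset.sum_congr rfl fun v _ => ?_
  rw [map_smul, ← partialDeriv_eq_fderiv hd, smul_eq_mul, mul_comm]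
  by_cases hv : v ∈ S
  · simp [W₁, hv]
  · simp [partialDeriv_eq_zero hF hv]

end Variables

namespace Design

variable {n : ℕ} [NeZero n] (D : Design n)

/-! ### The backstepping recursion, unfolded -/

/-- The computable part `Δα` of the time derivative of the control of stage `i`. -/
noncomputable def drift (i : Fin n) (w : Var n → ℝ) : ℝ :=
  (∑ k : Fin n,
    (partialDeriv (D.control i) (.ref k.castSucc) w * w (.ref k.succ) +
     partialDeriv (D.control i) (.perf k.castSucc) w * w (.perf k.succ) +
     partialDeriv (D.control i) (.auxU k.castSucc) w * w (.auxU k.succ) +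
     partialDeriv (D.control i) (.auxL k.castSucc) w * w (.auxL k.succ))) +
  ∑ k : Fin (i.val + 1), partialDeriv (D.control i) (.est (Fin.castLE i.isLt k)) w *
    D.rate (Fin.castLE i.isLt k) w

/-- The quantity whose square is the term `ε_i`: `μ_1 z_1` in the first stage, `e_i` later on. -/
noncomputable def coupling (i : Fin n) (w : Var n → ℝ) : ℝ :=
  if i = 0 then D.μ₁ w * D.z₁ w else D.err i w

theorem err_zero : D.err 0 = D.z₁ := by
  simp [err, stage]

theorem Φ_zero : D.Φ 0 = D.Φ₁ := by
  simp [Φ, stage]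

theorem control_apply (i : Fin n) (w : Var n → ℝ) : D.control i w =
    if i = 0 then -(1 / D.μ₁ w) * (D.c i * D.err i w + D.err i w * w (.est i) * D.Φ i w)
    else -(D.c i * D.err i w + w (.est i) * D.err i w * D.Φ i w) := rfl

theorem rate_apply (i : Fin n) (w : Var n → ℝ) :
    D.rate i w = D.r i * D.err i w ^ 2 * D.Φ i w - D.σ i * w (.est i) := rfl

theorem err_succ (i : ℕ) (hi : i + 1 < n) (w : Var n → ℝ) :
    D.err ⟨i + 1, hi⟩ w = w (.state ⟨i + 1, hi⟩) - D.control ⟨i, by omega⟩ w := by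
  simp only [err]
  rw [stage]
  rfl

theorem Φ_succ (i : ℕ) (hi : i + 1 < n) (w : Var n → ℝ) :
    D.Φ ⟨i + 1, hi⟩ w =
      (∑ k : Fin (i + 1), (partialDeriv (D.control ⟨i, by omega⟩)
        (.state ⟨k.val, by omega⟩) w * D.φAt ⟨k.val, by omega⟩ w) ^ 2) +
      (∑ k : Fin (i + 1), (partialDeriv (D.control ⟨i, by omega⟩)
        (.state ⟨k.val, by omega⟩) w * w (.state ⟨k.val + 1, by omega⟩)) ^ 2) +
      D.drift ⟨i, by omega⟩ w ^ 2 + D.coupling ⟨i, by omega⟩ w ^ 2 +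
      D.φAt ⟨i + 1, hi⟩ w ^ 2 + (if i + 2 = n then 1 else 0) := by
  have h0 : ((⟨i, by omega⟩ : Fin n) = 0) ↔ i = 0 := by
    rw [Fin.ext_iff]; simp
  have hc : D.coupling ⟨i, by omega⟩ w ^ 2 =
      if i = 0 then (D.μ₁ w) ^ 2 * (D.z₁ w) ^ 2 else (D.err ⟨i, by omega⟩ w) ^ 2 := by
    simp only [coupling, h0]
    split_ifs
    · ring
    · rfl
  rw [hc]
  simp only [Φ]
  rw [stage]
  rfl

theorem Φ_nonneg (i : Fin n) (w : Var n → ℝ) : 0 ≤ D.Φ i w := by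
  obtain ⟨i, hi⟩ := i
  cases i with
  | zero =>
    have h : (⟨0, hi⟩ : Fin n) = 0 := by ext; simp
    rw [h, Φ_zero, Φ₁]
    positivity
  | succ i =>
    rw [Φ_succ]
    have : (0 : ℝ) ≤ if i + 2 = n then 1 else 0 := by split_ifs <;> norm_num
    positivity

/-! ### Dependence of the stages on the variables -/

theorem dependsOn_gap : DependsOn (fun w : Var n → ℝ => (e₁ w, D.Eu w, D.El w, D.dEu w, D.dEl w))
    (Var.upTo 0) := by
  intro w w' h
  have h1 : ((1 : Fin (n + 1)) : ℕ) - 1 ≤ 0 := by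
    have := (NeZero.pos n)
    have h1n : (1 : ℕ) < n + 1 := by omega
    rw [Fin.val_one', Nat.mod_eq_of_lt h1n]
  have a1 := h (.state 0) (by simp [Var.upTo, Var.lvl])
  have a2 := h (.ref 0) (by simp [Var.upTo, Var.lvl])
  have a3 := h (.perf 0) (by simp [Var.upTo, Var.lvl])
  have a4 := h (.perf 1) h1
  have a5 := h (.auxU 0) (by simp [Var.upTo, Var.lvl])
  have a6 := h (.auxU 1) h1
  have a7 := h (.auxL 0) (by simp [Var.upTo, Var.lvl])
  have a8 := h (.auxL 1) h1
  simp only [e₁, Eu, El, dEu, dEl, a1, a2, a3, a4, a5, a6, a7, a8]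

theorem dependsOn_μ₁ : DependsOn D.μ₁ (Var.upTo 0) := by
  intro w w' h
  have := D.dependsOn_gap h
  simp only [Prod.mk.injEq] at this
  obtain ⟨h1, h2, h3, -, -⟩ := this
  simp only [μ₁, ell, h1, h2, h3]

theorem dependsOn_μ₂ : DependsOn D.μ₂ (Var.upTo 0) := by
  intro w w' h
  have := D.dependsOn_gap h
  simp only [Prod.mk.injEq] at this
  obtain ⟨h1, h2, h3, h4, h5⟩ := this
  simp only [μ₂, ell, h1, h2, h3, h4, h5]

theorem dependsOn_z₁ : DependsOn D.z₁ (Var.upTo 0) := by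
  intro w w' h
  have := D.dependsOn_gap h
  simp only [Prod.mk.injEq] at this
  obtain ⟨h1, h2, h3, -, -⟩ := this
  simp only [z₁, h1, h2, h3]

theorem dependsOn_φAt (i : Fin n) : DependsOn (D.φAt i) (Var.upTo i.val) := by
  intro w w' h
  simp only [φAt]
  congr 1
  funext j
  exact h _ (Nat.lt_succ_iff.1 j.isLt)

theorem dependsOn_err_Φ (i : ℕ) (hi : i < n) :
    DependsOn (D.err ⟨i, hi⟩) (Var.upTo i) ∧ DependsOn (D.Φ ⟨i, hi⟩) (Var.upTo i) := by
  induction i using Nat.strong_induction_on with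
  | _ i ih =>
    cases i with
    | zero =>
      have h : (⟨0, hi⟩ : Fin n) = 0 := by ext; simp
      rw [h, err_zero, Φ_zero]
      refine ⟨D.dependsOn_z₁, fun w w' hw => ?_⟩
      have h1 := hw (.ref 1) (by
        have h1n : (1 : ℕ) < n + 1 := by omega
        simp only [Var.upTo, Var.lvl, mem_ofPred_eq]
        rw [Fin.val_one', Nat.mod_eq_of_lt h1n])
      have h2 := D.dependsOn_φAt 0 (x := w) (y := w') (by simpa using hw)
      simp only [Φ₁, D.dependsOn_μ₁ hw, D.dependsOn_μ₂ hw, h1, h2]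
    | succ i =>
      have hctl : DependsOn (D.control ⟨i, by omega⟩) (Var.upTo i) := by
        intro w w' hw
        obtain ⟨h1, h2⟩ := ih i (by omega) (by omega)
        have h3 := D.dependsOn_μ₁ (x := w) (y := w') fun v hv => hw v (Var.upTo_mono (by omega) hv)
        have h4 := hw (.est ⟨i, by omega⟩) (by simp [Var.upTo, Var.lvl])
        simp only [control_apply, h1 hw, h2 hw, h3, h4]
      refine ⟨fun w w' hw => ?_, fun w w' hw => ?_⟩
      · rw [err_succ, err_succ, hw (.state ⟨i + 1, hi⟩) (by simp [Var.upTo, Var.lvl]),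
          hctl fun v hv => hw v (Var.upTo_mono (by omega) hv)]
      · have hw' : ∀ j, j ≤ i → ∀ v ∈ Var.upTo j, w v = w' v := fun j hj v hv =>
          hw v (Var.upTo_mono (by omega) hv)
        have hp : ∀ v, partialDeriv (D.control ⟨i, by omega⟩) v w =
            partialDeriv (D.control ⟨i, by omega⟩) v w' := fun v =>
          dependsOn_partialDeriv hctl v (hw' i le_rfl)
        -- a derivative of order `k` multiplies a partial derivative that vanishes for `k > i + 1`
        have hprod : ∀ (f : Fin (n + 1) → Var n), (∀ k, (f k).lvl = k.val - 1) → ∀ k : Fin n,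
            partialDeriv (D.control ⟨i, by omega⟩) (f k.castSucc) w * w (f k.succ) =
            partialDeriv (D.control ⟨i, by omega⟩) (f k.castSucc) w' * w' (f k.succ) := by
          intro f hf k
          by_cases hk : k.val - 1 ≤ i
          · rw [hp, hw (f k.succ)]
            change (f k.succ).lvl ≤ i + 1
            rw [hf, Fin.val_succ]; omega
          · have hz : f k.castSucc ∉ Var.upTo i := by
              change ¬ ((f k.castSucc).lvl ≤ i)
              rwa [hf]
            rw [partialDeriv_eq_zero hctl hz, partialDeriv_eq_zero hctl hz, zero_mul, zero_mul]
        have hdrift : D.drift ⟨i, by omega⟩ w = D.drift ⟨i, by omega⟩ w' := by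
          simp only [drift]
          congr 1
          · refine Finset.sum_congr rfl fun k _ => ?_
            rw [hprod .ref (fun _ => rfl), hprod .perf (fun _ => rfl), hprod .auxU (fun _ => rfl),
              hprod .auxL (fun _ => rfl)]
          · refine Finset.sum_congr rfl fun k _ => ?_
            have hk : k.val ≤ i := Nat.lt_succ_iff.1 k.isLt
            obtain ⟨h1, h2⟩ := ih k.val (by omega) (by omega)
            have h4 := hw' k.val hk (.est (Fin.castLE (by omega) k)) (by simp [Var.upTo, Var.lvl])
            rw [hp, rate_apply, rate_apply]
            have h1' := h1 (hw' k.val hk)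
            have h2' := h2 (hw' k.val hk)
            change _ * (D.r _ * D.err ⟨k.val, _⟩ w ^ 2 * D.Φ ⟨k.val, _⟩ w - _) =
              _ * (D.r _ * D.err ⟨k.val, _⟩ w' ^ 2 * D.Φ ⟨k.val, _⟩ w' - _)
            rw [h1', h2', h4]
        have hcoup : D.coupling ⟨i, by omega⟩ w = D.coupling ⟨i, by omega⟩ w' := by
          simp only [coupling, D.dependsOn_μ₁ (hw' 0 (by omega)),
            D.dependsOn_z₁ (hw' 0 (by omega)), (ih i (by omega) (by omega)).1 (hw' i le_rfl)]
        rw [Φ_succ, Φ_succ, hdrift, hcoup, D.dependsOn_φAt ⟨i + 1, hi⟩ hw]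
        have e1 : ∀ k : Fin (i + 1), D.φAt ⟨k.val, by omega⟩ w = D.φAt ⟨k.val, by omega⟩ w' :=
          fun k => D.dependsOn_φAt ⟨k.val, by omega⟩ (hw' k.val (Nat.lt_succ_iff.1 k.isLt))
        have e2 : ∀ k : Fin (i + 1), w (.state ⟨k.val + 1, by omega⟩) =
            w' (.state ⟨k.val + 1, by omega⟩) := fun k => hw _ (by
          simp only [Var.upTo, Var.lvl, mem_ofPred_eq]; omega)
        simp only [hp, e1, e2]

theorem dependsOn_control (i : Fin n) : DependsOn (D.control i) (Var.upTo i.val) := by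
  intro w w' hw
  obtain ⟨h1, h2⟩ := D.dependsOn_err_Φ i.val i.isLt
  have h3 := D.dependsOn_μ₁ (x := w) (y := w') fun v hv => hw v (Var.upTo_mono (by omega) hv)
  have h4 := hw (.est i) (by simp [Var.upTo, Var.lvl])
  simp only [control_apply, h1 hw, h2 hw, h3, h4]

/-! ### Smoothness of the stages -/

/-- The set of all values of the variables with `-E_l < e_1 < E_u`. -/
def safe : Set (Var n → ℝ) := {w | 0 < D.Eu w - e₁ w ∧ 0 < D.El w + e₁ w}

theorem contDiff_e₁ : ContDiff ℝ ∞ (e₁ : (Var n → ℝ) → ℝ) := by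
  unfold e₁; fun_prop

theorem contDiff_Eu : ContDiff ℝ ∞ D.Eu := by
  unfold Eu; fun_prop

theorem contDiff_El : ContDiff ℝ ∞ D.El := by
  unfold El; fun_prop

theorem contDiff_dEu : ContDiff ℝ ∞ D.dEu := by
  unfold dEu; fun_prop

theorem contDiff_dEl : ContDiff ℝ ∞ D.dEl := by
  unfold dEl; fun_prop

theorem isOpen_safe : IsOpen D.safe :=
  (isOpen_lt continuous_const (D.contDiff_Eu.continuous.sub contDiff_e₁.continuous)).inter
    (isOpen_lt continuous_const (D.contDiff_El.continuous.add contDiff_e₁.continuous))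

variable {D}

theorem ell_pos {w : Var n → ℝ} (hw : w ∈ D.safe) : 0 < D.ell w := by
  have h1 := hw.1
  have h2 := hw.2
  rw [ell, add_comm (e₁ w)]
  positivity

theorem μ₁_pos {w : Var n → ℝ} (hw : w ∈ D.safe) : 0 < D.μ₁ w :=
  mul_pos (ell_pos hw) (by linarith [hw.1, hw.2])

theorem contDiffOn_ell : ContDiffOn ℝ ∞ D.ell D.safe := by
  have h : ContDiff ℝ ∞ fun w => (e₁ w + D.El w) * (D.Eu w - e₁ w) :=
    (contDiff_e₁.add D.contDiff_El).mul (D.contDiff_Eu.sub contDiff_e₁)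
  refine contDiffOn_const.div h.contDiffOn fun w hw => ?_
  have h1 := hw.1
  have h2 := hw.2
  rw [add_comm (e₁ w)]
  positivity

theorem contDiffOn_μ₁ : ContDiffOn ℝ ∞ D.μ₁ D.safe :=
  contDiffOn_ell.mul (D.contDiff_Eu.add D.contDiff_El).contDiffOn

theorem contDiffOn_μ₂ : ContDiffOn ℝ ∞ D.μ₂ D.safe :=
  contDiffOn_ell.mul ((D.contDiff_dEl.mul (D.contDiff_Eu.sub contDiff_e₁)).sub
    (D.contDiff_dEu.mul (D.contDiff_El.add contDiff_e₁))).contDiffOn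

theorem contDiffOn_z₁ : ContDiffOn ℝ ∞ D.z₁ D.safe := by
  refine ContDiffOn.log ?_ fun w hw => (div_pos hw.2 hw.1).ne'
  exact (D.contDiff_El.add contDiff_e₁).contDiffOn.div
    (D.contDiff_Eu.sub contDiff_e₁).contDiffOn fun w hw => hw.1.ne'

theorem contDiff_φAt (hφ : ∀ i, ContDiff ℝ ∞ (D.φ i)) (i : Fin n) : ContDiff ℝ ∞ (D.φAt i) := by
  refine (hφ i).comp ?_
  unfold headState
  fun_prop

theorem contDiffOn_err_Φ (hφ : ∀ i, ContDiff ℝ ∞ (D.φ i)) (i : ℕ) (hi : i < n) :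
    ContDiffOn ℝ ∞ (D.err ⟨i, hi⟩) D.safe ∧ ContDiffOn ℝ ∞ (D.Φ ⟨i, hi⟩) D.safe := by
  induction i using Nat.strong_induction_on with
  | _ i ih =>
    cases i with
    | zero =>
      have h : (⟨0, hi⟩ : Fin n) = 0 := by ext; simp
      rw [h, err_zero, Φ_zero]
      refine ⟨contDiffOn_z₁, ?_⟩
      have hr : ContDiff ℝ ∞ fun w : Var n → ℝ => w (.ref 1) := by fun_prop
      exact (((contDiffOn_μ₁.pow 2).mul (hr.pow 2).contDiffOn).add
        ((contDiffOn_μ₁.pow 2).mul ((contDiff_φAt hφ 0).pow 2).contDiffOn)).add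
        (contDiffOn_μ₂.pow 2)
    | succ i =>
      have hs : ∀ v : Var n, ContDiffOn ℝ ∞ (fun w : Var n → ℝ => w v) D.safe := fun v =>
        ContDiff.contDiffOn (by fun_prop)
      have hctl : ContDiffOn ℝ ∞ (D.control ⟨i, by omega⟩) D.safe := by
        obtain ⟨h1, h2⟩ := ih i (by omega) (by omega)
        by_cases h0 : (⟨i, by omega⟩ : Fin n) = 0
        · have e : D.control ⟨i, by omega⟩ = fun w => -(1 / D.μ₁ w) *
              (D.c ⟨i, by omega⟩ * D.err ⟨i, by omega⟩ w + D.err ⟨i, by omega⟩ w *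
                w (.est ⟨i, by omega⟩) * D.Φ ⟨i, by omega⟩ w) := by
            funext w; rw [control_apply, if_pos h0]
          rw [e]
          exact ((contDiffOn_const.div contDiffOn_μ₁ fun w hw => (μ₁_pos hw).ne').neg).mul
            ((contDiffOn_const.mul h1).add ((h1.mul (hs _)).mul h2))
        · have e : D.control ⟨i, by omega⟩ = fun w => -(D.c ⟨i, by omega⟩ *
              D.err ⟨i, by omega⟩ w + w (.est ⟨i, by omega⟩) * D.err ⟨i, by omega⟩ w *
                D.Φ ⟨i, by omega⟩ w) := by
            funext w; rw [control_apply, if_neg h0]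
          rw [e]
          exact ((contDiffOn_const.mul h1).add (((hs _).mul h1).mul h2)).neg
      have hp : ∀ v, ContDiffOn ℝ ∞ (partialDeriv (D.control ⟨i, by omega⟩) v) D.safe :=
        contDiffOn_partialDeriv D.isOpen_safe hctl
      have hrate : ∀ k : Fin (i + 1), ContDiffOn ℝ ∞ (D.rate (Fin.castLE (by omega) k)) D.safe := by
        intro k
        obtain ⟨h1, h2⟩ := ih k.val (by omega) (by omega)
        exact ((contDiffOn_const.mul (h1.pow 2)).mul h2).sub (contDiffOn_const.mul (hs _))
      have hdrift : ContDiffOn ℝ ∞ (D.drift ⟨i, by omega⟩) D.safe := by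
        refine ContDiffOn.add (ContDiffOn.sum fun k _ => ?_) (ContDiffOn.sum fun k _ => ?_)
        · exact ((((hp _).mul (hs _)).add ((hp _).mul (hs _))).add ((hp _).mul (hs _))).add
            ((hp _).mul (hs _))
        · exact (hp _).mul (hrate k)
      have hcoup : ContDiffOn ℝ ∞ (D.coupling ⟨i, by omega⟩) D.safe := by
        by_cases h0 : (⟨i, by omega⟩ : Fin n) = 0
        · have e : D.coupling ⟨i, by omega⟩ = fun w => D.μ₁ w * D.z₁ w := by
            funext w; rw [coupling, if_pos h0]
          rw [e]; exact contDiffOn_μ₁.mul contDiffOn_z₁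
        · have e : D.coupling ⟨i, by omega⟩ = D.err ⟨i, by omega⟩ := by
            funext w; rw [coupling, if_neg h0]
          rw [e]; exact (ih i (by omega) (by omega)).1
      constructor
      · rw [show D.err ⟨i + 1, hi⟩ = _ from funext (D.err_succ i hi)]
        exact (hs _).sub hctl
      · rw [show D.Φ ⟨i + 1, hi⟩ = _ from funext (D.Φ_succ i hi)]
        refine ContDiffOn.add (ContDiffOn.add (ContDiffOn.add (ContDiffOn.add (ContDiffOn.add
          (ContDiffOn.sum fun k _ => ?_) (ContDiffOn.sum fun k _ => ?_)) (hdrift.pow 2))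
          (hcoup.pow 2)) ((contDiff_φAt hφ _).pow 2).contDiffOn) contDiffOn_const
        · exact ((hp _).mul (contDiff_φAt hφ _).contDiffOn).pow 2
        · exact ((hp _).mul (hs _)).pow 2

theorem contDiffOn_err (hφ : ∀ i, ContDiff ℝ ∞ (D.φ i)) (i : Fin n) :
    ContDiffOn ℝ ∞ (D.err i) D.safe := (contDiffOn_err_Φ hφ i.val i.isLt).1

theorem contDiffOn_Φ (hφ : ∀ i, ContDiff ℝ ∞ (D.φ i)) (i : Fin n) :
    ContDiffOn ℝ ∞ (D.Φ i) D.safe := (contDiffOn_err_Φ hφ i.val i.isLt).2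

theorem contDiffOn_rate (hφ : ∀ i, ContDiff ℝ ∞ (D.φ i)) (i : Fin n) :
    ContDiffOn ℝ ∞ (D.rate i) D.safe :=
  ((contDiffOn_const.mul ((contDiffOn_err hφ i).pow 2)).mul (contDiffOn_Φ hφ i)).sub
    (contDiffOn_const.mul (ContDiff.contDiffOn (by fun_prop)))

theorem contDiffOn_control (hφ : ∀ i, ContDiff ℝ ∞ (D.φ i)) (i : Fin n) :
    ContDiffOn ℝ ∞ (D.control i) D.safe := by
  have h1 := contDiffOn_err hφ i
  have h2 := contDiffOn_Φ hφ i
  have hs : ContDiffOn ℝ ∞ (fun w : Var n → ℝ => w (.est i)) D.safe :=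
    ContDiff.contDiffOn (by fun_prop)
  by_cases h0 : i = 0
  · have e : D.control i = fun w => -(1 / D.μ₁ w) * (D.c i * D.err i w + D.err i w *
        w (.est i) * D.Φ i w) := by
      funext w; rw [control_apply, if_pos h0]
    rw [e]
    exact ((contDiffOn_const.div contDiffOn_μ₁ fun w hw => (μ₁_pos hw).ne').neg).mul
      ((contDiffOn_const.mul h1).add ((h1.mul hs).mul h2))
  · have e : D.control i = fun w => -(D.c i * D.err i w + w (.est i) * D.err i w *
        D.Φ i w) := by
      funext w; rw [control_apply, if_neg h0]
    rw [e]
    exact ((contDiffOn_const.mul h1).add ((hs.mul h1).mul h2)).neg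

end Design

/-! ### Standing assumptions -/

/-- The hypotheses on the plant, the reference trajectory and the controller. -/
structure StandingAssumptions {n : ℕ} [NeZero n] (P : Plant n) (D : Design n) : Prop where
  two_le : 2 ≤ n
  cont_f : ∀ i, Continuous (P.f i)
  cont_g : ∀ i, Continuous (P.g i)
  reference : IsReference n D.yd
  smooth_φ : ∀ i, ContDiff ℝ ∞ (D.φ i)
  f_le : ∀ i, ∃ b : ℝ, 0 ≤ b ∧ ∀ ξ, |P.f i ξ| ≤ b * D.φ i ξ
  g_mem : ∀ i, ∃ glo ghi : ℝ, 0 < glo ∧ ∀ ξ, glo ≤ P.g i ξ ∧ P.g i ξ ≤ ghi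
  auxiliary : D.IsAuxiliary
  admissible : D.IsAdmissible

/-! ### Time derivatives of the signals -/

theorem hasDerivWithinAt_timeDeriv {N k : ℕ} {y : ℝ → ℝ} (hy : ContDiffOn ℝ N y (Ici 0))
    (hk : k < N) {t : ℝ} (ht : 0 ≤ t) :
    HasDerivWithinAt (timeDeriv k y) (timeDeriv (k + 1) y t) (Ici 0) t := by
  have h := hy.differentiableOn_iteratedDerivWithin (m := k) (by exact_mod_cast hk)
    (uniqueDiffOn_Ici 0) t ht
  have := h.hasDerivWithinAt
  rwa [← iteratedDerivWithin_succ] at this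

theorem continuousOn_timeDeriv {N k : ℕ} {y : ℝ → ℝ} (hy : ContDiffOn ℝ N y (Ici 0))
    (hk : k ≤ N) : ContinuousOn (timeDeriv k y) (Ici 0) :=
  hy.continuousOn_iteratedDerivWithin (by exact_mod_cast hk) (uniqueDiffOn_Ici 0)

theorem timeDeriv_zero (y : ℝ → ℝ) : timeDeriv 0 y = y := by
  funext t; simp [timeDeriv]

theorem Fin.val_one_of_neZero (n : ℕ) [NeZero n] : ((1 : Fin (n + 1)) : ℕ) = 1 := by
  have := NeZero.pos n
  rw [Fin.val_one', Nat.mod_eq_of_lt (by omega)]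

theorem Fin.sum_castLE_of_eq_zero {n m : ℕ} (hm : m ≤ n) (h : Fin n → ℝ)
    (h0 : ∀ k : Fin n, m ≤ k.val → h k = 0) : ∑ k, h k = ∑ k : Fin m, h (Fin.castLE hm k) := by
  symm
  refine Finset.sum_of_injOn (Fin.castLE hm) (fun a _ b _ hab => Fin.castLE_injective hm hab)
    (fun _ _ => by simp) (fun k _ hk => h0 k ?_) (fun _ _ => rfl)
  by_contra hlt
  push Not at hlt
  exact hk ⟨⟨k.val, hlt⟩, by simp, rfl⟩

namespace Design

variable {n : ℕ} [NeZero n] (D : Design n)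

theorem contDiff_ρ : ContDiff ℝ ∞ D.ρ := by
  unfold ρ; fun_prop

theorem hasDerivAt_iteratedDeriv_ρ (k : ℕ) (t : ℝ) :
    HasDerivAt (iteratedDeriv k D.ρ) (iteratedDeriv (k + 1) D.ρ t) t := by
  have h : DifferentiableAt ℝ (iteratedDeriv k D.ρ) t :=
    (D.contDiff_ρ.differentiable_iteratedDeriv k (by exact_mod_cast WithTop.coe_lt_top k)) t
  rw [iteratedDeriv_succ]
  exact h.hasDerivAt

/-- The right derivative of the error `e_i` (or `z_1`) when the variables have the values `w` and
the input is `u`. -/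
noncomputable def errRate (P : Plant n) : (i : Fin n) → (Var n → ℝ) → ℝ → ℝ
  | ⟨0, _⟩, w, u => D.μ₁ w * (P.rhs (fun j => w (.state j)) u 0 - w (.ref 1)) + D.μ₂ w
  | ⟨i + 1, hi⟩, w, u => P.rhs (fun j => w (.state j)) u ⟨i + 1, hi⟩ -
      (∑ k : Fin (i + 1), partialDeriv (D.control ⟨i, by omega⟩) (.state ⟨k.val, by omega⟩) w *
        P.rhs (fun j => w (.state j)) u ⟨k.val, by omega⟩ + D.drift ⟨i, by omega⟩ w)

end Design

namespace Execution

variable {n : ℕ} [NeZero n] {P : Plant n} {D : Design n} {S : CodedScheme}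

/-- The right derivatives of the variables along an execution. -/
noncomputable def velocity (E : Execution P D S) (t : ℝ) : Var n → ℝ
  | .state i => P.rhs (E.x t) (E.u t) i
  | .est i => D.rate i (E.pt t)
  | .ref k => timeDeriv (k.val + 1) D.yd t
  | .perf k => iteratedDeriv (k.val + 1) D.ρ t
  | .auxU k => timeDeriv (k.val + 1) D.ηu t
  | .auxL k => timeDeriv (k.val + 1) D.ηl t

variable (E : Execution P D S) (hA : StandingAssumptions P D)
include hA

/-- All variables but `y_d^(n)` are differentiable from the right. -/
theorem hasDerivWithinAt_pt {t : ℝ} (ht : 0 ≤ t) (htH : (t : EReal) < E.horizon) {v : Var n}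
    (hv : v ≠ .ref (Fin.last n)) :
    HasDerivWithinAt (fun s => E.pt s v) (E.velocity t v) (Ici t) t := by
  have hsub : Ici t ⊆ Ici (0 : ℝ) := Ici_subset_Ici.2 ht
  cases v with
  | state i => exact E.x_deriv t ht htH i
  | est i => exact E.θ_deriv t ht htH i
  | ref k =>
    have hk : k.val < n := by
      rcases Nat.lt_succ_iff_lt_or_eq.1 k.isLt with h | h
      · exact h
      · exact absurd (by rw [show k = Fin.last n from Fin.ext h]) hv
    exact (hasDerivWithinAt_timeDeriv hA.reference.smooth hk ht).mono hsub
  | perf k => exact (D.hasDerivAt_iteratedDeriv_ρ k.val t).hasDerivWithinAt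
  | auxU k => exact (hasDerivWithinAt_timeDeriv hA.auxiliary.smooth.1 k.isLt ht).mono hsub
  | auxL k => exact (hasDerivWithinAt_timeDeriv hA.auxiliary.smooth.2 k.isLt ht).mono hsub

theorem hasDerivWithinAt_z₁ {t : ℝ} (ht : 0 ≤ t) (htH : (t : EReal) < E.horizon)
    (hs : E.pt t ∈ D.safe) :
    HasDerivWithinAt (fun s => D.z₁ (E.pt s)) (D.errRate P 0 (E.pt t) (E.u t)) (Ici t) t := by
  have hn := hA.two_le
  have h0 : (0 : Fin (n + 1)) ≠ Fin.last n := by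
    intro h; have := congrArg Fin.val h; simp at this; omega
  have hx := E.hasDerivWithinAt_pt hA ht htH (v := .state 0) (by simp)
  have hr := E.hasDerivWithinAt_pt hA ht htH (v := .ref 0) (by simpa using h0)
  have hp := E.hasDerivWithinAt_pt hA ht htH (v := .perf 0) (by simp)
  have hu := E.hasDerivWithinAt_pt hA ht htH (v := .auxU 0) (by simp)
  have hl := E.hasDerivWithinAt_pt hA ht htH (v := .auxL 0) (by simp)
  have one := Fin.val_one_of_neZero n
  have er : E.velocity t (.ref 0) = E.pt t (.ref 1) := by
    change _ = timeDeriv ((1 : Fin (n + 1)) : ℕ) D.yd t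
    rw [one]; rfl
  have ep : E.velocity t (.perf 0) = E.pt t (.perf 1) := by
    change _ = iteratedDeriv ((1 : Fin (n + 1)) : ℕ) D.ρ t
    rw [one]; rfl
  have eu : E.velocity t (.auxU 0) = E.pt t (.auxU 1) := by
    change _ = timeDeriv ((1 : Fin (n + 1)) : ℕ) D.ηu t
    rw [one]; rfl
  have el : E.velocity t (.auxL 0) = E.pt t (.auxL 1) := by
    change _ = timeDeriv ((1 : Fin (n + 1)) : ℕ) D.ηl t
    rw [one]; rfl
  rw [er] at hr; rw [ep] at hp; rw [eu] at hu; rw [el] at hl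
  have dE : HasDerivWithinAt (fun s => Design.e₁ (E.pt s))
      (P.rhs (E.x t) (E.u t) 0 - E.pt t (.ref 1)) (Ici t) t := hx.sub hr
  have dU : HasDerivWithinAt (fun s => D.Eu (E.pt s)) (D.dEu (E.pt t)) (Ici t) t :=
    ((hp.const_mul _).sub_const _).add hu
  have dL : HasDerivWithinAt (fun s => D.El (E.pt s)) (D.dEl (E.pt t)) (Ici t) t :=
    ((hp.const_mul _).add_const _).sub hl
  have h1 := hs.1
  have h2 := hs.2
  have key := ((dL.add dE).div (dU.sub dE) h1.ne').log (div_pos h2 h1).ne'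
  refine key.congr_deriv ?_
  have e0 : D.errRate P 0 (E.pt t) (E.u t) = D.μ₁ (E.pt t) *
      (P.rhs (E.x t) (E.u t) 0 - E.pt t (.ref 1)) + D.μ₂ (E.pt t) := by
    have h : (0 : Fin n) = ⟨0, by omega⟩ := by ext; simp
    rw [h]; simp only [Design.errRate]; rfl
  rw [e0, Design.μ₁, Design.μ₂, Design.ell, add_comm (Design.e₁ (E.pt t))]
  simp only [Pi.div_apply, Pi.add_apply, Pi.sub_apply]
  have h1' := h1.ne'
  have h2' := h2.ne'
  field_simp
  ring

/-- The controls of all stages but the last are differentiable from the right along an execution;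
the part `Δα` collects the terms that the controller can compute. -/
theorem hasDerivWithinAt_control (i : ℕ) (hi : i + 1 < n) {t : ℝ} (ht : 0 ≤ t)
    (htH : (t : EReal) < E.horizon) (hs : E.pt t ∈ D.safe) :
    HasDerivWithinAt (fun s => D.control ⟨i, by omega⟩ (E.pt s))
      (∑ k : Fin (i + 1), partialDeriv (D.control ⟨i, by omega⟩) (.state ⟨k.val, by omega⟩)
        (E.pt t) * P.rhs (E.x t) (E.u t) ⟨k.val, by omega⟩ + D.drift ⟨i, by omega⟩ (E.pt t))
      (Ici t) t := by
  have hdep := D.dependsOn_control ⟨i, by omega⟩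
  have hd : DifferentiableAt ℝ (D.control ⟨i, by omega⟩) (E.pt t) :=
    ((Design.contDiffOn_control hA.smooth_φ _).contDiffAt
      (D.isOpen_safe.mem_nhds hs)).differentiableAt (by simp)
  have key := hasDerivWithinAt_comp_of_dependsOn hdep hd (W := E.velocity t) (A := Ici t)
    (fun v hv => E.hasDerivWithinAt_pt hA ht htH (by
      rintro rfl
      simp only [Var.upTo, Var.lvl, mem_ofPred_eq, Fin.val_last] at hv
      omega))
  refine key.congr_deriv ?_
  have hz : ∀ v : Var n, i < v.lvl → partialDeriv (D.control ⟨i, by omega⟩) v (E.pt t) = 0 :=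
    fun v hv => partialDeriv_eq_zero hdep (by simpa [Var.upTo] using hv) _
  rw [sum_var]
  have e1 : ∀ h : Fin n → ℝ, (∀ k : Fin n, i + 1 ≤ k.val → h k = 0) →
      ∑ k, h k = ∑ k : Fin (i + 1), h (Fin.castLE (by omega) k) := fun h h0 =>
    Fin.sum_castLE_of_eq_zero (by omega) h h0
  rw [e1 (fun k => partialDeriv (D.control ⟨i, by omega⟩) (.state k) (E.pt t) *
      E.velocity t (.state k)) (fun k hk => by rw [hz (.state k) hk, zero_mul]),
    e1 (fun k => partialDeriv (D.control ⟨i, by omega⟩) (.est k) (E.pt t) *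
      E.velocity t (.est k)) (fun k hk => by rw [hz (.est k) hk, zero_mul])]
  have hlast : ∀ f : Fin (n + 1) → Var n, (f (Fin.last n)).lvl = n - 1 →
      ∑ k, partialDeriv (D.control ⟨i, by omega⟩) (f k) (E.pt t) * E.velocity t (f k) =
      ∑ k : Fin n, partialDeriv (D.control ⟨i, by omega⟩) (f k.castSucc) (E.pt t) *
        E.velocity t (f k.castSucc) := by
    intro f hf
    rw [Fin.sum_univ_castSucc, hz (f (Fin.last n)) (by omega), zero_mul, add_zero]
  rw [hlast .ref rfl, hlast .perf rfl, hlast .auxU rfl, hlast .auxL rfl]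
  simp only [Design.drift, Finset.sum_add_distrib]
  simp only [velocity, pt, Design.point, Fin.val_castSucc, Fin.val_succ]
  simp only [Fin.castLE]
  ring

theorem hasDerivWithinAt_err (i : Fin n) {t : ℝ} (ht : 0 ≤ t)
    (htH : (t : EReal) < E.horizon) (hs : E.pt t ∈ D.safe) :
    HasDerivWithinAt (fun s => D.err i (E.pt s)) (D.errRate P i (E.pt t) (E.u t)) (Ici t) t := by
  obtain ⟨i, hi⟩ := i
  cases i with
  | zero =>
    have h : (⟨0, hi⟩ : Fin n) = 0 := by ext; simp
    rw [h, D.err_zero]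
    exact E.hasDerivWithinAt_z₁ hA ht htH hs
  | succ i =>
    simp only [D.err_succ, Design.errRate]
    exact (E.x_deriv t ht htH ⟨i + 1, hi⟩).sub (E.hasDerivWithinAt_control hA i hi ht htH hs)

end Execution

/-! ### The dissipation inequality -/

theorem mul_le_sq_add_sq (a b : ℝ) : a * b ≤ a ^ 2 + b ^ 2 := by
  nlinarith [sq_nonneg (a - b), sq_nonneg a, sq_nonneg b]

theorem mul_le_sq_add_sq_of_abs_le {a b p : ℝ} (h : |p| ≤ a * b) (e : ℝ) :
    e * p ≤ a ^ 2 + (e * b) ^ 2 := by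
  have h1 : e * p ≤ |e| * (a * b) := by
    refine (le_abs_self _).trans ?_
    rw [abs_mul]
    exact mul_le_mul_of_nonneg_left h (abs_nonneg e)
  have h2 := mul_le_sq_add_sq a (|e| * b)
  have h3 : (|e| * b) ^ 2 = (e * b) ^ 2 := by rw [mul_pow, sq_abs, mul_pow]
  nlinarith

/-- A linear combination of terms that are dominated by known ones with unknown factors. -/
theorem mul_sum_le {ι : Type*} (s : Finset ι) (e : ℝ) (p a b : ι → ℝ)
    (h : ∀ k ∈ s, |p k| ≤ a k * b k) :
    e * ∑ k ∈ s, p k ≤ ∑ k ∈ s, a k ^ 2 + e ^ 2 * ∑ k ∈ s, b k ^ 2 := by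
  rw [Finset.mul_sum, Finset.mul_sum, ← Finset.sum_add_distrib]
  refine Finset.sum_le_sum fun k hk => ?_
  have := mul_le_sq_add_sq_of_abs_le (h k hk) e
  rwa [mul_pow] at this

namespace Design

variable {n : ℕ} [NeZero n] {D : Design n} {P : Plant n}

/-- The product `e_{i+1}² Φ_{i+1}` that dominates the coupling of stage `i` with the next one; the
last stage is coupled only with the bounded sampling error. -/
noncomputable def nextTerm (D : Design n) (i : Fin n) (w : Var n → ℝ) : ℝ :=
  if h : i.val + 1 < n then D.err ⟨i.val + 1, h⟩ w ^ 2 * D.Φ ⟨i.val + 1, h⟩ w else 0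

theorem coupling_sq_le_Φ (i : ℕ) (hi : i + 1 < n) (w : Var n → ℝ) :
    D.coupling ⟨i, by omega⟩ w ^ 2 ≤ D.Φ ⟨i + 1, hi⟩ w := by
  rw [Φ_succ]
  have : (0 : ℝ) ≤ if i + 2 = n then 1 else 0 := by split_ifs <;> norm_num
  have h1 : 0 ≤ ∑ k : Fin (i + 1), (partialDeriv (D.control ⟨i, by omega⟩)
        (.state ⟨k.val, by omega⟩) w * D.φAt ⟨k.val, by omega⟩ w) ^ 2 :=
    Finset.sum_nonneg fun _ _ => sq_nonneg _
  have h2 : 0 ≤ ∑ k : Fin (i + 1), (partialDeriv (D.control ⟨i, by omega⟩)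
        (.state ⟨k.val, by omega⟩) w * w (.state ⟨k.val + 1, by omega⟩)) ^ 2 :=
    Finset.sum_nonneg fun _ _ => sq_nonneg _
  nlinarith [sq_nonneg (D.drift ⟨i, by omega⟩ w), sq_nonneg (D.φAt ⟨i + 1, hi⟩ w)]

theorem err_mul_errRate_zero_le (hA : StandingAssumptions P D) {γ : ℝ}
    (hγ : ∀ ξ, γ ≤ P.g 0 ξ) :
    ∃ C : ℝ, ∀ w ∈ D.safe, ∀ u : ℝ, 0 ≤ w (.est 0) →
      D.err 0 w * D.errRate P 0 w u ≤ C - γ * (D.c 0 * D.err 0 w ^ 2 +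
        w (.est 0) * (D.err 0 w ^ 2 * D.Φ 0 w)) + D.err 0 w ^ 2 * D.Φ 0 w +
        D.nextTerm 0 w := by
  have hn := hA.two_le
  obtain ⟨b, hb0, hb⟩ := hA.f_le 0
  obtain ⟨glo, ghi, hglo, hg⟩ := hA.g_mem 0
  refine ⟨b ^ 2 + 1 + 1 + ghi ^ 2, fun w hw u hθ => ?_⟩
  have h0 : (⟨0, by omega⟩ : Fin n) = 0 := by ext; simp
  have hc := hA.admissible.c_pos 0
  have hΦ := D.Φ_nonneg 0 w
  have hμ := μ₁_pos hw
  have e0 : D.errRate P 0 w u = D.μ₁ w *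
      (P.rhs (fun j => w (.state j)) u 0 - w (.ref 1)) + D.μ₂ w := by
    rw [← h0]; simp only [errRate]; rw [h0]
  have h1n : ((0 : Fin n) : ℕ) + 1 < n := by simp; omega
  have hrhs : P.rhs (fun j => w (.state j)) u 0 = P.f 0 (headState (fun j => w (.state j)) 0) +
      P.g 0 (headState (fun j => w (.state j)) 0) * w (.state ⟨((0 : Fin n) : ℕ) + 1, h1n⟩) := by
    rw [Plant.rhs, dif_pos h1n]
  have hstate : w (.state ⟨((0 : Fin n) : ℕ) + 1, h1n⟩) =
      D.err ⟨((0 : Fin n) : ℕ) + 1, h1n⟩ w + D.control 0 w := by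
    rw [err_succ]; simp
  have hα : D.μ₁ w * D.control 0 w =
      -(D.c 0 * D.err 0 w + D.err 0 w * w (.est 0) * D.Φ 0 w) := by
    rw [control_apply, if_pos rfl]
    field_simp
  have hnext : D.nextTerm 0 w = D.err ⟨((0 : Fin n) : ℕ) + 1, h1n⟩ w ^ 2 *
      D.Φ ⟨((0 : Fin n) : ℕ) + 1, h1n⟩ w := by
    rw [nextTerm, dif_pos h1n]
  have hcoup := coupling_sq_le_Φ (D := D) ((0 : Fin n) : ℕ) h1n w
  have hcoup0 : D.coupling ⟨((0 : Fin n) : ℕ), by omega⟩ w = D.μ₁ w * D.err 0 w := by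
    have : (⟨((0 : Fin n) : ℕ), by omega⟩ : Fin n) = 0 := by ext; simp
    rw [this, coupling, if_pos rfl, err_zero]
  rw [hcoup0] at hcoup
  rw [hnext, e0, hrhs, hstate]
  have hΦ0 : D.Φ 0 w = (D.μ₁ w) ^ 2 * (w (.ref 1)) ^ 2 + (D.μ₁ w) ^ 2 * (D.φAt 0 w) ^ 2 +
    (D.μ₂ w) ^ 2 := by rw [Φ_zero]; rfl
  set f := P.f 0 (headState (fun j => w (.state j)) 0) with hf
  set g := P.g 0 (headState (fun j => w (.state j)) 0) with hgdef
  set d := D.err ⟨((0 : Fin n) : ℕ) + 1, h1n⟩ w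
  set z := D.err 0 w
  set θ := w (.est 0)
  have hgl : γ ≤ g := hγ _
  have hgl0 : 0 < g := hglo.trans_le (hg _).1
  have hgh : g ≤ ghi := (hg _).2
  -- Young's inequality for each uncertain term; the known squares add up to `z² Φ` in `hsum`
  have y1 : z * D.μ₁ w * f ≤ b ^ 2 + (z * D.μ₁ w * D.φAt 0 w) ^ 2 :=
    mul_le_sq_add_sq_of_abs_le (hb _) _
  have y2 : z * D.μ₁ w * (-w (.ref 1)) ≤ 1 ^ 2 + (z * D.μ₁ w * w (.ref 1)) ^ 2 := by
    have := mul_le_sq_add_sq 1 (z * D.μ₁ w * (-w (.ref 1)))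
    rwa [one_mul, mul_neg, neg_sq, ← mul_neg] at this
  have y3 : z * D.μ₂ w ≤ 1 ^ 2 + (z * D.μ₂ w) ^ 2 := by
    simpa using mul_le_sq_add_sq 1 (z * D.μ₂ w)
  have y4 : g * (D.μ₁ w * z * d) ≤ g ^ 2 + (D.μ₁ w * z * d) ^ 2 := mul_le_sq_add_sq _ _
  have y5 : (D.μ₁ w * z * d) ^ 2 ≤ d ^ 2 * D.Φ ⟨((0 : Fin n) : ℕ) + 1, h1n⟩ w := by
    rw [mul_pow, mul_comm]
    exact mul_le_mul_of_nonneg_left hcoup (sq_nonneg d)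
  have y6 : g ^ 2 ≤ ghi ^ 2 := pow_le_pow_left₀ hgl0.le hgh 2
  have y7 : γ * (D.c 0 * z ^ 2 + θ * (z ^ 2 * D.Φ 0 w)) ≤
      g * (D.c 0 * z ^ 2 + θ * (z ^ 2 * D.Φ 0 w)) :=
    mul_le_mul_of_nonneg_right hgl (by positivity)
  have key : z * (D.μ₁ w * (f + g * (d + D.control 0 w) - w (.ref 1)) + D.μ₂ w) =
      z * D.μ₁ w * f + z * D.μ₁ w * (-w (.ref 1)) + z * D.μ₂ w + g * (D.μ₁ w * z * d) +
      g * z * (D.μ₁ w * D.control 0 w) := by ring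
  rw [key, hα]
  have hsum : z ^ 2 * D.Φ 0 w = (z * D.μ₁ w * D.φAt 0 w) ^ 2 + (z * D.μ₁ w * w (.ref 1)) ^ 2 +
      (z * D.μ₂ w) ^ 2 := by rw [hΦ0]; ring
  have e2 : g * z * -(D.c 0 * z + z * θ * D.Φ 0 w) =
      -(g * (D.c 0 * z ^ 2 + θ * (z ^ 2 * D.Φ 0 w))) := by ring
  rw [e2]
  linarith

theorem err_mul_errRate_succ_le (hA : StandingAssumptions P D) (i : ℕ) (hi : i + 1 < n) {γ : ℝ}
    (hγ : ∀ ξ, γ ≤ P.g ⟨i + 1, hi⟩ ξ) (Ω : ℝ) :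
    ∃ C : ℝ, ∀ (w : Var n → ℝ) (u : ℝ), |u - D.control (top n) w| ≤ Ω →
      0 ≤ w (.est ⟨i + 1, hi⟩) →
      D.err ⟨i + 1, hi⟩ w * D.errRate P ⟨i + 1, hi⟩ w u ≤
        C - γ * (D.c ⟨i + 1, hi⟩ * D.err ⟨i + 1, hi⟩ w ^ 2 +
        w (.est ⟨i + 1, hi⟩) * (D.err ⟨i + 1, hi⟩ w ^ 2 * D.Φ ⟨i + 1, hi⟩ w)) +
        D.err ⟨i + 1, hi⟩ w ^ 2 * D.Φ ⟨i + 1, hi⟩ w + D.nextTerm ⟨i + 1, hi⟩ w := by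
  choose b hb0 hb using hA.f_le
  choose glo ghi hglo hg using hA.g_mem
  let k' : Fin (i + 1) → Fin n := fun k => ⟨k.val, by omega⟩
  refine ⟨b ⟨i + 1, hi⟩ ^ 2 + ∑ k, b (k' k) ^ 2 + ∑ k, ghi (k' k) ^ 2 + 1 +
    ghi ⟨i + 1, hi⟩ ^ 2 * (1 + Ω ^ 2), fun w u hu hθ => ?_⟩
  have hc := hA.admissible.c_pos ⟨i + 1, hi⟩
  have hΦ := D.Φ_nonneg ⟨i + 1, hi⟩ w
  set x : Fin n → ℝ := fun j => w (.state j) with hx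
  let A : Fin (i + 1) → ℝ := fun k =>
    partialDeriv (D.control ⟨i, by omega⟩) (.state (k' k)) w
  let xn : Fin (i + 1) → ℝ := fun k => w (.state ⟨k.val + 1, by omega⟩)
  set f := P.f ⟨i + 1, hi⟩ (headState x ⟨i + 1, hi⟩) with hf
  set g := P.g ⟨i + 1, hi⟩ (headState x ⟨i + 1, hi⟩) with hgdef
  let F : Fin (i + 1) → ℝ := fun k => P.f (k' k) (headState x (k' k))
  let G : Fin (i + 1) → ℝ := fun k => P.g (k' k) (headState x (k' k))
  -- the control of this stage, and what the next state (or the input) adds to it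
  obtain ⟨d, hrhs, hd⟩ : ∃ d, P.rhs x u ⟨i + 1, hi⟩ = f + g * (D.control ⟨i + 1, hi⟩ w + d) ∧
      ((D.err ⟨i + 1, hi⟩ w * d) ^ 2 ≤ D.nextTerm ⟨i + 1, hi⟩ w ∨ (i + 2 = n ∧ |d| ≤ Ω)) := by
    by_cases h2 : i + 1 + 1 < n
    · refine ⟨D.err ⟨i + 1 + 1, h2⟩ w, ?_, Or.inl ?_⟩
      · rw [Plant.rhs, dif_pos h2, err_succ]
        simp only [hx]; ring
      · have h3 := coupling_sq_le_Φ (D := D) (i + 1) h2 w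
        have h4 : D.coupling ⟨i + 1, by omega⟩ w = D.err ⟨i + 1, hi⟩ w := by
          rw [coupling, if_neg]
          rw [Fin.ext_iff]; simp
        rw [h4] at h3
        rw [nextTerm, dif_pos h2, mul_pow, mul_comm]
        exact mul_le_mul_of_nonneg_left h3 (sq_nonneg _)
    · have htop : (⟨i + 1, hi⟩ : Fin n) = top n := by
        ext; simp only [top]; omega
      refine ⟨u - D.control ⟨i + 1, hi⟩ w, ?_, Or.inr ⟨by omega, ?_⟩⟩
      · rw [Plant.rhs, dif_neg h2, add_sub_cancel]
      · rw [htop]; exact hu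
  have hrhs' : ∀ k, P.rhs x u (k' k) = F k + G k * xn k := fun k => by
    have hk : (k' k).val + 1 < n := by have := k.isLt; simp only [k']; omega
    rw [Plant.rhs, dif_pos hk]
  have hα : D.control ⟨i + 1, hi⟩ w = -(D.c ⟨i + 1, hi⟩ * D.err ⟨i + 1, hi⟩ w +
      w (.est ⟨i + 1, hi⟩) * D.err ⟨i + 1, hi⟩ w * D.Φ ⟨i + 1, hi⟩ w) := by
    rw [control_apply, if_neg]
    rw [Fin.ext_iff]; simp
  have hrate : D.errRate P ⟨i + 1, hi⟩ w u = f + g * (D.control ⟨i + 1, hi⟩ w + d) +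
      ∑ k, -(A k * F k) + ∑ k, -(A k * G k * xn k) + -D.drift ⟨i, by omega⟩ w := by
    simp only [errRate]
    rw [hrhs]
    have : ∑ k : Fin (i + 1), partialDeriv (D.control ⟨i, by omega⟩)
        (.state ⟨k.val, by omega⟩) w * P.rhs x u ⟨k.val, by omega⟩ =
        ∑ k, A k * F k + ∑ k, A k * G k * xn k := by
      rw [← Finset.sum_add_distrib]
      refine Finset.sum_congr rfl fun k _ => ?_
      rw [show P.rhs x u ⟨k.val, by omega⟩ = _ from hrhs' k]
      simp only [A, k']
      ring
    rw [this, Finset.sum_neg_distrib, Finset.sum_neg_distrib]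
    ring
  have hΦs := Φ_succ D i hi w
  set κ : ℝ := if i + 2 = n then 1 else 0 with hκ
  have hκ0 : 0 ≤ κ := by rw [hκ]; split_ifs <;> norm_num
  set Φi := D.Φ ⟨i + 1, hi⟩ w with hΦi
  set e := D.err ⟨i + 1, hi⟩ w with he
  set θ := w (.est ⟨i + 1, hi⟩)
  have hgl : γ ≤ g := hγ _
  have hgl0 : 0 < g := (hglo _).trans_le (hg _ _).1
  have hgh : g ≤ ghi ⟨i + 1, hi⟩ := (hg _ _).2
  have hN0 : 0 ≤ D.nextTerm ⟨i + 1, hi⟩ w := by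
    rw [nextTerm]
    split_ifs with h
    · exact mul_nonneg (sq_nonneg _) (D.Φ_nonneg _ _)
    · exact le_rfl
  have y6 : g ^ 2 ≤ ghi ⟨i + 1, hi⟩ ^ 2 := pow_le_pow_left₀ hgl0.le hgh 2
  -- the next stage is absorbed by `nextTerm`, and the sampling error by the summand `κ` of `Φ`
  have y0 : g * (e * d) ≤ ghi ⟨i + 1, hi⟩ ^ 2 * (1 + Ω ^ 2) + D.nextTerm ⟨i + 1, hi⟩ w +
      e ^ 2 * κ := by
    have hge : 0 ≤ e ^ 2 * κ := by positivity
    rcases hd with hd | ⟨hin, hd⟩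
    · have := mul_le_sq_add_sq g (e * d)
      have h2 : 0 ≤ ghi ⟨i + 1, hi⟩ ^ 2 * Ω ^ 2 := by positivity
      linarith
    · have h1 := mul_le_sq_add_sq (g * d) e
      have h2 : κ = 1 := by rw [hκ, if_pos hin]
      have h3 : d ^ 2 ≤ Ω ^ 2 := sq_le_sq' (abs_le.1 hd).1 (abs_le.1 hd).2
      have h4 : g ^ 2 * d ^ 2 ≤ ghi ⟨i + 1, hi⟩ ^ 2 * Ω ^ 2 :=
        mul_le_mul y6 h3 (sq_nonneg _) (sq_nonneg _)
      have h5 : 0 ≤ ghi ⟨i + 1, hi⟩ ^ 2 := sq_nonneg _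
      rw [h2]
      nlinarith
  -- Young's inequality for each uncertain term; the known squares are summands of `e² Φ` in `hsum`
  have y1 : e * f ≤ b ⟨i + 1, hi⟩ ^ 2 + (e * D.φAt ⟨i + 1, hi⟩ w) ^ 2 :=
    mul_le_sq_add_sq_of_abs_le (hb _ _) _
  have y2 : e * ∑ k, -(A k * F k) ≤ ∑ k, b (k' k) ^ 2 +
      e ^ 2 * ∑ k, (A k * D.φAt (k' k) w) ^ 2 := by
    have := mul_sum_le Finset.univ e (fun k => -(A k * F k)) (fun k => b (k' k))
      (fun k => |A k| * D.φAt (k' k) w) (fun k _ => by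
        rw [abs_neg, abs_mul, mul_left_comm]
        exact mul_le_mul_of_nonneg_left (hb _ _) (abs_nonneg _))
    simpa only [mul_pow, sq_abs] using this
  have y3 : e * ∑ k, -(A k * G k * xn k) ≤ ∑ k, ghi (k' k) ^ 2 +
      e ^ 2 * ∑ k, (A k * xn k) ^ 2 := by
    have := mul_sum_le Finset.univ e (fun k => -(A k * G k * xn k)) (fun k => ghi (k' k))
      (fun k => |A k * xn k|) (fun k _ => by
        have hG : |G k| ≤ ghi (k' k) := by
          rw [abs_of_pos ((hglo _).trans_le (hg _ _).1)]
          exact (hg _ _).2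
        rw [abs_neg, mul_right_comm, abs_mul, mul_comm]
        exact mul_le_mul_of_nonneg_right hG (abs_nonneg _))
    simpa only [sq_abs] using this
  have y4 : e * -D.drift ⟨i, by omega⟩ w ≤ 1 + e ^ 2 * D.drift ⟨i, by omega⟩ w ^ 2 := by
    have := mul_le_sq_add_sq 1 (e * -D.drift ⟨i, by omega⟩ w)
    rw [one_mul, mul_pow, neg_sq] at this
    linarith
  have y7 : γ * (D.c ⟨i + 1, hi⟩ * e ^ 2 + θ * (e ^ 2 * Φi)) ≤
      g * (D.c ⟨i + 1, hi⟩ * e ^ 2 + θ * (e ^ 2 * Φi)) :=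
    mul_le_mul_of_nonneg_right hgl (by positivity)
  have y9 : 0 ≤ e ^ 2 * D.coupling ⟨i, by omega⟩ w ^ 2 := by positivity
  have hsum : e ^ 2 * Φi = e ^ 2 * ∑ k, (A k * D.φAt (k' k) w) ^ 2 +
      e ^ 2 * ∑ k, (A k * xn k) ^ 2 + e ^ 2 * D.drift ⟨i, by omega⟩ w ^ 2 +
      e ^ 2 * D.coupling ⟨i, by omega⟩ w ^ 2 + (e * D.φAt ⟨i + 1, hi⟩ w) ^ 2 + e ^ 2 * κ := by
    rw [hΦs]; simp only [A, xn, k']; ring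
  have key : e * D.errRate P ⟨i + 1, hi⟩ w u = e * f + g * (e * d) +
      e * ∑ k, -(A k * F k) + e * ∑ k, -(A k * G k * xn k) + e * -D.drift ⟨i, by omega⟩ w -
      g * (D.c ⟨i + 1, hi⟩ * e ^ 2 + θ * (e ^ 2 * Φi)) := by
    rw [hrate, hα]; ring
  rw [key]
  linarith

theorem sum_nextTerm_le (w : Var n → ℝ) :
    ∑ i, D.nextTerm i w ≤ ∑ i, D.err i w ^ 2 * D.Φ i w := by
  have h0 : ∀ i, 0 ≤ D.err i w ^ 2 * D.Φ i w := fun i =>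
    mul_nonneg (sq_nonneg _) (D.Φ_nonneg i w)
  obtain ⟨m, rfl⟩ : ∃ m, n = m + 1 := Nat.exists_eq_succ_of_ne_zero (NeZero.ne n)
  rw [Fin.sum_univ_castSucc, Fin.sum_univ_succ (fun i => D.err i w ^ 2 * D.Φ i w)]
  have h1 : D.nextTerm (Fin.last m) w = 0 := by
    rw [nextTerm, dif_neg]; simp
  have h2 : ∀ i : Fin m, D.nextTerm i.castSucc w = D.err i.succ w ^ 2 * D.Φ i.succ w := fun i => by
    rw [nextTerm, dif_pos (by simp)]; rfl
  rw [h1, Finset.sum_congr rfl fun i _ => h2 i]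
  linarith [h0 0]

/-- The Lyapunov function: the squared errors and the weighted squared distances of the estimates
from the values `2 / γ_i`, where `γ_i` is a lower bound of `g_i`. -/
noncomputable def lyapunov (D : Design n) (γ : Fin n → ℝ) (w : Var n → ℝ) : ℝ :=
  ∑ i, (D.err i w ^ 2 / 2 + γ i / (2 * D.r i) * (w (.est i) - 2 / γ i) ^ 2)

/-- The right derivative of the Lyapunov function. -/
noncomputable def lyapunovRate (D : Design n) (P : Plant n) (γ : Fin n → ℝ) (w : Var n → ℝ)
    (u : ℝ) : ℝ :=
  ∑ i, (D.err i w * D.errRate P i w u + γ i / D.r i * (w (.est i) - 2 / γ i) * D.rate i w)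

/-- The dissipation inequality `V' ≤ C - κ V`. The products `e_i² Φ_i` dominate all uncertain terms
after Young's inequality, once in their own stage and once as `nextTerm` of the stage before; the
estimates cancel both contributions, which is why they are compared with `2 / γ_i`. -/
theorem lyapunovRate_le (hA : StandingAssumptions P D) {γ : Fin n → ℝ} (hγ0 : ∀ i, 0 < γ i)
    (hγ : ∀ i ξ, γ i ≤ P.g i ξ) (Ω : ℝ) :
    ∃ C κ : ℝ, 0 < κ ∧ ∀ w ∈ D.safe, ∀ u : ℝ, |u - D.control (top n) w| ≤ Ω →
      (∀ i, 0 ≤ w (.est i)) → D.lyapunovRate P γ w u ≤ C - κ * D.lyapunov γ w := by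
  have hstage : ∀ i : Fin n, ∃ C : ℝ, ∀ w ∈ D.safe, ∀ u : ℝ, |u - D.control (top n) w| ≤ Ω →
      0 ≤ w (.est i) → D.err i w * D.errRate P i w u ≤ C - γ i * (D.c i * D.err i w ^ 2 +
        w (.est i) * (D.err i w ^ 2 * D.Φ i w)) + D.err i w ^ 2 * D.Φ i w +
        D.nextTerm i w := by
    rintro ⟨i, hi⟩
    cases i with
    | zero =>
      have h : (⟨0, hi⟩ : Fin n) = 0 := by ext; simp
      rw [h]
      obtain ⟨C, hC⟩ := err_mul_errRate_zero_le hA (hγ 0)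
      exact ⟨C, fun w hw u _ hθ => hC w hw u hθ⟩
    | succ i =>
      obtain ⟨C, hC⟩ := err_mul_errRate_succ_le hA i hi (hγ _) Ω
      exact ⟨C, fun w _ u hu hθ => hC w u hu hθ⟩
  choose C hC using hstage
  have hr := hA.admissible.r_pos
  have hσ := hA.admissible.σ_pos
  have hc := hA.admissible.c_pos
  obtain ⟨i₀, -, hi₀⟩ := Finset.exists_min_image Finset.univ
    (fun i => min (2 * γ i * D.c i) (D.σ i)) ⟨0, Finset.mem_univ _⟩
  set κ := min (2 * γ i₀ * D.c i₀) (D.σ i₀) with hκ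
  have hκ0 : 0 < κ := lt_min (mul_pos (mul_pos two_pos (hγ0 _)) (hc _)) (hσ _)
  refine ⟨∑ i, (C i + γ i * D.σ i / (2 * D.r i) * (2 / γ i) ^ 2), κ, hκ0,
    fun w hw u hu hθ => ?_⟩
  have hN := D.sum_nextTerm_le w
  have hterm : ∀ i, D.err i w * D.errRate P i w u +
      γ i / D.r i * (w (.est i) - 2 / γ i) * D.rate i w ≤
      (C i + γ i * D.σ i / (2 * D.r i) * (2 / γ i) ^ 2) -
      κ * (D.err i w ^ 2 / 2 + γ i / (2 * D.r i) * (w (.est i) - 2 / γ i) ^ 2) +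
      (D.nextTerm i w - D.err i w ^ 2 * D.Φ i w) := by
    intro i
    have h1 := hC i w hw u hu (hθ i)
    have h2 : κ ≤ 2 * γ i * D.c i := (hi₀ i (Finset.mem_univ _)).trans (min_le_left _ _)
    have h3 : κ ≤ D.σ i := (hi₀ i (Finset.mem_univ _)).trans (min_le_right _ _)
    have h4 : κ * (D.err i w ^ 2) ≤ 2 * γ i * D.c i * D.err i w ^ 2 :=
      mul_le_mul_of_nonneg_right h2 (sq_nonneg _)
    have ha : 0 < γ i / (2 * D.r i) := div_pos (hγ0 i) (mul_pos two_pos (hr i))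
    have h5 : κ * (γ i / (2 * D.r i) * (w (.est i) - 2 / γ i) ^ 2) ≤
        D.σ i * (γ i / (2 * D.r i) * (w (.est i) - 2 / γ i) ^ 2) :=
      mul_le_mul_of_nonneg_right h3 (mul_nonneg ha.le (sq_nonneg _))
    have h6 : γ i / D.r i * (w (.est i) - 2 / γ i) * D.rate i w =
        γ i * w (.est i) * (D.err i w ^ 2 * D.Φ i w) - 2 * (D.err i w ^ 2 * D.Φ i w) -
        2 * (D.σ i * (γ i / (2 * D.r i))) * ((w (.est i) - 2 / γ i) * w (.est i)) := by
      have h7 := (hr i).ne'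
      have h8 := (hγ0 i).ne'
      rw [rate_apply]
      field_simp
    have h9 : γ i * D.σ i / (2 * D.r i) = D.σ i * (γ i / (2 * D.r i)) := by ring
    have h10 : 0 < D.σ i * (γ i / (2 * D.r i)) := mul_pos (hσ i) ha
    -- completing the square in the leakage term
    have h11 : (w (.est i) - 2 / γ i) ^ 2 - (2 / γ i) ^ 2 ≤
        2 * ((w (.est i) - 2 / γ i) * w (.est i)) := by
      nlinarith [sq_nonneg (w (.est i))]
    have h12 := mul_le_mul_of_nonneg_left h11 h10.le
    rw [h6, h9]
    nlinarith
  rw [lyapunovRate, lyapunov, Finset.mul_sum]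
  refine (Finset.sum_le_sum fun i _ => hterm i).trans ?_
  rw [Finset.sum_add_distrib, Finset.sum_sub_distrib, Finset.sum_sub_distrib]
  linarith

end Design

/-! ### Elementary facts about the scheme and about executions -/

namespace CodedScheme

variable (S : CodedScheme)

theorem two_mul_sc : 2 * S.sc = S.p ^ S.m :=
  Nat.mul_div_cancel' (dvd_pow S.p_even.two_dvd S.m_pos.ne')

theorem sc_pos : 0 < S.sc := by
  have h := S.two_mul_sc
  have := pow_pos S.p_pos S.m
  omega

theorem level_lt (a : ℝ) : S.level a < S.sc := by
  have h : S.level a ≤ S.sc - 1 := Nat.findGreatest_le _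
  have := S.sc_pos
  omega

theorem step_pos {q : ℕ} (hq : q < S.sc) : 0 < S.step q :=
  mul_pos (S.wgt_pos q hq) (pow_pos (by exact_mod_cast S.p_pos) q)

theorem threshold_pos (a : ℝ) : 0 < S.threshold a := S.step_pos (S.level_lt a)

theorem exists_threshold_le : ∃ Ω, ∀ a, S.threshold a ≤ Ω :=
  ⟨∑ q ∈ Finset.range S.sc, S.step q, fun a =>
    Finset.single_le_sum (f := S.step) (fun _ hq => (S.step_pos (Finset.mem_range.1 hq)).le)
      (Finset.mem_range.2 (S.level_lt a))⟩

theorem exists_le_threshold : ∃ η > 0, ∀ a, η ≤ S.threshold a := by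
  obtain ⟨q, hq, h⟩ := Finset.exists_min_image (Finset.range S.sc) S.step
    ⟨0, Finset.mem_range.2 S.sc_pos⟩
  exact ⟨S.step q, S.step_pos (Finset.mem_range.1 hq),
    fun a => h _ (Finset.mem_range.2 (S.level_lt a))⟩

end CodedScheme

namespace Execution

variable {n : ℕ} [NeZero n] {P : Plant n} {D : Design n} {S : CodedScheme}
variable (E : Execution P D S)

/-- The time interval on which an execution is defined. -/
def domain : Set ℝ := {t | 0 ≤ t ∧ (t : EReal) < E.horizon}

theorem Icc_subset_domain {t : ℝ} (ht : t ∈ E.domain) : Icc 0 t ⊆ E.domain := fun _ hs =>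
  ⟨hs.1, (EReal.coe_le_coe_iff.2 hs.2).trans_lt ht.2⟩

theorem event_le_succ (k : ℕ) : E.event k ≤ E.event (k + 1) := by
  rw [E.event_succ]
  refine le_sInf ?_
  rintro s ⟨t, rfl, h, -⟩
  exact h.le

theorem monotone_event : Monotone E.event := monotone_nat_of_le_succ E.event_le_succ

theorem event_nonneg (k : ℕ) : 0 ≤ E.event k := by
  rw [← E.event_zero]; exact E.monotone_event (Nat.zero_le k)

theorem coe_toReal_event {k : ℕ} (h : E.event k ≠ ⊤) : ((E.event k).toReal : EReal) = E.event k :=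
  EReal.coe_toReal h fun hb => by
    have := E.event_nonneg k
    rw [hb] at this
    simp at this

theorem event_lt_horizon {k : ℕ} (h : E.event (k + 1) ≠ ⊤) : E.event (k + 1) < E.horizon := by
  by_contra hcon
  push Not at hcon
  apply h
  rw [E.event_succ, sInf_eq_top]
  rintro s ⟨t, rfl, h1, h2, h3⟩
  exfalso
  have : E.event (k + 1) ≤ t := by
    rw [E.event_succ]
    exact sInf_le ⟨t, rfl, h1, h2, h3⟩
  exact absurd (hcon.trans this) (not_le.2 h2)

theorem v_eq_control (t : ℝ) : E.v t = D.control (Design.top n) (E.pt t) := E.v_eq t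

/-- The data of the sampling interval that contains a given time. -/
theorem exists_sample {t : ℝ} (ht : t ∈ E.domain) : ∃ k, E.event k ≤ t ∧
    (t : EReal) < E.event (k + 1) ∧ (E.event k).toReal ∈ E.domain ∧
    (E.event k).toReal ≤ t ∧ E.u t = E.v (E.event k).toReal := by
  obtain ⟨k, h1, h2⟩ := E.covered t ht.1 ht.2
  have hne : E.event k ≠ ⊤ := (h1.trans_lt (EReal.coe_lt_top t)).ne
  have hc := E.coe_toReal_event hne
  have h3 : (E.event k).toReal ≤ t := by
    rw [← EReal.coe_le_coe_iff, hc]; exact h1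
  have h4 : 0 ≤ (E.event k).toReal := EReal.toReal_nonneg (E.event_nonneg k)
  exact ⟨k, h1, h2, E.Icc_subset_domain ht ⟨h4, h3⟩, h3, E.hold t ht.1 ht.2 k h1 h2⟩

/-- Between two events the applied input differs from the control signal by less than the
threshold. -/
theorem abs_u_sub_v_le {Ω : ℝ} (hΩ : ∀ a, S.threshold a ≤ Ω) {t : ℝ} (ht : t ∈ E.domain) :
    |E.u t - E.v t| ≤ Ω := by
  obtain ⟨k, h1, h2, -, -, hu⟩ := E.exists_sample ht
  rw [hu, abs_sub_comm]
  refine le_trans ?_ (hΩ (E.v (E.event k).toReal))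
  by_contra hcon
  push Not at hcon
  rcases h1.lt_or_eq with h | h
  · have : E.event (k + 1) ≤ t := by
      rw [E.event_succ]
      exact sInf_le ⟨t, rfl, h, ht.2, hcon.le⟩
    exact absurd h2 (not_lt.2 this)
  · have h' : (E.event k).toReal = t := by rw [h]; rfl
    rw [h', sub_self, abs_zero] at hcon
    exact absurd hcon (not_lt.2 (S.threshold_pos _).le)

theorem pt_zero : E.pt 0 = D.point 0 D.xinit D.θinit := by
  rw [pt, E.x_init, E.θ_init]

theorem continuousOn_pt (hA : StandingAssumptions P D) : ContinuousOn E.pt E.domain := by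
  rw [continuousOn_pi]
  have hsub : E.domain ⊆ Ici 0 := fun t ht => ht.1
  rintro (i | i | k | k | k | k)
  · exact (continuous_apply i).comp_continuousOn E.x_cont
  · exact (continuous_apply i).comp_continuousOn E.θ_cont
  · exact (continuousOn_timeDeriv hA.reference.smooth (Nat.lt_succ_iff.1 k.isLt)).mono hsub
  · exact fun t _ => (D.hasDerivAt_iteratedDeriv_ρ k.val t).continuousAt.continuousWithinAt
  · exact (continuousOn_timeDeriv hA.auxiliary.smooth.1 k.isLt.le).mono hsub
  · exact (continuousOn_timeDeriv hA.auxiliary.smooth.2 k.isLt.le).mono hsub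

theorem est_nonneg (hA : StandingAssumptions P D) {t : ℝ} (ht : t ∈ E.domain) (i : Fin n) :
    0 ≤ E.θ t i := by
  have hsub := E.Icc_subset_domain ht
  refine nonneg_of_deriv_right_ge (f := fun s => E.θ s i)
    (f' := fun s => D.rate i (E.pt s)) (a := 0) (b := t) (σ := D.σ i) ?_ ?_ ?_ ?_ t
    (right_mem_Icc.2 ht.1)
  · exact ((continuous_apply i).comp_continuousOn E.θ_cont).mono hsub
  · intro s hs
    have := hsub (Ico_subset_Icc_self hs)
    exact E.θ_deriv s this.1 this.2 i
  · simp only [E.θ_init]; exact hA.admissible.θinit_nonneg i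
  · intro s _
    rw [Design.rate_apply]
    have h1 := hA.admissible.r_pos i
    have h2 := D.Φ_nonneg i (E.pt s)
    have h3 : 0 ≤ D.r i * D.err i (E.pt s) ^ 2 * D.Φ i (E.pt s) := by positivity
    change -(D.σ i * E.pt s (.est i)) ≤ _
    linarith

end Execution

/-! ### The prescribed performance and the boundedness of the variables -/

namespace Design

variable {n : ℕ} [NeZero n] {D : Design n} {P : Plant n}

theorem ρinf_le_ρ (hD : D.IsAdmissible) (t : ℝ) : D.ρinf ≤ D.ρ t := by
  have h1 := hD.ρinf_lt
  have h2 := Real.exp_pos (-D.ς * t)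
  rw [ρ]
  nlinarith

theorem Eu_point (t : ℝ) (x θ : Fin n → ℝ) : D.Eu (D.point t x θ) = D.upper t + D.ηu t := by
  simp [Eu, point, upper, timeDeriv_zero]

theorem El_point (t : ℝ) (x θ : Fin n → ℝ) : D.El (D.point t x θ) = D.lower t - D.ηl t := by
  simp [El, point, lower, timeDeriv_zero]

theorem e₁_point (t : ℝ) (x θ : Fin n → ℝ) : e₁ (D.point t x θ) = x 0 - D.yd t := by
  simp [e₁, point, timeDeriv_zero]

theorem le_Eu_add_El (hA : StandingAssumptions P D) {t : ℝ} (ht : 0 ≤ t) (x θ : Fin n → ℝ) :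
    2 * D.δ * D.ρinf ≤ D.Eu (D.point t x θ) + D.El (D.point t x θ) := by
  rw [Eu_point, El_point, upper, lower]
  have h1 := ρinf_le_ρ hA.admissible t
  have h2 := hA.admissible.δ_pos
  have h3 := hA.auxiliary.le t ht
  nlinarith

theorem point_zero_mem_safe (hA : StandingAssumptions P D) :
    D.point 0 D.xinit D.θinit ∈ D.safe := by
  have h1 := hA.auxiliary.init_upper
  have h2 := hA.auxiliary.init_lower
  rw [einit] at h1 h2
  constructor
  · rw [Eu_point, e₁_point]; linarith
  · rw [El_point, e₁_point]; linarith

/-- A bound on the logarithmic error keeps the tracking error away from both boundaries. -/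
theorem le_gap_of_abs_z₁_le {w : Var n → ℝ} (hw : w ∈ D.safe) {R s : ℝ}
    (hR : |D.z₁ w| ≤ R) (hs : s ≤ D.Eu w + D.El w) :
    s / (1 + Real.exp R) ≤ min (D.Eu w - e₁ w) (D.El w + e₁ w) := by
  obtain ⟨h1, h2⟩ := hw
  have he := Real.exp_pos R
  rw [z₁, Real.log_div h2.ne' h1.ne', abs_le] at hR
  have h3 : D.El w + e₁ w ≤ Real.exp R * (D.Eu w - e₁ w) := by
    rw [← Real.log_le_log_iff h2 (by positivity), Real.log_mul he.ne' h1.ne', Real.log_exp]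
    linarith [hR.2]
  have h4 : D.Eu w - e₁ w ≤ Real.exp R * (D.El w + e₁ w) := by
    rw [← Real.log_le_log_iff h1 (by positivity), Real.log_mul he.ne' h2.ne', Real.log_exp]
    linarith [hR.1]
  rw [div_le_iff₀ (by positivity)]
  rcases min_choice (D.Eu w - e₁ w) (D.El w + e₁ w) with h | h <;> rw [h] <;> nlinarith

theorem iteratedDeriv_ρ (k : ℕ) (t : ℝ) : iteratedDeriv k D.ρ t =
    (D.ρzero - D.ρinf) * (-D.ς) ^ k * Real.exp (-D.ς * t) + if k = 0 then D.ρinf else 0 := by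
  induction k generalizing t with
  | zero => simp [ρ]
  | succ k ih =>
    rw [iteratedDeriv_succ, funext ih]
    have he : HasDerivAt (fun t => Real.exp (-D.ς * t)) (Real.exp (-D.ς * t) * (-D.ς)) t := by
      simpa using ((hasDerivAt_id t).const_mul (-D.ς)).exp
    have := (he.const_mul ((D.ρzero - D.ρinf) * (-D.ς) ^ k)).add_const
      (if k = 0 then D.ρinf else 0)
    rw [this.deriv, if_neg (by omega)]
    ring

theorem exists_bound_iteratedDeriv_ρ (hD : D.IsAdmissible) (k : ℕ) :
    ∃ M : ℝ, ∀ t, 0 ≤ t → |iteratedDeriv k D.ρ t| ≤ M := by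
  refine ⟨|(D.ρzero - D.ρinf) * (-D.ς) ^ k| + |if k = 0 then D.ρinf else 0|, fun t ht => ?_⟩
  rw [iteratedDeriv_ρ]
  refine (abs_add_le _ _).trans ?_
  refine add_le_add ?_ le_rfl
  rw [abs_mul, Real.abs_exp]
  refine mul_le_of_le_one_right (abs_nonneg _) (Real.exp_le_one_iff.2 ?_)
  have := hD.ς_pos
  nlinarith

theorem continuousOn_lyapunov (hA : StandingAssumptions P D) (γ : Fin n → ℝ) :
    ContinuousOn (D.lyapunov γ) D.safe := by
  refine continuousOn_finsetSum _ fun i _ => ContinuousOn.add ?_ ?_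
  · exact ((contDiffOn_err hA.smooth_φ i).continuousOn.pow 2).div_const 2
  · exact Continuous.continuousOn (by fun_prop)

end Design

namespace Execution

variable {n : ℕ} [NeZero n] {P : Plant n} {D : Design n} {S : CodedScheme}

/-- The smaller one of the distances of the tracking error from the two boundaries. -/
noncomputable def gap (E : Execution P D S) (t : ℝ) : ℝ :=
  min (D.Eu (E.pt t) - Design.e₁ (E.pt t)) (D.El (E.pt t) + Design.e₁ (E.pt t))

theorem gap_pos_iff (E : Execution P D S) (t : ℝ) : 0 < E.gap t ↔ E.pt t ∈ D.safe := lt_min_iff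

/-- Uniform bounds for all executions: the errors and the estimates are bounded, and the tracking
error stays away from the boundaries. -/
theorem exists_uniform_bound (hA : StandingAssumptions P D) :
    ∃ R ε : ℝ, 0 < ε ∧ ∀ (E : Execution P D S), ∀ t ∈ E.domain, ε ≤ E.gap t ∧
      ∀ i, |D.err i (E.pt t)| ≤ R ∧ |E.pt t (.est i)| ≤ R := by
  choose γ ghi hγ0 hg using hA.g_mem
  obtain ⟨Ω, hΩ⟩ := S.exists_threshold_le
  obtain ⟨C, κ, hκ, hdiss⟩ := Design.lyapunovRate_le hA hγ0 (fun i ξ => (hg i ξ).1) Ω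
  have hr := hA.admissible.r_pos
  set B : ℝ := max (D.lyapunov γ (D.point 0 D.xinit D.θinit)) (C / κ) + 1 with hB
  -- as long as the tracking error stays between the boundaries, the sublevel set is invariant
  have hV : ∀ (E : Execution P D S), ∀ t ∈ E.domain, (∀ s ∈ Icc 0 t, 0 < E.gap s) →
      D.lyapunov γ (E.pt t) ≤ B := by
    intro E t ht hgap
    have hsub := E.Icc_subset_domain ht
    have hmaps : MapsTo E.pt (Icc 0 t) D.safe := fun s hs => (E.gap_pos_iff s).1 (hgap s hs)
    refine image_le_of_deriv_right_lt_deriv_boundary (a := 0) (b := t)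
      (f := fun s => D.lyapunov γ (E.pt s))
      (f' := fun s => D.lyapunovRate P γ (E.pt s) (E.u s)) (B := fun _ => B) (B' := fun _ => 0)
      ((Design.continuousOn_lyapunov hA γ).comp ((E.continuousOn_pt hA).mono hsub) hmaps)
      ?_ ?_ (fun _ => hasDerivAt_const _ _) ?_ (right_mem_Icc.2 ht.1)
    · intro s hs
      have hs' := Ico_subset_Icc_self hs
      have hsd := hsub hs'
      simp only [Design.lyapunov, Design.lyapunovRate]
      refine HasDerivWithinAt.fun_sum fun i _ => ?_
      have h1 := E.hasDerivWithinAt_err hA i hsd.1 hsd.2 (hmaps hs')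
      have h2 := E.θ_deriv s hsd.1 hsd.2 i
      have h3 := (h1.pow 2).div_const 2
      have h4 := ((h2.sub_const (2 / γ i)).pow 2).const_mul (γ i / (2 * D.r i))
      refine (h3.add h4).congr_deriv ?_
      have h5 := (hr i).ne'
      change _ = D.err i (E.pt s) * D.errRate P i (E.pt s) (E.u s) +
        γ i / D.r i * (E.θ s i - 2 / γ i) * D.rate i (E.pt s)
      simp only [pt]
      generalize 2 / γ i = ϑ
      push_cast
      field_simp
    · rw [E.pt_zero]
      exact (le_max_left _ _).trans (by rw [hB]; linarith)
    · intro s hs hsB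
      have hs' := Ico_subset_Icc_self hs
      have hu := E.abs_u_sub_v_le hΩ (hsub hs')
      rw [E.v_eq_control] at hu
      have := hdiss _ (hmaps hs') _ hu fun i => E.est_nonneg hA (hsub hs') i
      rw [hsB] at this
      have h1 : C / κ < B := lt_of_le_of_lt (le_max_right _ _) (lt_add_one _)
      rw [div_lt_iff₀ hκ] at h1
      linarith
  have hB0 : 0 ≤ B := by
    have h0 : 0 ≤ D.lyapunov γ (D.point 0 D.xinit D.θinit) :=
      Finset.sum_nonneg fun i _ => by
        have := hr i
        have := hγ0 i
        positivity
    have := le_max_left (D.lyapunov γ (D.point 0 D.xinit D.θinit)) (C / κ)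
    rw [hB]; linarith
  -- the sublevel set bounds each error and each estimate
  have hterm : ∀ w, D.lyapunov γ w ≤ B → ∀ i,
      D.err i w ^ 2 / 2 + γ i / (2 * D.r i) * (w (.est i) - 2 / γ i) ^ 2 ≤ B := by
    intro w hw i
    refine le_trans (Finset.single_le_sum (f := fun i => D.err i w ^ 2 / 2 +
      γ i / (2 * D.r i) * (w (.est i) - 2 / γ i) ^ 2) (fun j _ => ?_) (Finset.mem_univ i)) hw
    have := hr j
    have := hγ0 j
    positivity
  let R₀ : ℝ := 2 * B + 1
  let Rθ : Fin n → ℝ := fun i => 2 * D.r i * B / γ i + 1 + 2 / γ i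
  have habs : ∀ a b : ℝ, a ^ 2 ≤ b → |a| ≤ b + 1 := by
    intro a b h
    have : |a| ^ 2 ≤ b := by rwa [sq_abs]
    nlinarith [sq_nonneg (|a| - 1), abs_nonneg a]
  have hbd : ∀ w, D.lyapunov γ w ≤ B → ∀ i, |D.err i w| ≤ R₀ ∧ |w (.est i)| ≤ Rθ i := by
    intro w hw i
    have h1 := hterm w hw i
    have hri := hr i
    have hγi := hγ0 i
    have h2 : 0 ≤ γ i / (2 * D.r i) * (w (.est i) - 2 / γ i) ^ 2 := by positivity
    refine ⟨habs _ _ (by linarith), ?_⟩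
    have h3 : (w (.est i) - 2 / γ i) ^ 2 ≤ 2 * D.r i * B / γ i := by
      have h4 : γ i / (2 * D.r i) * (w (.est i) - 2 / γ i) ^ 2 ≤ B := by
        have := sq_nonneg (D.err i w)
        linarith
      rw [div_mul_eq_mul_div, div_le_iff₀ (by positivity)] at h4
      rw [le_div_iff₀ hγi]
      linarith
    have h5 := habs _ _ h3
    have h6 : |w (.est i)| ≤ |w (.est i) - 2 / γ i| + |2 / γ i| := by
      simpa using abs_add_le (w (.est i) - 2 / γ i) (2 / γ i)
    rw [abs_of_pos (by positivity : 0 < 2 / γ i)] at h6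
    simp only [Rθ]
    linarith
  have hRθ : ∀ i, 0 ≤ Rθ i := fun i => by
    have := hr i
    have := hγ0 i
    positivity
  have hδ := hA.admissible.δ_pos
  have hρ := hA.admissible.ρinf_pos
  refine ⟨R₀ + ∑ i, Rθ i, 2 * D.δ * D.ρinf / (1 + Real.exp R₀), by positivity,
    fun E t ht => ?_⟩
  -- hence the tracking error never gets close to the boundaries, and the bounds hold at all times
  have hgap : ∀ s ∈ Icc 0 t, 2 * D.δ * D.ρinf / (1 + Real.exp R₀) ≤ E.gap s := by
    have hsub := E.Icc_subset_domain ht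
    apply ge_of_forall_pos_initial (by positivity)
    · have hc := (E.continuousOn_pt hA).mono hsub
      have h1 : Continuous fun w => min (D.Eu w - Design.e₁ w) (D.El w + Design.e₁ w) :=
        (D.contDiff_Eu.continuous.sub Design.contDiff_e₁.continuous).min
          (D.contDiff_El.continuous.add Design.contDiff_e₁.continuous)
      exact h1.comp_continuousOn hc
    · rw [gap_pos_iff, E.pt_zero]
      exact Design.point_zero_mem_safe hA
    · intro s hs hpos
      have h1 := (hbd _ (hV E s (hsub hs) hpos) 0).1
      rw [D.err_zero] at h1
      exact Design.le_gap_of_abs_z₁_le ((E.gap_pos_iff s).1 (hpos s (right_mem_Icc.2 hs.1))) h1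
        (Design.le_Eu_add_El hA hs.1 _ _)
  refine ⟨hgap t (right_mem_Icc.2 ht.1), fun i => ?_⟩
  have h1 := hbd _ (hV E t ht fun s hs => lt_of_lt_of_le (by positivity) (hgap s hs)) i
  have h2 : Rθ i ≤ ∑ i, Rθ i := Finset.single_le_sum (fun j _ => hRθ j) (Finset.mem_univ i)
  have h3 : 0 ≤ ∑ i, Rθ i := Finset.sum_nonneg fun j _ => hRθ j
  have h4 : 0 ≤ R₀ := by simp only [R₀]; linarith
  exact ⟨by linarith [h1.1], by linarith [h1.2]⟩

end Execution

/-! ### A compact set of safe values that contains all executions -/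

namespace Design

variable {n : ℕ} [NeZero n] {D : Design n}

/-- The values of the variables that are bounded by `R` and for which the tracking error has at
least the distance `ε` from the boundaries. -/
def safeBox (D : Design n) (R : Var n → ℝ) (ε : ℝ) : Set (Var n → ℝ) :=
  {w | (∀ v, |w v| ≤ R v) ∧ ε ≤ min (D.Eu w - e₁ w) (D.El w + e₁ w)}

theorem isCompact_safeBox (R : Var n → ℝ) (ε : ℝ) : IsCompact (D.safeBox R ε) := by
  have h1 : Continuous fun w => min (D.Eu w - e₁ w) (D.El w + e₁ w) :=
    (D.contDiff_Eu.continuous.sub contDiff_e₁.continuous).min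
      (D.contDiff_El.continuous.add contDiff_e₁.continuous)
  have h2 : D.safeBox R ε = Icc (-R) R ∩ {w | ε ≤ min (D.Eu w - e₁ w) (D.El w + e₁ w)} := by
    ext w
    simp only [safeBox, mem_ofPred_eq, mem_inter_iff, mem_Icc, Pi.le_def, Pi.neg_apply, abs_le,
      forall_and]
  rw [h2]
  exact isCompact_Icc.inter_right (isClosed_le continuous_const h1)

theorem safeBox_subset_safe {R : Var n → ℝ} {ε : ℝ} (hε : 0 < ε) : D.safeBox R ε ⊆ D.safe :=
  fun _ hw => lt_min_iff.1 (hε.trans_le hw.2)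

end Design

namespace Execution

variable {n : ℕ} [NeZero n] {P : Plant n} {D : Design n} {S : CodedScheme}

theorem exists_bound_control (hA : StandingAssumptions P D) (i : Fin n)
    (h : ∀ v ∈ Var.upTo i.val, ∃ R : ℝ, ∀ E : Execution P D S, ∀ t ∈ E.domain, |E.pt t v| ≤ R) :
    ∃ M : ℝ, ∀ E : Execution P D S, ∀ t ∈ E.domain, |D.control i (E.pt t)| ≤ M := by
  classical
  obtain ⟨_, ε, hε, hgap⟩ := exists_uniform_bound (S := S) hA
  choose! R hR using h
  let R' : Var n → ℝ := fun v => if v ∈ Var.upTo i.val then R v else 0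
  obtain ⟨M, hM⟩ := (D.isCompact_safeBox R' ε).exists_bound_of_continuousOn
    ((Design.contDiffOn_control hA.smooth_φ i).continuousOn.mono (Design.safeBox_subset_safe hε))
  refine ⟨M, fun E t ht => ?_⟩
  -- the variables that do not occur are replaced by zero
  let w : Var n → ℝ := fun v => if v ∈ Var.upTo i.val then E.pt t v else 0
  have hw : ∀ v ∈ Var.upTo i.val, w v = E.pt t v := fun v hv => if_pos hv
  have hgapw := D.dependsOn_gap (x := w) (y := E.pt t)
    fun v hv => hw v (Var.upTo_mono (Nat.zero_le _) hv)
  simp only [Prod.mk.injEq] at hgapw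
  have hmem : w ∈ D.safeBox R' ε := by
    refine ⟨fun v => ?_, ?_⟩
    · by_cases hv : v ∈ Var.upTo i.val
      · simpa [w, R', hv] using hR v hv E t ht
      · simp [w, R', hv]
    · rw [hgapw.1, hgapw.2.1, hgapw.2.2.1]
      exact (hgap E t ht).1
  rw [← D.dependsOn_control i hw]
  exact hM w hmem

theorem exists_bound_signal (hA : StandingAssumptions P D) {v : Var n}
    (hv : ∀ i, v ≠ .state i) :
    ∃ R : ℝ, ∀ E : Execution P D S, ∀ t ∈ E.domain, |E.pt t v| ≤ R := by
  cases v with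
  | state i => exact absurd rfl (hv i)
  | est i =>
    obtain ⟨R, ε, -, h⟩ := exists_uniform_bound (S := S) hA
    exact ⟨R, fun E t ht => ((h E t ht).2 i).2⟩
  | ref k =>
    obtain ⟨M, hM⟩ := hA.reference.bounded k.val k.isLt.le
    exact ⟨M, fun E t ht => hM t ht.1⟩
  | perf k =>
    obtain ⟨M, hM⟩ := Design.exists_bound_iteratedDeriv_ρ hA.admissible k.val
    exact ⟨M, fun E t ht => hM t ht.1⟩
  | auxU k =>
    obtain ⟨M, hM⟩ := hA.auxiliary.bounded k.val k.isLt.le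
    exact ⟨M, fun E t ht => (hM t ht.1).1⟩
  | auxL k =>
    obtain ⟨M, hM⟩ := hA.auxiliary.bounded k.val k.isLt.le
    exact ⟨M, fun E t ht => (hM t ht.1).2⟩

/-- The states are bounded one after the other: `x_{i+1}` is the sum of `e_{i+1}` and a control that
depends only on variables whose boundedness is known. -/
theorem exists_bound_state (hA : StandingAssumptions P D) (i : ℕ) (hi : i < n) :
    ∃ R : ℝ, ∀ E : Execution P D S, ∀ t ∈ E.domain, |E.pt t (.state ⟨i, hi⟩)| ≤ R := by
  induction i using Nat.strong_induction_on with
  | _ i ih =>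
    obtain ⟨R, ε, hε, h⟩ := exists_uniform_bound (S := S) hA
    cases i with
    | zero =>
      obtain ⟨R0, hR0⟩ := exists_bound_signal (S := S) hA (v := .ref 0) (by simp)
      obtain ⟨R1, hR1⟩ := exists_bound_signal (S := S) hA (v := .perf 0) (by simp)
      obtain ⟨R2, hR2⟩ := exists_bound_signal (S := S) hA (v := .auxU 0) (by simp)
      obtain ⟨R3, hR3⟩ := exists_bound_signal (S := S) hA (v := .auxL 0) (by simp)
      have h0 : (⟨0, hi⟩ : Fin n) = 0 := by ext; simp
      refine ⟨R0 + |D.δ + D.sgn| * R1 + |D.δ - D.sgn| * R1 + |D.ρinf * D.sgn| + R2 + R3,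
        fun E t ht => ?_⟩
      obtain ⟨h1, h2⟩ := lt_min_iff.1 (hε.trans_le (h E t ht).1)
      rw [h0]
      simp only [Design.Eu, Design.El, Design.e₁] at h1 h2
      have b0 := abs_le.1 (hR0 E t ht)
      have b2 := abs_le.1 (hR2 E t ht)
      have b3 := abs_le.1 (hR3 E t ht)
      have b4 := abs_le.1 (show |(D.δ + D.sgn) * E.pt t (.perf 0)| ≤ |D.δ + D.sgn| * R1 by
        rw [abs_mul]; exact mul_le_mul_of_nonneg_left (hR1 E t ht) (abs_nonneg _))
      have b5 := abs_le.1 (show |(D.δ - D.sgn) * E.pt t (.perf 0)| ≤ |D.δ - D.sgn| * R1 by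
        rw [abs_mul]; exact mul_le_mul_of_nonneg_left (hR1 E t ht) (abs_nonneg _))
      have b6 := abs_le.1 (le_refl |D.ρinf * D.sgn|)
      rw [abs_le]
      constructor <;> linarith
    | succ i =>
      obtain ⟨M, hM⟩ := exists_bound_control (S := S) hA ⟨i, by omega⟩ (by
        intro v hv
        by_cases hs : ∃ j, v = .state j
        · obtain ⟨j, rfl⟩ := hs
          exact ih j.val (Nat.lt_succ_of_le hv) j.isLt
        · exact exists_bound_signal hA fun j hj => hs ⟨j, hj⟩)
      refine ⟨R + M, fun E t ht => ?_⟩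
      have h1 := ((h E t ht).2 ⟨i + 1, hi⟩).1
      rw [D.err_succ] at h1
      have h2 := hM E t ht
      have h3 := abs_add_le (E.pt t (.state ⟨i + 1, hi⟩) - D.control ⟨i, by omega⟩ (E.pt t))
        (D.control ⟨i, by omega⟩ (E.pt t))
      rw [sub_add_cancel] at h3
      linarith

theorem exists_compact (P : Plant n) (D : Design n) (S : CodedScheme)
    (hA : StandingAssumptions P D) :
    ∃ K : Set (Var n → ℝ), IsCompact K ∧ K ⊆ D.safe ∧
      ∀ E : Execution P D S, ∀ t ∈ E.domain, E.pt t ∈ K := by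
  obtain ⟨_, ε, hε, h⟩ := exists_uniform_bound (S := S) hA
  have hv : ∀ v : Var n, ∃ R : ℝ, ∀ E : Execution P D S, ∀ t ∈ E.domain, |E.pt t v| ≤ R := by
    intro v
    by_cases hs : ∃ j, v = .state j
    · obtain ⟨j, rfl⟩ := hs
      exact exists_bound_state hA j.val j.isLt
    · exact exists_bound_signal hA fun j hj => hs ⟨j, hj⟩
  choose R hR using hv
  exact ⟨D.safeBox R ε, D.isCompact_safeBox R ε, Design.safeBox_subset_safe hε,
    fun E t ht => ⟨fun v => hR v E t ht, (h E t ht).1⟩⟩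

/-! ### Uniform continuity and the minimal time between events -/

theorem exists_bound_u (hA : StandingAssumptions P D) :
    ∃ M : ℝ, ∀ E : Execution P D S, ∀ t ∈ E.domain, |E.u t| ≤ M := by
  obtain ⟨K, hK, hKs, hmem⟩ := exists_compact P D S hA
  obtain ⟨M, hM⟩ := hK.exists_bound_of_continuousOn
    ((Design.contDiffOn_control hA.smooth_φ (Design.top n)).continuousOn.mono hKs)
  refine ⟨M, fun E t ht => ?_⟩
  obtain ⟨k, -, -, hk, -, hu⟩ := E.exists_sample ht
  rw [hu, E.v_eq_control]
  exact hM _ (hmem E _ hk)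

theorem continuous_headState (i : Fin n) : Continuous fun x : Fin n → ℝ => headState x i := by
  unfold headState; fun_prop

theorem _root_.Plant.continuous_rhs (hA : StandingAssumptions P D) (i : Fin n) :
    Continuous fun q : (Fin n → ℝ) × ℝ => P.rhs q.1 q.2 i := by
  unfold Plant.rhs
  have h1 := (continuous_headState i).comp (continuous_fst (X := Fin n → ℝ) (Y := ℝ))
  have h2 := (hA.cont_f i).comp h1
  have h3 := (hA.cont_g i).comp h1
  refine h2.add (h3.mul ?_)
  split_ifs <;> fun_prop

/-- The velocities of all variables are bounded, uniformly for all executions. -/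
theorem exists_bound_velocity (hA : StandingAssumptions P D) :
    ∃ L : ℝ, 0 ≤ L ∧ ∀ E : Execution P D S, ∀ t ∈ E.domain, ∀ v, |E.velocity t v| ≤ L := by
  obtain ⟨K, hK, hKs, hmem⟩ := exists_compact P D S hA
  obtain ⟨M, hM⟩ := exists_bound_u (S := S) hA
  suffices hv : ∀ v : Var n, ∃ L : ℝ, ∀ E : Execution P D S, ∀ t ∈ E.domain,
      |E.velocity t v| ≤ L by
    choose L hL using hv
    refine ⟨∑ v, |L v|, Finset.sum_nonneg fun _ _ => abs_nonneg _, fun E t ht v => ?_⟩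
    exact ((hL v E t ht).trans (le_abs_self _)).trans
      (Finset.single_le_sum (f := fun v => |L v|) (fun _ _ => abs_nonneg _) (Finset.mem_univ v))
  rintro (i | i | k | k | k | k)
  · have hc : Continuous fun q : (Var n → ℝ) × ℝ => P.rhs (fun j => q.1 (.state j)) q.2 i :=
      (Plant.continuous_rhs hA i).comp (f := fun q : (Var n → ℝ) × ℝ =>
        (fun j => q.1 (.state j), q.2)) (by fun_prop)
    obtain ⟨L, hL⟩ := (hK.prod (isCompact_Icc (a := -M) (b := M))).exists_bound_of_continuousOn
      hc.continuousOn
    exact ⟨L, fun E t ht => hL (E.pt t, E.u t) ⟨hmem E t ht, abs_le.1 (hM E t ht)⟩⟩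
  · obtain ⟨L, hL⟩ := hK.exists_bound_of_continuousOn
      ((Design.contDiffOn_rate hA.smooth_φ i).continuousOn.mono hKs)
    exact ⟨L, fun E t ht => hL _ (hmem E t ht)⟩
  · obtain ⟨L, hL⟩ := hA.reference.bounded (k.val + 1) (by omega)
    exact ⟨L, fun E t ht => hL t ht.1⟩
  · obtain ⟨L, hL⟩ := Design.exists_bound_iteratedDeriv_ρ hA.admissible (k.val + 1)
    exact ⟨L, fun E t ht => hL t ht.1⟩
  · obtain ⟨L, hL⟩ := hA.auxiliary.bounded (k.val + 1) (by omega)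
    exact ⟨L, fun E t ht => (hL t ht.1).1⟩
  · obtain ⟨L, hL⟩ := hA.auxiliary.bounded (k.val + 1) (by omega)
    exact ⟨L, fun E t ht => (hL t ht.1).2⟩

theorem _root_.IsReference.abs_sub_le {y : ℝ → ℝ} (hy : IsReference n y) {M s t : ℝ}
    (hM : ∀ t, 0 ≤ t → |timeDeriv (n + 1) y t| ≤ M) (hs : 0 ≤ s) (hst : s ≤ t) :
    |timeDeriv n y t - timeDeriv n y s| ≤ M * (t - s) := by
  obtain ⟨A, hA, h⟩ := hy.piecewise
  refine abs_sub_le_of_deriv_off_finset (hA t).toFinset (f' := timeDeriv (n + 1) y) hst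
    ((continuousOn_timeDeriv hy.smooth le_rfl).mono fun r hr => hs.trans hr.1) ?_
    (fun r hr => hM r (hs.trans hr.1.le))
  intro r hr hrA
  have hr0 : 0 < r := hs.trans_lt hr.1
  have hrA' : r ∉ A := fun hmem => hrA (by
    rw [Set.Finite.mem_toFinset]; exact ⟨hmem, hr0.le, hr.2.le⟩)
  have h1 := (h r hr0.le hrA').1.hasDerivWithinAt.hasDerivAt (Ici_mem_nhds hr0)
  have h2 : derivWithin (timeDeriv n y) (Ici 0) r = timeDeriv (n + 1) y r := by
    unfold timeDeriv
    rw [iteratedDerivWithin_succ]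
  rwa [h2] at h1

theorem exists_lipschitz_pt (P : Plant n) (D : Design n) (S : CodedScheme)
    (hA : StandingAssumptions P D) :
    ∃ L : ℝ, 0 ≤ L ∧ ∀ E : Execution P D S, ∀ s ∈ E.domain, ∀ t ∈ E.domain,
      dist (E.pt s) (E.pt t) ≤ L * dist s t := by
  obtain ⟨L, hL0, hL⟩ := exists_bound_velocity (S := S) hA
  obtain ⟨M, hM⟩ := hA.reference.bounded (n + 1) le_rfl
  have hM0 : 0 ≤ M := (abs_nonneg _).trans (hM 0 le_rfl)
  refine ⟨L + M, by positivity, fun E s hs t ht => ?_⟩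
  wlog hst : s ≤ t generalizing s t
  · rw [dist_comm, dist_comm s t]
    exact this t ht s hs (le_of_not_ge hst)
  rw [dist_comm, dist_comm s t, dist_pi_le_iff (by positivity), Real.dist_eq,
    abs_of_nonneg (sub_nonneg.2 hst)]
  intro v
  rw [Real.dist_eq]
  by_cases hv : v = .ref (Fin.last n)
  · subst hv
    refine (hA.reference.abs_sub_le hM hs.1 hst).trans ?_
    exact mul_le_mul_of_nonneg_right (by linarith) (sub_nonneg.2 hst)
  · have hsub : Icc s t ⊆ E.domain := fun r hr => E.Icc_subset_domain ht ⟨hs.1.trans hr.1, hr.2⟩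
    have h := norm_image_sub_le_of_norm_deriv_right_le_segment (a := s) (b := t)
      (f := fun r => E.pt r v) (f' := fun r => E.velocity r v) (C := L)
      (((continuous_apply v).comp_continuousOn (E.continuousOn_pt hA)).mono hsub)
      (fun r hr => E.hasDerivWithinAt_pt hA (hsub (Ico_subset_Icc_self hr)).1
        (hsub (Ico_subset_Icc_self hr)).2 hv)
      (fun r hr => hL E r (hsub (Ico_subset_Icc_self hr)) v) t (right_mem_Icc.2 hst)
    refine h.trans ?_
    exact mul_le_mul_of_nonneg_right (by linarith) (sub_nonneg.2 hst)

/-- The control signal is uniformly continuous, so that it needs a minimal time to change by the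
smallest threshold. -/
theorem exists_minimal_time (P : Plant n) (D : Design n) (S : CodedScheme)
    (hA : StandingAssumptions P D) :
    ∃ τ : ℝ, 0 < τ ∧ ∀ E : Execution P D S, ∀ k,
      E.event k + (τ : EReal) ≤ E.event (k + 1) := by
  obtain ⟨K, hK, hKs, hmem⟩ := exists_compact P D S hA
  obtain ⟨L, hL0, hL⟩ := exists_lipschitz_pt P D S hA
  obtain ⟨η, hη, hthr⟩ := S.exists_le_threshold
  have huc := hK.uniformContinuousOn_of_continuous
    ((Design.contDiffOn_control hA.smooth_φ (Design.top n)).continuousOn.mono hKs)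
  obtain ⟨d, hd, huc⟩ := Metric.uniformContinuousOn_iff.1 huc η hη
  refine ⟨d / (L + 1), by positivity, fun E k => ?_⟩
  rw [E.event_succ]
  refine le_sInf ?_
  rintro s ⟨t, rfl, h1, h2, h3⟩
  have hne : E.event k ≠ ⊤ := (h1.trans (EReal.coe_lt_top t)).ne
  have hc := E.coe_toReal_event hne
  set a := (E.event k).toReal with ha
  have ha0 : 0 ≤ a := EReal.toReal_nonneg (E.event_nonneg k)
  have hat : a < t := by rw [← EReal.coe_lt_coe_iff, hc]; exact h1
  have htd : t ∈ E.domain := ⟨ha0.trans hat.le, h2⟩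
  have had : a ∈ E.domain := E.Icc_subset_domain htd ⟨ha0, hat.le⟩
  rw [← hc, ← EReal.coe_add, EReal.coe_le_coe_iff]
  by_contra hcon
  push Not at hcon
  have h4 : dist (E.pt t) (E.pt a) < d := by
    refine (hL E t htd a had).trans_lt ?_
    rw [Real.dist_eq, abs_of_pos (sub_pos.2 hat)]
    have h5 : t - a < d / (L + 1) := by linarith
    rw [lt_div_iff₀ (by positivity)] at h5
    nlinarith
  have h6 := huc _ (hmem E t htd) _ (hmem E a had) h4
  rw [Real.dist_eq, ← E.v_eq_control, ← E.v_eq_control] at h6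
  linarith [hthr (E.v a)]

end Execution

/-! ### The events that a control signal generates -/

/-- The event times that the control signal `v` generates before the horizon `H`. -/
noncomputable def eventSeq (S : CodedScheme) (H : EReal) (v : ℝ → ℝ) : ℕ → EReal
  | 0 => 0
  | k + 1 => sInf {s : EReal | ∃ t : ℝ, s = t ∧ eventSeq S H v k < t ∧ (t : EReal) < H ∧
      S.threshold (v (eventSeq S H v k).toReal) ≤ |v t - v (eventSeq S H v k).toReal|}

/-- The sampled signal that is held between the generated events. -/
noncomputable def heldInput (S : CodedScheme) (H : EReal) (v : ℝ → ℝ) (t : ℝ) : ℝ :=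
  open Classical in
  if h : ∃ k, eventSeq S H v k ≤ t ∧ (t : EReal) < eventSeq S H v (k + 1) then
    v (eventSeq S H v h.choose).toReal else 0

section EventSeq

variable {S : CodedScheme} {H h : EReal} {v w : ℝ → ℝ}

theorem monotone_eventSeq : Monotone (eventSeq S H v) := by
  refine monotone_nat_of_le_succ fun k => le_sInf ?_
  rintro s ⟨t, rfl, hs, -⟩
  exact hs.le

theorem eventSeq_nonneg (k : ℕ) : 0 ≤ eventSeq S H v k :=
  monotone_eventSeq (Nat.zero_le k)

theorem heldInput_eq {k : ℕ} {t : ℝ} (h1 : eventSeq S H v k ≤ t)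
    (h2 : (t : EReal) < eventSeq S H v (k + 1)) :
    heldInput S H v t = v (eventSeq S H v k).toReal := by
  have hex : ∃ k, eventSeq S H v k ≤ t ∧ (t : EReal) < eventSeq S H v (k + 1) := ⟨k, h1, h2⟩
  rw [heldInput, dif_pos hex]
  obtain ⟨h3, h4⟩ := hex.choose_spec
  have hlt : ∀ i j, eventSeq S H v i ≤ t → (t : EReal) < eventSeq S H v (j + 1) → i ≤ j := by
    intro i j hi hj
    by_contra hcon
    push Not at hcon
    exact absurd (hi.trans_lt hj) (not_lt.2 (monotone_eventSeq hcon))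
  rw [le_antisymm (hlt _ _ h3 h2) (hlt _ _ h1 h4)]

theorem toReal_nonneg_lt {e : EReal} (h0 : 0 ≤ e) (he : e < h) :
    0 ≤ e.toReal ∧ ((e.toReal : ℝ) : EReal) < h := by
  have h1 : e ≠ ⊤ := (he.trans_le le_top).ne
  have h2 : e ≠ ⊥ := fun hb => by rw [hb] at h0; simp at h0
  exact ⟨EReal.toReal_nonneg h0, by rwa [EReal.coe_toReal h1 h2]⟩

/-- The events before `h` depend only on the control signal before `h`. -/
theorem eventSeq_congr (hH : h ≤ H) (h0 : v 0 = w 0)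
    (hvw : ∀ t : ℝ, 0 ≤ t → (t : EReal) < h → v t = w t) (k : ℕ) :
    (eventSeq S h v k = eventSeq S H w k ∧ (eventSeq S h v k < h ∨ k = 0)) ∨
      (eventSeq S h v k = ⊤ ∧ h ≤ eventSeq S H w k) := by
  induction k with
  | zero => exact Or.inl ⟨rfl, Or.inr rfl⟩
  | succ k ih =>
    rcases ih with ⟨heq, hlt⟩ | ⟨htop, hle⟩
    · have hs : v (eventSeq S h v k).toReal = w (eventSeq S h v k).toReal := by
        rcases hlt with hlt | rfl
        · obtain ⟨h1, h2⟩ := toReal_nonneg_lt (eventSeq_nonneg k) hlt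
          exact hvw _ h1 h2
        · simpa [eventSeq] using h0
      set A := {s : EReal | ∃ t : ℝ, s = t ∧ eventSeq S h v k < t ∧ (t : EReal) < h ∧
        S.threshold (v (eventSeq S h v k).toReal) ≤ |v t - v (eventSeq S h v k).toReal|} with hA
      set B := {s : EReal | ∃ t : ℝ, s = t ∧ eventSeq S H w k < t ∧ (t : EReal) < H ∧
        S.threshold (w (eventSeq S H w k).toReal) ≤ |w t - w (eventSeq S H w k).toReal|} with hB
      have eA : eventSeq S h v (k + 1) = sInf A := rfl
      have eB : eventSeq S H w (k + 1) = sInf B := rfl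
      have hAB : A ⊆ B := by
        rintro s ⟨t, rfl, h1, h2, h3⟩
        have ht0 : 0 ≤ t := by
          have := (eventSeq_nonneg k).trans_lt h1
          exact_mod_cast this.le
        refine ⟨t, rfl, heq ▸ h1, h2.trans_le hH, ?_⟩
        rw [← heq, ← hs, ← hvw t ht0 h2]
        exact h3
      have hBA : ∀ s ∈ B, s < h → s ∈ A := by
        rintro s ⟨t, rfl, h1, h2, h3⟩ hth
        rw [← heq] at h1 h3
        have ht0 : 0 ≤ t := by
          have := (eventSeq_nonneg k).trans_lt h1
          exact_mod_cast this.le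
        refine ⟨t, rfl, h1, hth, ?_⟩
        rw [hs, hvw t ht0 hth]
        exact h3
      rw [eA, eB]
      rcases A.eq_empty_or_nonempty with hne | ⟨s, hsA⟩
      · right
        rw [hne, sInf_empty]
        refine ⟨rfl, le_sInf fun s hsB => ?_⟩
        by_contra hcon
        push Not at hcon
        exact absurd (hBA s hsB hcon) (by rw [hne]; exact notMem_empty s)
      · left
        have hsh : s < h := by
          obtain ⟨t, rfl, -, h2, -⟩ := hsA
          exact h2
        refine ⟨le_antisymm (le_sInf fun r hr => ?_) (sInf_le_sInf hAB),
          Or.inl ((sInf_le hsA).trans_lt hsh)⟩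
        rcases lt_or_ge r h with hrh | hrh
        · exact sInf_le (hBA r hr hrh)
        · exact (sInf_le hsA).trans (hsh.le.trans hrh)
    · right
      constructor
      · change sInf _ = ⊤
        rw [sInf_eq_top]
        rintro s ⟨t, rfl, h1, -⟩
        rw [htop] at h1
        exact absurd h1 not_top_lt
      · exact hle.trans (monotone_eventSeq (Nat.le_succ k))

/-- The sampling interval of a time before `h` is the same for both signals. -/
theorem eventSeq_interval_congr (hH : h ≤ H) (h0 : v 0 = w 0)
    (hvw : ∀ t : ℝ, 0 ≤ t → (t : EReal) < h → v t = w t) {t : ℝ} (hth : (t : EReal) < h) {k : ℕ}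
    (h1 : eventSeq S h v k ≤ t) (h2 : (t : EReal) < eventSeq S h v (k + 1)) :
    eventSeq S H w k ≤ t ∧ (t : EReal) < eventSeq S H w (k + 1) ∧
      w (eventSeq S H w k).toReal = v (eventSeq S h v k).toReal := by
  have hk : eventSeq S h v k = eventSeq S H w k := by
    rcases eventSeq_congr (S := S) hH h0 hvw k with ⟨h3, -⟩ | ⟨h3, -⟩
    · exact h3
    · rw [h3] at h1
      exact absurd h1 (not_le.2 (EReal.coe_lt_top t))
  have h4 := toReal_nonneg_lt (eventSeq_nonneg k) (h1.trans_lt hth)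
  refine ⟨hk ▸ h1, ?_, by rw [← hk, hvw _ h4.1 h4.2]⟩
  rcases eventSeq_congr (S := S) hH h0 hvw (k + 1) with ⟨h3, -⟩ | ⟨-, h3⟩
  · exact h3 ▸ h2
  · exact hth.trans_le h3

end EventSeq

namespace Execution

variable {n : ℕ} [NeZero n] {P : Plant n} {D : Design n} {S : CodedScheme}

theorem event_eq_eventSeq (E : Execution P D S) (k : ℕ) :
    E.event k = eventSeq S E.horizon E.v k := by
  induction k with
  | zero => exact E.event_zero
  | succ k ih => rw [E.event_succ, ih]; rfl

/-- The control signal of a trajectory. -/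
noncomputable def controlOf (D : Design n) (x θ : ℝ → Fin n → ℝ) (t : ℝ) : ℝ :=
  D.control (Design.top n) (D.point t (x t) (θ t))

/-- An execution is determined by its trajectory: the events and the applied input can be
reconstructed from it. -/
theorem exists_of_trajectory {H : EReal} (hH : 0 ≤ H) {x θ : ℝ → Fin n → ℝ}
    (hx0 : x 0 = D.xinit) (hθ0 : θ 0 = D.θinit)
    (hxc : ContinuousOn x {t | 0 ≤ t ∧ (t : EReal) < H})
    (hθc : ContinuousOn θ {t | 0 ≤ t ∧ (t : EReal) < H})
    (h : ∀ t : ℝ, 0 ≤ t → (t : EReal) < H → ∃ k, eventSeq S H (controlOf D x θ) k ≤ t ∧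
      (t : EReal) < eventSeq S H (controlOf D x θ) (k + 1) ∧
      ∀ i, HasDerivWithinAt (fun s => x s i) (P.rhs (x t)
          (controlOf D x θ (eventSeq S H (controlOf D x θ) k).toReal) i) (Ici t) t ∧
        HasDerivWithinAt (fun s => θ s i) (D.rate i (D.point t (x t) (θ t))) (Ici t) t) :
    ∃ E : Execution P D S, E.horizon = H ∧ E.x = x ∧ E.θ = θ :=
  ⟨{ horizon := H
     horizon_nonneg := hH
     x := x
     θ := θ
     v := controlOf D x θ
     u := heldInput S H (controlOf D x θ)
     event := eventSeq S H (controlOf D x θ)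
     x_init := hx0
     θ_init := hθ0
     x_cont := hxc
     θ_cont := hθc
     x_deriv := fun t h0 hT i => by
       obtain ⟨k, h1, h2, h3⟩ := h t h0 hT
       rw [heldInput_eq h1 h2]
       exact (h3 i).1
     θ_deriv := fun t h0 hT i => by
       obtain ⟨k, -, -, h3⟩ := h t h0 hT
       exact (h3 i).2
     v_eq := fun _ => rfl
     event_zero := rfl
     event_succ := fun _ => rfl
     covered := fun t h0 hT => by
       obtain ⟨k, h1, h2, -⟩ := h t h0 hT
       exact ⟨k, h1, h2⟩
     hold := fun t _ _ k h1 h2 => heldInput_eq h1 h2 }, rfl, rfl, rfl⟩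

/-- A trajectory inherits the requirements on an execution from the executions that it extends. -/
theorem trajectory_of_restriction (E : Execution P D S) {H : EReal} (hH : E.horizon ≤ H)
    {x θ : ℝ → Fin n → ℝ} (hx0 : x 0 = D.xinit) (hθ0 : θ 0 = D.θinit)
    (hE : ∀ t : ℝ, 0 ≤ t → (t : EReal) < E.horizon → x t = E.x t ∧ θ t = E.θ t)
    {t : ℝ} (ht0 : 0 ≤ t) (ht : (t : EReal) < E.horizon) :
    ∃ k, eventSeq S H (controlOf D x θ) k ≤ t ∧
      (t : EReal) < eventSeq S H (controlOf D x θ) (k + 1) ∧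
      ∀ i, HasDerivWithinAt (fun s => x s i) (P.rhs (x t)
          (controlOf D x θ (eventSeq S H (controlOf D x θ) k).toReal) i) (Ici t) t ∧
        HasDerivWithinAt (fun s => θ s i) (D.rate i (D.point t (x t) (θ t))) (Ici t) t := by
  have hv : ∀ t : ℝ, 0 ≤ t → (t : EReal) < E.horizon → E.v t = controlOf D x θ t := by
    intro t h0 h1
    rw [E.v_eq, controlOf, (hE t h0 h1).1, (hE t h0 h1).2]
  have hv0 : E.v 0 = controlOf D x θ 0 := by
    rw [E.v_eq, controlOf, hx0, hθ0, E.x_init, E.θ_init]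
  obtain ⟨k, h1, h2⟩ := E.covered t ht0 ht
  have hu := E.hold t ht0 ht k h1 h2
  rw [event_eq_eventSeq] at h1 h2 hu
  obtain ⟨h3, h4, h5⟩ := eventSeq_interval_congr hH hv0 hv ht h1 h2
  have hnear : ∀ᶠ s in 𝓝[Ici t] t, x s = E.x s ∧ θ s = E.θ s := by
    have hlt : ∀ᶠ s : ℝ in 𝓝 t, (s : EReal) < E.horizon :=
      continuous_coe_real_ereal.continuousAt.eventually (gt_mem_nhds ht)
    filter_upwards [self_mem_nhdsWithin, nhdsWithin_le_nhds hlt] with s hs hs'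
    exact hE s (ht0.trans hs) hs'
  refine ⟨k, h3, h4, fun i => ⟨?_, ?_⟩⟩
  · rw [h5, ← hu, (hE t ht0 ht).1]
    refine (E.x_deriv t ht0 ht i).congr_of_eventuallyEq ?_ (by rw [(hE t ht0 ht).1])
    filter_upwards [hnear] with s hs using by rw [hs.1]
  · rw [(hE t ht0 ht).1, (hE t ht0 ht).2]
    refine (E.θ_deriv t ht0 ht i).congr_of_eventuallyEq ?_ (by rw [(hE t ht0 ht).2])
    filter_upwards [hnear] with s hs using by rw [hs.2]

/-- Executions that continue each other can be united. -/
theorem exists_glue {H : EReal} (hH : 0 ≤ H) {x θ : ℝ → Fin n → ℝ}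
    (hx0 : x 0 = D.xinit) (hθ0 : θ 0 = D.θinit)
    (h : ∀ t : ℝ, 0 ≤ t → (t : EReal) < H → ∃ E : Execution P D S, (t : EReal) < E.horizon ∧
      E.horizon ≤ H ∧
      ∀ s : ℝ, 0 ≤ s → (s : EReal) < E.horizon → x s = E.x s ∧ θ s = E.θ s) :
    ∃ E : Execution P D S, E.horizon = H ∧ E.x = x ∧ E.θ = θ := by
  have hnear : ∀ t : ℝ, 0 ≤ t → (t : EReal) < H → ∃ E : Execution P D S, t ∈ E.domain ∧
      ∀ᶠ s in 𝓝[{t | 0 ≤ t ∧ (t : EReal) < H}] t, s ∈ E.domain ∧ x s = E.x s ∧ θ s = E.θ s := by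
    intro t h0 hT
    obtain ⟨E, h1, -, h3⟩ := h t h0 hT
    refine ⟨E, ⟨h0, h1⟩, ?_⟩
    have hlt : ∀ᶠ s : ℝ in 𝓝 t, (s : EReal) < E.horizon :=
      continuous_coe_real_ereal.continuousAt.eventually (gt_mem_nhds h1)
    filter_upwards [self_mem_nhdsWithin, nhdsWithin_le_nhds hlt] with s hs hs'
    exact ⟨⟨hs.1, hs'⟩, h3 s hs.1 hs'⟩
  refine exists_of_trajectory hH hx0 hθ0 ?_ ?_ fun t h0 hT => ?_
  · rintro t ⟨h0, hT⟩
    obtain ⟨E, ht, hev⟩ := hnear t h0 hT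
    have h1 : ContinuousWithinAt E.x {t | 0 ≤ t ∧ (t : EReal) < H} t :=
      (E.x_cont t ht).mono_of_mem_nhdsWithin (hev.mono fun s hs => hs.1)
    exact h1.congr_of_eventuallyEq (hev.mono fun s hs => hs.2.1)
      (hev.self_of_nhdsWithin ⟨h0, hT⟩).2.1
  · rintro t ⟨h0, hT⟩
    obtain ⟨E, ht, hev⟩ := hnear t h0 hT
    have h1 : ContinuousWithinAt E.θ {t | 0 ≤ t ∧ (t : EReal) < H} t :=
      (E.θ_cont t ht).mono_of_mem_nhdsWithin (hev.mono fun s hs => hs.1)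
    exact h1.congr_of_eventuallyEq (hev.mono fun s hs => hs.2.2)
      (hev.self_of_nhdsWithin ⟨h0, hT⟩).2.2
  · obtain ⟨E, h1, h2, h3⟩ := h t h0 hT
    exact E.trajectory_of_restriction h2 hx0 hθ0 h3 h0 h1

/-! ### Maximal executions -/

/-- `E'` continues `E`. -/
def Continues (E E' : Execution P D S) : Prop :=
  E.horizon ≤ E'.horizon ∧
    ∀ t : ℝ, 0 ≤ t → (t : EReal) < E.horizon → E'.x t = E.x t ∧ E'.θ t = E.θ t

theorem exists_initial (P : Plant n) (D : Design n) (S : CodedScheme) :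
    ∃ E : Execution P D S, E.horizon = 0 := by
  have h0 : ∀ t : ℝ, 0 ≤ t → ¬ ((t : EReal) < 0) := fun t ht h => by
    have : t < 0 := by exact_mod_cast h
    linarith
  obtain ⟨E, hE, -⟩ := exists_glue (P := P) (D := D) (S := S) (H := 0) le_rfl
    (x := fun _ => D.xinit) (θ := fun _ => D.θinit) rfl rfl
    fun t h1 h2 => absurd h2 (h0 t h1)
  exact ⟨E, hE⟩

theorem exists_upper_bound {c : Set (Execution P D S)} (hc : IsChain Continues c) :
    ∃ U : Execution P D S, ∀ E ∈ c, Continues E U := by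
  classical
  rcases c.eq_empty_or_nonempty with rfl | ⟨E₀, hE₀⟩
  · obtain ⟨E, -⟩ := exists_initial P D S
    exact ⟨E, fun _ h => absurd h (notMem_empty _)⟩
  have hagree : ∀ E ∈ c, ∀ E' ∈ c, ∀ t : ℝ, 0 ≤ t → (t : EReal) < E.horizon →
      (t : EReal) < E'.horizon → E'.x t = E.x t ∧ E'.θ t = E.θ t := by
    intro E hE E' hE' t h0 h1 h2
    rcases eq_or_ne E E' with rfl | hne
    · exact ⟨rfl, rfl⟩
    rcases hc hE hE' hne with h | h
    · exact h.2 t h0 h1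
    · exact ⟨(h.2 t h0 h2).1.symm, (h.2 t h0 h2).2.symm⟩
  let pick : ℝ → Execution P D S := fun t =>
    if h : ∃ E ∈ c, (t : EReal) < E.horizon then h.choose else E₀
  have hpickc : ∀ t, pick t ∈ c := by
    intro t
    by_cases h : ∃ E ∈ c, (t : EReal) < E.horizon
    · simp only [pick, dif_pos h]; exact h.choose_spec.1
    · simp only [pick, dif_neg h]; exact hE₀
  have hpick : ∀ E ∈ c, ∀ t : ℝ, 0 ≤ t → (t : EReal) < E.horizon →
      (pick t).x t = E.x t ∧ (pick t).θ t = E.θ t := by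
    intro E hE t h0 ht
    have h : ∃ E ∈ c, (t : EReal) < E.horizon := ⟨E, hE, ht⟩
    refine hagree E hE _ (hpickc t) t h0 ht ?_
    simp only [pick, dif_pos h]; exact h.choose_spec.2
  have hle : ∀ E ∈ c, E.horizon ≤ sSup (horizon '' c) := fun E hE => le_sSup ⟨E, hE, rfl⟩
  obtain ⟨U, hU, hUx, hUθ⟩ := exists_glue (P := P) (D := D) (S := S)
    (H := sSup (horizon '' c)) (E₀.horizon_nonneg.trans (hle E₀ hE₀))
    (x := fun t => (pick t).x t) (θ := fun t => (pick t).θ t) (pick 0).x_init (pick 0).θ_init (by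
      intro t h0 ht
      obtain ⟨_, ⟨E, hE, rfl⟩, hlt⟩ := lt_sSup_iff.1 ht
      exact ⟨E, hlt, hle E hE, hpick E hE⟩)
  refine ⟨U, fun E hE => ⟨hU ▸ hle E hE, fun t h0 ht => ?_⟩⟩
  rw [hUx, hUθ]
  exact hpick E hE t h0 ht

theorem exists_isMaximal (P : Plant n) (D : Design n) (S : CodedScheme) :
    ∃ E : Execution P D S, E.IsMaximal := by
  obtain ⟨M, hM⟩ := exists_maximal_of_chains_bounded (r := Continues (P := P) (D := D) (S := S))
    (fun c hc => exists_upper_bound hc)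
    (fun {a b c} hab hbc => ⟨hab.1.trans hbc.1, fun t h0 h1 => by
      obtain ⟨h2, h3⟩ := hab.2 t h0 h1
      obtain ⟨h4, h5⟩ := hbc.2 t h0 (h1.trans_le hab.1)
      exact ⟨h4.trans h2, h5.trans h3⟩⟩)
  refine ⟨M, ?_⟩
  rintro ⟨E', h1, h2⟩
  exact absurd (hM E' ⟨h1.le, h2⟩).1 (not_le.2 h1)

end Execution

namespace Design

variable {n : ℕ} [NeZero n] {D : Design n} {P : Plant n}

theorem continuousOn_point (hA : StandingAssumptions P D) :
    ContinuousOn (fun q : ℝ × (Fin n → ℝ) × (Fin n → ℝ) => D.point q.1 q.2.1 q.2.2)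
      (Ici 0 ×ˢ univ) := by
  have hf : MapsTo Prod.fst (Ici (0 : ℝ) ×ˢ (univ : Set ((Fin n → ℝ) × (Fin n → ℝ)))) (Ici 0) :=
    fun q hq => hq.1
  rw [continuousOn_pi]
  rintro (i | i | k | k | k | k)
  · exact Continuous.continuousOn (by simp only [point]; fun_prop)
  · exact Continuous.continuousOn (by simp only [point]; fun_prop)
  · exact (continuousOn_timeDeriv hA.reference.smooth (Nat.lt_succ_iff.1 k.isLt)).comp
      continuousOn_fst hf
  · have h : Continuous (iteratedDeriv k.val D.ρ) :=
      continuous_iff_continuousAt.2 fun t => (D.hasDerivAt_iteratedDeriv_ρ k.val t).continuousAt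
    exact (h.comp continuous_fst).continuousOn
  · exact (continuousOn_timeDeriv hA.auxiliary.smooth.1 k.isLt.le).comp continuousOn_fst hf
  · exact (continuousOn_timeDeriv hA.auxiliary.smooth.2 k.isLt.le).comp continuousOn_fst hf

/-- The closed loop with a constant input `a` has local solutions from every safe value. -/
theorem exists_local_trajectory (hA : StandingAssumptions P D) {h : ℝ} (hh : 0 ≤ h)
    {x₀ θ₀ : Fin n → ℝ} (hs : D.point h x₀ θ₀ ∈ D.safe) (a : ℝ) :
    ∃ ε > 0, ∃ x θ : ℝ → Fin n → ℝ, x h = x₀ ∧ θ h = θ₀ ∧ Continuous x ∧ Continuous θ ∧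
      ∀ t ∈ Icc h (h + ε), D.point t (x t) (θ t) ∈ D.safe ∧
        ∀ i, HasDerivAt (fun s => x s i) (P.rhs (x t) a i) t ∧
          HasDerivAt (fun s => θ s i) (D.rate i (D.point t (x t) (θ t))) t := by
  let y₀ : Fin n ⊕ Fin n → ℝ := Sum.elim x₀ θ₀
  let q : ℝ × (Fin n ⊕ Fin n → ℝ) → ℝ × (Fin n → ℝ) × (Fin n → ℝ) := fun p =>
    (p.1, fun i => p.2 (.inl i), fun i => p.2 (.inr i))
  have hq : Continuous q := by fun_prop
  let pnt : ℝ × (Fin n ⊕ Fin n → ℝ) → Var n → ℝ := fun p => D.point (q p).1 (q p).2.1 (q p).2.2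
  have hpnt : ContinuousOn pnt (Ici 0 ×ˢ univ) :=
    (continuousOn_point hA).comp hq.continuousOn fun p hp => ⟨hp.1, mem_univ _⟩
  have hmem : (h, y₀) ∈ (Ici (0 : ℝ) ×ˢ univ : Set (ℝ × (Fin n ⊕ Fin n → ℝ))) :=
    ⟨hh, mem_univ _⟩
  have hnear : pnt ⁻¹' D.safe ∈ 𝓝[Ici 0 ×ˢ univ] (h, y₀) :=
    (hpnt _ hmem).preimage_mem_nhdsWithin (D.isOpen_safe.mem_nhds hs)
  obtain ⟨δ, hδ, hball⟩ := Metric.mem_nhdsWithin_iff.1 hnear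
  set r : ℝ := δ / 2 with hr
  have hr0 : 0 < r := half_pos hδ
  have hbox : ∀ p ∈ Icc h (h + r) ×ˢ Icc (fun i => y₀ i - r) (fun i => y₀ i + r),
      p ∈ (Ici (0 : ℝ) ×ˢ univ : Set (ℝ × (Fin n ⊕ Fin n → ℝ))) ∧ pnt p ∈ D.safe := by
    rintro ⟨t, y⟩ ⟨ht, hy⟩
    have h0 : (t, y) ∈ (Ici (0 : ℝ) ×ˢ univ : Set (ℝ × (Fin n ⊕ Fin n → ℝ))) :=
      ⟨hh.trans ht.1, mem_univ _⟩
    refine ⟨h0, hball ⟨?_, h0⟩⟩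
    rw [Metric.mem_ball, Prod.dist_eq]
    have h1 : dist t h ≤ r := by
      rw [Real.dist_eq, abs_le]
      constructor <;> linarith [ht.1, ht.2]
    have h2 : dist y y₀ ≤ r := by
      rw [dist_pi_le_iff hr0.le]
      intro i
      rw [Real.dist_eq, abs_le]
      have h3 := hy.1 i
      have h4 := hy.2 i
      dsimp only at h3 h4
      constructor <;> linarith
    exact (max_le h1 h2).trans_lt (by linarith)
  let F : ℝ × (Fin n ⊕ Fin n → ℝ) → Fin n ⊕ Fin n → ℝ := fun p =>
    Sum.elim (fun i => P.rhs (fun j => p.2 (.inl j)) a i) (fun i => D.rate i (pnt p))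
  have hF : ContinuousOn F (Icc h (h + r) ×ˢ Icc (fun i => y₀ i - r) (fun i => y₀ i + r)) := by
    rw [continuousOn_pi]
    rintro (i | i)
    · exact ((Plant.continuous_rhs hA i).comp (f := fun p : ℝ × (Fin n ⊕ Fin n → ℝ) =>
        (fun j => p.2 (.inl j), a)) (by fun_prop)).continuousOn
    · exact (contDiffOn_rate hA.smooth_φ i).continuousOn.comp
        (hpnt.mono fun p hp => (hbox p hp).1) fun p hp => (hbox p hp).2
  obtain ⟨ε, hε, y, hεr, hy0, hyc, hy⟩ := exists_local_solution hr0 hF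
  refine ⟨ε, hε, fun t i => y t (.inl i), fun t i => y t (.inr i), ?_, ?_, by fun_prop,
    by fun_prop, fun t ht => ?_⟩
  · funext i; exact congrFun hy0 (.inl i)
  · funext i; exact congrFun hy0 (.inr i)
  · obtain ⟨h1, h2⟩ := hy t ht
    rw [hasDerivAt_pi] at h2
    refine ⟨(hbox (t, y t) ⟨⟨ht.1, by linarith [ht.2]⟩, h1⟩).2, fun i => ⟨?_, ?_⟩⟩
    · exact h2 (.inl i)
    · exact h2 (.inr i)

end Design

namespace Execution

variable {n : ℕ} [NeZero n] {P : Plant n} {D : Design n} {S : CodedScheme}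

/-! ### Continuation beyond a finite horizon -/

/-- The trajectory of an execution has a limit at a finite horizon, with a safe value. -/
theorem exists_limit (hA : StandingAssumptions P D) (E : Execution P D S) {h : ℝ}
    (hE : E.horizon = h) (hh : 0 ≤ h) :
    ∃ X Θ : ℝ → Fin n → ℝ, Continuous X ∧ Continuous Θ ∧ X 0 = D.xinit ∧ Θ 0 = D.θinit ∧
      (∀ t : ℝ, 0 ≤ t → t < h → X t = E.x t ∧ Θ t = E.θ t) ∧ D.point h (X h) (Θ h) ∈ D.safe := by
  rcases hh.eq_or_lt with rfl | hpos
  · exact ⟨fun _ => D.xinit, fun _ => D.θinit, continuous_const, continuous_const, rfl, rfl,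
      fun t h0 h1 => absurd h1 (not_lt.2 h0), Design.point_zero_mem_safe hA⟩
  obtain ⟨L, hL0, hL⟩ := exists_lipschitz_pt P D S hA
  obtain ⟨K, hK, hKs, hmem⟩ := exists_compact P D S hA
  have hdom : ∀ t, t ∈ E.domain ↔ 0 ≤ t ∧ t < h := fun t => by
    rw [domain, mem_ofPred_eq, hE, EReal.coe_lt_coe_iff]
  have hx : LipschitzOnWith ⟨L, hL0⟩ E.x E.domain := LipschitzOnWith.of_dist_le_mul
    fun s hs t ht => (dist_pi_le_iff (by positivity)).2 fun i =>
      (dist_le_pi_dist (E.pt s) (E.pt t) (.state i)).trans (hL E s hs t ht)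
  have hθ : LipschitzOnWith ⟨L, hL0⟩ E.θ E.domain := LipschitzOnWith.of_dist_le_mul
    fun s hs t ht => (dist_pi_le_iff (by positivity)).2 fun i =>
      (dist_le_pi_dist (E.pt s) (E.pt t) (.est i)).trans (hL E s hs t ht)
  obtain ⟨X, hXl, hX⟩ := hx.extend_pi
  obtain ⟨Θ, hΘl, hΘ⟩ := hθ.extend_pi
  have h0 : (0 : ℝ) ∈ E.domain := (hdom 0).2 ⟨le_rfl, hpos⟩
  refine ⟨X, Θ, hXl.continuous, hΘl.continuous, (hX h0).symm.trans E.x_init,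
    (hΘ h0).symm.trans E.θ_init,
    fun t h1 h2 => ⟨(hX ((hdom t).2 ⟨h1, h2⟩)).symm, (hΘ ((hdom t).2 ⟨h1, h2⟩)).symm⟩, ?_⟩
  have hlim : Tendsto (fun t => D.point t (X t) (Θ t)) (𝓝[<] h) (𝓝 (D.point h (X h) (Θ h))) := by
    have h1 : ContinuousWithinAt (fun t => D.point t (X t) (Θ t)) (Ici 0) h :=
      ContinuousOn.comp (f := fun t => (t, X t, Θ t)) (s := Ici (0 : ℝ))
        (Design.continuousOn_point hA)
        (continuous_id.prodMk (hXl.continuous.prodMk hΘl.continuous)).continuousOn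
        (fun t ht => ⟨ht, mem_univ _⟩) h hh
    exact h1.mono_left (nhdsWithin_le_of_mem (mem_nhdsWithin_of_mem_nhds (Ici_mem_nhds hpos)))
  refine hKs (hK.isClosed.mem_of_tendsto hlim ?_)
  filter_upwards [Ico_mem_nhdsLT hpos] with t ht
  have := hmem E t ((hdom t).2 ht)
  rwa [pt, hX ((hdom t).2 ht), hΘ ((hdom t).2 ht)] at this

/-- Before a finite horizon there are only finitely many events. -/
theorem exists_last_event (hA : StandingAssumptions P D) (E : Execution P D S) {h : ℝ}
    (hE : E.horizon = h) : ∃ N, E.event N ≠ ⊤ ∧ E.event (N + 1) = ⊤ := by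
  classical
  obtain ⟨τ, hτ, hgap⟩ := exists_minimal_time P D S hA
  have hlow : ∀ k : ℕ, ((k * τ : ℝ) : EReal) ≤ E.event k := by
    intro k
    induction k with
    | zero => rw [E.event_zero]; simp
    | succ k ih =>
      refine le_trans ?_ (hgap E k)
      have : ((((k + 1 : ℕ) : ℝ) * τ : ℝ) : EReal) = ((k * τ : ℝ) : EReal) + (τ : EReal) := by
        rw [← EReal.coe_add]; congr 1; push_cast; ring
      rw [this]
      gcongr
  have hex : ∃ k, E.event (k + 1) = ⊤ := by
    obtain ⟨k, hk⟩ := exists_nat_gt (h / τ)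
    refine ⟨k, ?_⟩
    by_contra hne
    have h1 := E.event_lt_horizon hne
    have h2 := (hlow k).trans ((E.event_le_succ k).trans h1.le)
    rw [hE, EReal.coe_le_coe_iff] at h2
    rw [div_lt_iff₀ hτ] at hk
    linarith
  refine ⟨Nat.find hex, ?_, Nat.find_spec hex⟩
  rcases Nat.eq_zero_or_pos (Nat.find hex) with h0 | h0
  · rw [h0, E.event_zero]; exact EReal.zero_ne_top
  · have := Nat.find_min hex (Nat.sub_lt h0 one_pos)
    rwa [show Nat.find hex - 1 + 1 = Nat.find hex from Nat.sub_add_cancel h0] at this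

/-- An execution with a finite horizon is not maximal: at the horizon the input is kept, or renewed
if the threshold is reached there, and Peano's theorem continues the trajectory. -/
theorem not_isMaximal_of_finite_horizon (hA : StandingAssumptions P D) (E : Execution P D S) {h : ℝ}
    (hE : E.horizon = h) : ¬ E.IsMaximal := by
  have hh : 0 ≤ h := by
    have := E.horizon_nonneg
    rw [hE] at this
    exact_mod_cast this
  obtain ⟨X, Θ, hXc, hΘc, hX0, hΘ0, hXE, hsafe⟩ := exists_limit hA E hE hh
  obtain ⟨N, hN, hN1⟩ := exists_last_event hA E hE
  set s := (E.event N).toReal with hs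
  have hsc := E.coe_toReal_event hN
  have hs0 : 0 ≤ s := EReal.toReal_nonneg (E.event_nonneg N)
  -- the stored input, and the input from time `h` on
  set a₀ := E.v s with ha₀
  set vh := controlOf D X Θ h with hvh
  obtain ⟨a, ha, haa⟩ : ∃ a, (a = a₀ ∧ |vh - a₀| < S.threshold a₀ ∨
      a = vh ∧ S.threshold a₀ ≤ |vh - a₀|) ∧ |vh - a| < S.threshold a := by
    by_cases hc : |vh - a₀| < S.threshold a₀
    · exact ⟨a₀, Or.inl ⟨rfl, hc⟩, hc⟩
    · exact ⟨vh, Or.inr ⟨rfl, not_lt.1 hc⟩, by simpa using S.threshold_pos vh⟩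
  obtain ⟨ε₁, hε₁, Y, Ψ, hY, hΨ, hYc, hΨc, hYd⟩ :=
    Design.exists_local_trajectory (P := P) hA hh hsafe a
  -- the continued trajectory
  let x : ℝ → Fin n → ℝ := fun t => if t ≤ h then X t else Y t
  let θ : ℝ → Fin n → ℝ := fun t => if t ≤ h then Θ t else Ψ t
  have hxc : Continuous x := hXc.if_le hYc continuous_id continuous_const fun t ht => by
    rw [show t = h from ht, hY]
  have hθc : Continuous θ := hΘc.if_le hΨc continuous_id continuous_const fun t ht => by
    rw [show t = h from ht, hΨ]
  have hxl : ∀ t ≤ h, x t = X t ∧ θ t = Θ t := fun t ht => ⟨if_pos ht, if_pos ht⟩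
  have hxr : ∀ t, h ≤ t → x t = Y t ∧ θ t = Ψ t := by
    intro t ht
    rcases ht.eq_or_lt with rfl | hlt
    · rw [(hxl h le_rfl).1, (hxl h le_rfl).2, hY, hΨ]; exact ⟨rfl, rfl⟩
    · exact ⟨if_neg (not_le.2 hlt), if_neg (not_le.2 hlt)⟩
  have hx0 : x 0 = D.xinit := (hxl 0 hh).1.trans hX0
  have hθ0 : θ 0 = D.θinit := (hxl 0 hh).2.trans hΘ0
  have hrestr : ∀ t : ℝ, 0 ≤ t → (t : EReal) < E.horizon → x t = E.x t ∧ θ t = E.θ t := by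
    intro t h0 h1
    rw [hE, EReal.coe_lt_coe_iff] at h1
    rw [(hxl t h1.le).1, (hxl t h1.le).2]
    exact hXE t h0 h1
  set v := controlOf D x θ with hv
  have hvh' : v h = vh := by
    simp only [hv, hvh, controlOf, (hxl h le_rfl).1, (hxl h le_rfl).2]
  -- no event happens for a while after `h`
  obtain ⟨ε, hε, hε1, hquiet⟩ : ∃ ε > 0, ε ≤ ε₁ ∧ ∀ t, h ≤ t → t < h + ε →
      |v t - a| < S.threshold a := by
    have hvc : ContinuousWithinAt v (Ici h) h := by
      have h1 : ContinuousWithinAt (fun t => D.point t (x t) (θ t)) (Ici h) h :=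
        (ContinuousOn.comp (f := fun t => (t, x t, θ t)) (s := Ici (0 : ℝ))
          (Design.continuousOn_point hA)
          (continuous_id.prodMk (hxc.prodMk hθc)).continuousOn
          (fun t ht => ⟨ht, mem_univ _⟩) h hh).mono (Ici_subset_Ici.2 hh)
      have h2 : ContinuousAt (D.control (Design.top n)) (D.point h (x h) (θ h)) := by
        rw [(hxl h le_rfl).1, (hxl h le_rfl).2]
        exact (Design.contDiffOn_control hA.smooth_φ _).continuousOn.continuousAt
          (D.isOpen_safe.mem_nhds hsafe)
      exact ContinuousAt.comp_continuousWithinAt (g := D.control (Design.top n))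
        (f := fun t => D.point t (x t) (θ t)) h2 h1
    have h3 : ∀ᶠ t in 𝓝[≥] h, |v t - a| < S.threshold a := by
      have h4 : ContinuousWithinAt (fun t => |v t - a|) (Ici h) h :=
        (hvc.sub continuousWithinAt_const).abs
      exact h4.eventually (gt_mem_nhds (by beta_reduce; rw [hvh']; exact haa))
    obtain ⟨b, hb, hsub⟩ := mem_nhdsGE_iff_exists_Ico_subset.1 h3
    refine ⟨min (b - h) ε₁, lt_min (sub_pos.2 hb) hε₁, min_le_right _ _, fun t h5 h6 => ?_⟩
    exact hsub ⟨h5, by linarith [min_le_left (b - h) ε₁]⟩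
  set H : EReal := ((h + ε : ℝ) : EReal) with hH
  have hhH : E.horizon < H := by
    rw [hE, hH, EReal.coe_lt_coe_iff]; linarith
  -- the events of the continued trajectory
  have hvE : ∀ t : ℝ, 0 ≤ t → (t : EReal) < E.horizon → E.v t = v t := by
    intro t h0 h1
    rw [E.v_eq, hv, controlOf, (hrestr t h0 h1).1, (hrestr t h0 h1).2]
  have hvE0 : E.v 0 = v 0 := by
    rw [E.v_eq, hv, controlOf, hx0, hθ0, E.x_init, E.θ_init]
  obtain ⟨hevN, hNlt⟩ : E.event N = eventSeq S H v N ∧ (E.event N < E.horizon ∨ N = 0) := by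
    have := eventSeq_congr (S := S) hhH.le hvE0 hvE N
    rw [← E.event_eq_eventSeq] at this
    rcases this with h1 | h1
    · exact h1
    · exact absurd h1.1 hN
  have hevN1 : (h : EReal) ≤ eventSeq S H v (N + 1) := by
    have := eventSeq_congr (S := S) hhH.le hvE0 hvE (N + 1)
    rw [← E.event_eq_eventSeq, hE] at this
    rcases this with h1 | h1
    · rw [← h1.1, hN1]; exact le_top
    · exact h1.2
  have hsh : s ≤ h := by
    rcases hNlt with h1 | h1
    · rw [hE, ← hsc, EReal.coe_lt_coe_iff] at h1
      exact h1.le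
    · rw [hs, h1, E.event_zero]; simpa using hh
  have hvs : v (eventSeq S H v N).toReal = a₀ := by
    rw [← hevN, ← hs, ha₀]
    rcases hNlt with h1 | h1
    · exact (hvE s hs0 (by rw [hsc]; exact h1)).symm
    · have : s = 0 := by rw [hs, h1, E.event_zero]; simp
      rw [this, hvE0]
  obtain ⟨k, hk1, hk2, hk3⟩ : ∃ k, eventSeq S H v k ≤ h ∧ eventSeq S H v (k + 1) = ⊤ ∧
      v (eventSeq S H v k).toReal = a := by
    have hnone : ∀ k, v (eventSeq S H v k).toReal = a → (h : EReal) ≤ eventSeq S H v (k + 1) →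
        eventSeq S H v (k + 1) = ⊤ := by
      intro k hk hle
      change sInf _ = ⊤
      rw [sInf_eq_top]
      rintro r ⟨t, rfl, h1, h2, h3⟩
      exfalso
      rw [hk] at h3
      have h4 : h ≤ t := by
        have h5 : eventSeq S H v (k + 1) ≤ t := sInf_le ⟨t, rfl, h1, h2, by rw [hk]; exact h3⟩
        exact_mod_cast hle.trans h5
      have h6 : t < h + ε := EReal.coe_lt_coe_iff.1 h2
      exact absurd h3 (not_le.2 (hquiet t h4 h6))
    rcases ha with ⟨rfl, -⟩ | ⟨rfl, hthr⟩
    · refine ⟨N, ?_, hnone N hvs hevN1, hvs⟩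
      rw [← hevN, ← hsc, EReal.coe_le_coe_iff]
      exact hsh
    · have hne : s ≠ h := by
        intro hsh'
        have h1 : a₀ = vh := by rw [← hvs, ← hevN, ← hs, hsh', hvh']
        rw [h1, sub_self, abs_zero] at hthr
        exact absurd hthr (not_le.2 (S.threshold_pos _))
      have hev : eventSeq S H v (N + 1) = h := by
        refine le_antisymm (sInf_le ⟨h, rfl, ?_, ?_, ?_⟩) hevN1
        · rw [← hevN, ← hsc, EReal.coe_lt_coe_iff]
          exact lt_of_le_of_ne hsh hne
        · rw [← hE]; exact hhH
        · rw [hvs, hvh']; exact hthr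
      have hva : v (eventSeq S H v (N + 1)).toReal = vh := by
        rw [hev, EReal.toReal_coe, hvh']
      exact ⟨N + 1, hev.le, hnone (N + 1) hva
        (hev.ge.trans (monotone_eventSeq (Nat.le_succ _))), hva⟩
  intro hmax
  apply hmax
  obtain ⟨E', hE', hEx, hEθ⟩ := exists_of_trajectory (P := P) (S := S) (H := H)
    (E.horizon_nonneg.trans hhH.le) hx0 hθ0 hxc.continuousOn hθc.continuousOn (by
      intro t h0 ht
      rcases lt_or_ge t h with hth | hth
      · exact E.trajectory_of_restriction hhH.le hx0 hθ0 hrestr h0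
          (by rw [hE, EReal.coe_lt_coe_iff]; exact hth)
      · have htε : t < h + ε := EReal.coe_lt_coe_iff.1 ht
        refine ⟨k, hk1.trans (EReal.coe_le_coe_iff.2 hth), ?_, fun i => ?_⟩
        · change _ < eventSeq S H v (k + 1)
          rw [hk2]; exact EReal.coe_lt_top t
        · obtain ⟨-, hd⟩ := hYd t ⟨hth, by linarith⟩
          change HasDerivWithinAt (fun s => x s i)
            (P.rhs (x t) (v (eventSeq S H v k).toReal) i) (Ici t) t ∧ _
          rw [hk3, (hxr t hth).1, (hxr t hth).2]
          exact ⟨(hd i).1.hasDerivWithinAt.congr (fun r hr => by rw [(hxr r (hth.trans hr)).1])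
              (by rw [(hxr t hth).1]),
            (hd i).2.hasDerivWithinAt.congr (fun r hr => by rw [(hxr r (hth.trans hr)).2])
              (by rw [(hxr t hth).2])⟩)
  refine ⟨E', by rw [hE']; exact hhH, fun t h0 ht => ?_⟩
  rw [hEx, hEθ]
  exact hrestr t h0 ht

theorem horizon_eq_top (hA : StandingAssumptions P D) (E : Execution P D S) (hE : E.IsMaximal) :
    E.horizon = ⊤ := by
  by_contra hne
  have hb : E.horizon ≠ ⊥ := fun hb => by
    have := E.horizon_nonneg
    rw [hb] at this
    simp at this
  exact not_isMaximal_of_finite_horizon hA E (EReal.coe_toReal hne hb).symm hE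

end Execution

/-! ### The transmitted strings -/

namespace CodedScheme

variable (S : CodedScheme)

theorem sum_digits (p : ℕ) (hp : 0 < p) (N m : ℕ) (hN : N < p ^ m) :
    ∑ j : Fin m, N / p ^ j.val % p * p ^ j.val = N := by
  induction m generalizing N with
  | zero => simp at hN; simp [hN]
  | succ m ih =>
    rw [Fin.sum_univ_succ]
    have h1 : N / p < p ^ m := by
      rw [Nat.div_lt_iff_lt_mul hp]
      rwa [pow_succ] at hN
    have h2 := ih (N / p) h1
    have h3 : ∀ j : Fin m, N / p ^ (j.succ : ℕ) % p * p ^ (j.succ : ℕ) =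
        N / p / p ^ j.val % p * p ^ j.val * p := fun j => by
      rw [Fin.val_succ, Nat.div_div_eq_div_mul, pow_succ, mul_comm p]
      ring
    rw [Finset.sum_congr rfl fun j _ => h3 j, ← Finset.sum_mul, h2]
    simp only [Fin.val_zero, pow_zero, Nat.div_one, mul_one]
    rw [mul_comm]
    exact Nat.mod_add_div N p

/-- The string determines the sign and the level, so that the actuator moves its stored input by
exactly the threshold. -/
theorem decode_encode {q : ℕ} (hq : q < S.sc) (d a : ℝ) :
    S.decode (S.encode d q) a = if 0 < d then a + S.step q else a - S.step q := by
  have hsc := S.two_mul_sc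
  have hp := S.p_pos
  set M : ℕ := if 0 < d then q else q + S.sc with hM
  have hMlt : M < S.p ^ S.m := by
    rw [hM]; split_ifs <;> omega
  have hval : S.value (S.encode d q) = M := by
    simp only [value, encode]
    rw [← hM]
    exact sum_digits S.p hp M S.m hMlt
  -- `s_c` is half of `p` times the weight of the leading digit
  obtain ⟨m, hm⟩ : ∃ m, S.m = m + 1 := Nat.exists_eq_succ_of_ne_zero S.m_pos.ne'
  obtain ⟨b, hb⟩ := S.p_even
  have hhalf : S.p / 2 = b := by omega
  have hscb : S.sc = b * S.p ^ m := by
    rw [hm, pow_succ] at hsc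
    have h3 : S.p ^ m * S.p = 2 * (b * S.p ^ m) := by
      have h4 : S.p = 2 * b := by omega
      calc S.p ^ m * S.p = S.p ^ m * (2 * b) := congrArg _ h4
        _ = 2 * (b * S.p ^ m) := by ring
    omega
  have hpm : 0 < S.p ^ m := pow_pos hp m
  have hlead : (S.encode d q ⟨S.m - 1, Nat.sub_lt S.m_pos Nat.one_pos⟩).val = M / S.p ^ m := by
    simp only [encode]
    rw [← hM, hm, Nat.add_sub_cancel, Nat.mod_eq_of_lt]
    rw [Nat.div_lt_iff_lt_mul hpm, mul_comm, ← pow_succ, ← hm]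
    exact hMlt
  have hiff : M / S.p ^ m < S.p / 2 ↔ 0 < d := by
    rw [hhalf, Nat.div_lt_iff_lt_mul hpm, ← hscb, hM]
    split_ifs with h
    · exact ⟨fun _ => h, fun _ => hq⟩
    · exact ⟨fun h' => by omega, fun h' => absurd h' h⟩
  rw [decode, hlead, hval]
  by_cases h : 0 < d
  · rw [if_pos (hiff.2 h), if_pos h, hM, if_pos h]
  · rw [if_neg (fun h' => h (hiff.1 h')), if_neg h, hM, if_neg h, Nat.add_sub_cancel]

end CodedScheme

namespace Execution

variable {n : ℕ} [NeZero n] {P : Plant n} {D : Design n} {S : CodedScheme}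

theorem continuousOn_v (hA : StandingAssumptions P D) (E : Execution P D S) :
    ContinuousOn E.v E.domain := by
  obtain ⟨K, -, hKs, hmem⟩ := exists_compact P D S hA
  rw [show E.v = D.control (Design.top n) ∘ E.pt from funext E.v_eq_control]
  exact (Design.contDiffOn_control hA.smooth_φ _).continuousOn.comp (E.continuousOn_pt hA)
    fun t ht => hKs (hmem E t ht)

/-- By continuity the control signal has moved by exactly the threshold when an event happens. -/
theorem abs_sample_sub (hA : StandingAssumptions P D) (E : Execution P D S) (hE : E.horizon = ⊤)
    {k : ℕ} (hk : E.event (k + 1) < ⊤) :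
    |E.sample (k + 1) - E.sample k| = S.threshold (E.sample k) := by
  have hk0 : E.event k ≠ ⊤ := ((E.event_le_succ k).trans_lt hk).ne
  set a := (E.event k).toReal with ha
  set b := (E.event (k + 1)).toReal with hb
  have hca := E.coe_toReal_event hk0
  have hcb := E.coe_toReal_event hk.ne
  have ha0 : 0 ≤ a := EReal.toReal_nonneg (E.event_nonneg k)
  have hdom : ∀ t, 0 ≤ t → t ∈ E.domain := fun t ht => ⟨ht, by rw [hE]; exact EReal.coe_lt_top t⟩
  set φ : ℝ → ℝ := fun t => |E.v t - E.v a| with hφ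
  have hφc : ContinuousOn φ (Ici 0) := fun t ht =>
    ((((E.continuousOn_v hA) t (hdom t ht)).mono fun r hr => hdom r hr).sub
      continuousWithinAt_const).abs
  set A : Set ℝ := {t | a < t ∧ S.threshold (E.v a) ≤ φ t} with hA'
  have hev : ∀ t ∈ A, b ≤ t := by
    rintro t ⟨h1, h2⟩
    rw [← EReal.coe_le_coe_iff, hcb, E.event_succ]
    exact sInf_le ⟨t, rfl, by rw [← hca, EReal.coe_lt_coe_iff]; exact h1,
      (hdom t (ha0.trans h1.le)).2, h2⟩
  have happrox : ∀ r, b < r → ∃ t ∈ A, t < r := by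
    intro r hr
    have h1 : E.event (k + 1) < r := by rw [← hcb, EReal.coe_lt_coe_iff]; exact hr
    rw [E.event_succ, sInf_lt_iff] at h1
    obtain ⟨_, ⟨t, rfl, h2, -, h3⟩, h4⟩ := h1
    refine ⟨t, ⟨?_, h3⟩, by exact_mod_cast h4⟩
    rw [← hca, EReal.coe_lt_coe_iff] at h2
    exact h2
  have hab : a ≤ b := by
    rw [← EReal.coe_le_coe_iff, hca, hcb]; exact E.event_le_succ k
  have hb0 : 0 ≤ b := ha0.trans hab
  have hge : S.threshold (E.v a) ≤ φ b := by
    by_contra hcon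
    push Not at hcon
    have h1 : ∀ᶠ t in 𝓝[≥] b, φ t < S.threshold (E.v a) :=
      ((hφc b hb0).mono (Ici_subset_Ici.2 hb0)).eventually (gt_mem_nhds hcon)
    obtain ⟨r, hr, hsub⟩ := mem_nhdsGE_iff_exists_Ico_subset.1 h1
    obtain ⟨t, htA, htr⟩ := happrox r hr
    exact absurd htA.2 (not_le.2 (hsub ⟨hev t htA, htr⟩))
  have hab' : a < b := by
    refine lt_of_le_of_ne hab fun h => ?_
    have h1 : φ b = 0 := by simp [hφ, ← h]
    rw [h1] at hge
    exact absurd hge (not_le.2 (S.threshold_pos _))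
  have hle : φ b ≤ S.threshold (E.v a) := by
    have h1 : Tendsto φ (𝓝[<] b) (𝓝 (φ b)) :=
      (hφc b hb0).mono_left (nhdsWithin_le_of_mem
        (mem_nhdsWithin_of_mem_nhds (Ici_mem_nhds (ha0.trans_lt hab'))))
    refine le_of_tendsto h1 ?_
    filter_upwards [Ioo_mem_nhdsLT hab'] with t ht
    by_contra hcon
    push Not at hcon
    exact absurd (hev t ⟨ht.1, hcon.le⟩) (not_le.2 ht.2)
  exact le_antisymm hle hge

theorem decoded_eq_sample (hA : StandingAssumptions P D) (E : Execution P D S)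
    (hE : E.horizon = ⊤) (k : ℕ) (hk : E.event k < ⊤) : E.decoded k = E.sample k := by
  induction k with
  | zero => rfl
  | succ k ih =>
    have h1 := E.abs_sample_sub hA hE hk
    have h2 := S.threshold_pos (E.sample k)
    rw [decoded, ih ((E.event_le_succ k).trans_lt hk), codeword, S.decode_encode (S.level_lt _)]
    change (if 0 < E.sample (k + 1) - E.sample k then E.sample k + S.threshold (E.sample k)
      else E.sample k - S.threshold (E.sample k)) = _
    split_ifs with h
    · rw [abs_of_pos h] at h1; linarith
    · rw [abs_of_nonpos (not_lt.1 h)] at h1; linarith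

/-! ### The closed loop -/

theorem exists_bound_signals (hA : StandingAssumptions P D) (E : Execution P D S)
    (hE : E.horizon = ⊤) : ∃ M : ℝ, ∀ t : ℝ, 0 ≤ t →
        |E.trackingError t| ≤ M ∧ |E.v t| ≤ M ∧ |E.u t| ≤ M ∧
        |D.μ₁ (E.pt t)| ≤ M ∧ |D.μ₂ (E.pt t)| ≤ M ∧
        ∀ i, |E.x t i| ≤ M ∧ |E.θ t i| ≤ M ∧ |D.rate i (E.pt t)| ≤ M ∧
          |D.err i (E.pt t)| ≤ M ∧ |D.Φ i (E.pt t)| ≤ M ∧ |D.control i (E.pt t)| ≤ M := by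
  obtain ⟨K, hK, hKs, hmem⟩ := exists_compact P D S hA
  obtain ⟨Mu, hMu⟩ := exists_bound_u (S := S) hA
  have hfam : ∀ F : Fin n → (Var n → ℝ) → ℝ, (∀ i, ContinuousOn (F i) D.safe) →
      ∃ M : ℝ, 0 ≤ M ∧ ∀ w ∈ K, ∀ i, |F i w| ≤ M := by
    intro F hF
    obtain ⟨M, hM⟩ := hK.exists_bound_of_continuousOn (f := fun w i => F i w)
      (continuousOn_pi.2 fun i => (hF i).mono hKs)
    exact ⟨|M|, abs_nonneg _, fun w hw i =>
      ((norm_le_pi_norm (fun i => F i w) i).trans (hM w hw)).trans (le_abs_self M)⟩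
  obtain ⟨M1, p1, h1⟩ := hfam (fun _ => Design.e₁) fun _ =>
    Design.contDiff_e₁.continuous.continuousOn
  obtain ⟨M2, p2, h2⟩ := hfam (fun _ => D.μ₁) fun _ => Design.contDiffOn_μ₁.continuousOn
  obtain ⟨M3, p3, h3⟩ := hfam (fun _ => D.μ₂) fun _ => Design.contDiffOn_μ₂.continuousOn
  obtain ⟨M4, p4, h4⟩ := hfam (fun i w => w (.state i)) fun i => (continuous_apply _).continuousOn
  obtain ⟨M5, p5, h5⟩ := hfam (fun i w => w (.est i)) fun i => (continuous_apply _).continuousOn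
  obtain ⟨M6, p6, h6⟩ := hfam D.rate fun i => (Design.contDiffOn_rate hA.smooth_φ i).continuousOn
  obtain ⟨M7, p7, h7⟩ := hfam D.err fun i => (Design.contDiffOn_err hA.smooth_φ i).continuousOn
  obtain ⟨M8, p8, h8⟩ := hfam D.Φ fun i => (Design.contDiffOn_Φ hA.smooth_φ i).continuousOn
  obtain ⟨M9, p9, h9⟩ := hfam D.control fun i =>
    (Design.contDiffOn_control hA.smooth_φ i).continuousOn
  refine ⟨M1 + M2 + M3 + M4 + M5 + M6 + M7 + M8 + M9 + |Mu|, fun t ht => ?_⟩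
  have htd : t ∈ E.domain := ⟨ht, by rw [hE]; exact EReal.coe_lt_top t⟩
  have hw := hmem E t htd
  have hu := (hMu E t htd).trans (le_abs_self Mu)
  have pu := abs_nonneg Mu
  have he : E.trackingError t = Design.e₁ (E.pt t) := (D.e₁_point t (E.x t) (E.θ t)).symm
  refine ⟨?_, ?_, by linarith, by linarith [h2 _ hw 0], by linarith [h3 _ hw 0], fun i =>
    ⟨?_, ?_, by linarith [h6 _ hw i], by linarith [h7 _ hw i], by linarith [h8 _ hw i],
      by linarith [h9 _ hw i]⟩⟩
  · rw [he]; linarith [h1 _ hw 0]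
  · rw [E.v_eq_control]; linarith [h9 _ hw (Design.top n)]
  · have := h4 _ hw i
    change |E.x t i| ≤ M4 at this
    linarith
  · have := h5 _ hw i
    change |E.θ t i| ≤ M5 at this
    linarith

theorem trackingError_mem (hA : StandingAssumptions P D) (E : Execution P D S) {t : ℝ}
    (ht : t ∈ E.domain) : -(D.lower t - D.ηl t) < E.trackingError t ∧
      E.trackingError t < D.upper t + D.ηu t := by
  obtain ⟨K, -, hKs, hmem⟩ := exists_compact P D S hA
  obtain ⟨h1, h2⟩ := hKs (hmem E t ht)
  rw [pt, Design.Eu_point, Design.e₁_point] at h1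
  rw [pt, Design.El_point, Design.e₁_point] at h2
  rw [trackingError]
  constructor <;> linarith

end Execution

theorem theorem2 {n : ℕ} [NeZero n] (hn : 2 ≤ n)
    (P : Plant n) (D : Design n) (S : CodedScheme)
    (hf : ∀ i, Continuous (P.f i)) (hg : ∀ i, Continuous (P.g i))
    (hyd : IsReference n D.yd)
    (hφ : ∀ i, ContDiff ℝ ∞ (D.φ i) ∧ ∀ ξ, 0 ≤ D.φ i ξ)
    (hfφ : ∀ i, ∃ b : ℝ, 0 ≤ b ∧ ∀ ξ, |P.f i ξ| ≤ b * D.φ i ξ)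
    (hgb : ∀ i, ∃ glo ghi : ℝ, 0 < glo ∧ ∀ ξ, glo ≤ P.g i ξ ∧ P.g i ξ ≤ ghi)
    (hη : D.IsAuxiliary) (hD : D.IsAdmissible) :
    (∃ E : Execution P D S, E.horizon = ⊤) ∧
    ∀ E : Execution P D S, E.IsMaximal →
      E.horizon = ⊤ ∧
      -- performance: the boundaries with auxiliary functions, then entry capture
      (∀ t : ℝ, 0 ≤ t → -(D.lower t - D.ηl t) < E.trackingError t ∧
        E.trackingError t < D.upper t + D.ηu t) ∧
      (∀ t : ℝ, D.T ≤ t → -D.lower t < E.trackingError t ∧ E.trackingError t < D.upper t) ∧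
      -- boundedness of all signals
      (∃ M : ℝ, ∀ t : ℝ, 0 ≤ t →
        |E.trackingError t| ≤ M ∧ |E.v t| ≤ M ∧ |E.u t| ≤ M ∧
        |D.μ₁ (E.pt t)| ≤ M ∧ |D.μ₂ (E.pt t)| ≤ M ∧
        ∀ i, |E.x t i| ≤ M ∧ |E.θ t i| ≤ M ∧ |D.rate i (E.pt t)| ≤ M ∧
          |D.err i (E.pt t)| ≤ M ∧ |D.Φ i (E.pt t)| ≤ M ∧ |D.control i (E.pt t)| ≤ M) ∧
      -- no Zeno behaviour: a positive minimal time between events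
      (∃ τ : ℝ, 0 < τ ∧ ∀ k, E.event k + (τ : EReal) ≤ E.event (k + 1)) ∧
      -- the strings suffice for the actuator to apply the held input
      (∀ k, E.event k < ⊤ → E.decoded k = E.sample k) := by
  have hA : StandingAssumptions P D :=
    ⟨hn, hf, hg, hyd, fun i => (hφ i).1, hfφ, hgb, hη, hD⟩
  refine ⟨?_, fun E hE => ?_⟩
  · obtain ⟨E, hE⟩ := Execution.exists_isMaximal P D S
    exact ⟨E, E.horizon_eq_top hA hE⟩
  have htop := E.horizon_eq_top hA hE
  have hperf : ∀ t : ℝ, 0 ≤ t → -(D.lower t - D.ηl t) < E.trackingError t ∧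
      E.trackingError t < D.upper t + D.ηu t := fun t ht =>
    E.trackingError_mem hA ⟨ht, by rw [htop]; exact EReal.coe_lt_top t⟩
  refine ⟨htop, hperf, fun t ht => ?_, E.exists_bound_signals hA htop, ?_,
    E.decoded_eq_sample hA htop⟩
  · have h1 := hperf t (hD.T_pos.le.trans ht)
    obtain ⟨hu, hl⟩ := hη.eq_zero t ht
    rwa [hu, hl, sub_zero, add_zero] at h1
  · obtain ⟨τ, hτ, h⟩ := Execution.exists_minimal_time P D S hA
    exact ⟨τ, hτ, h E⟩
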